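/- Let $\mathfrak g$ be a simple finite dimensional complex Lie algebra of type $ADE$ and rank $n$, with Cartan subalgebra $\mathfrak h$, Chevalley generators $f_i,h_i,e_i$ ($1\le i\le n$), simple roots $\alpha_i$ and dual Coxeter number $h^\vee$. Let $\widehat{\mathfrak g}=\mathfrak g\otimes\mathbb C[t,t^{-1}]\oplus\mathbb Cc$ be the affine Kac–Moody algebra, put $e=\sum_{i=1}^n e_i$ and $e_0=a\otimes t$, where $a\neq 0$ belongs to the root space of the lowest root of $\mathfrak g$, and let $h\in\mathfrak h$ be the element with $[h,e]=e$ and $[h,e_0]=-(h^\vee-1)e_0$. Let $\ell\in\mathfrak h$, let $M>0$ be real, and for $E\in\mathbb C$ let $p(x,E)=x^{Mh^\vee}-E$. All powers and logarithms of $x$ are the principal ones on $\widetilde{\mathbb C}=\mathbb C\setminus\mathbb R_{\le 0}$. Let $s=\lfloor\frac{M+1}{h^\vee M}\rfloor$ and $$q(x,E)=\sum_{j=0}^{s}c_j(E)\,x^{M(1-h^\vee j)},\qquad c_j(E)=\binom{1/h^\vee}{j}(-E)^j,$$ the truncated expansion of $p(x,E)^{1/h^\vee}$ at infinity (so $c_0=1$).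 Define $S(x,E)=\int_0^x q(y,E)\,dy$ if $\frac{M+1}{h^\vee M}$ is not an integer, and $$S(x,E)=\sum_{j=0}^{s-1}\int_0^x c_j(E)\,y^{M(1-h^\vee j)}\,dy+c_s(E)\log x$$ if it is an integer. Let $V$ be a finite dimensional $\mathfrak g$-module, let $\zeta\in\mathbb C^*$, and regard $V$ as the evaluation representation of $\widehat{\mathfrak g}$ at $\zeta$: $(b\otimes f(t))v=f(\zeta)\,bv$ and $cv=0$. Suppose that $\Lambda=e_0+e$ has in this representation a maximal eigenvalue $\lambda$, that is, a real eigenvalue of algebraic multiplicity one with $\lambda>\operatorname{Re}\mu$ for every other eigenvalue $\mu$, and let $\psi\in V$ be a corresponding eigenvector. Then for every $E\in\mathbb C$ there is a unique solution $\Psi(\cdot,E):\widetilde{\mathbb C}\to V$ of $$\Psi'(x)+\Big(\frac{\ell}{x}+e+p(x,E)\,e_0\Big)\Psi(x)=0$$ such that $$\Psi(x,E)=e^{-\lambda S(x,E)}\,q(x,E)^{-h}\big(\psi+o(1)\big)\qquad\text{as } x\to+\infty,$$ where $q^{-h}=\exp(-h\log q)$ with the principal logarithm of $q$. Moreover, for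 every $E$ and every $\delta>0$ the same asymptotics hold as $x\to\infty$, uniformly, in the sector $|\arg x|<\frac{\pi}{2(M+1)}-\delta$. Finally, for every $x\in\widetilde{\mathbb C}$ the function $E\mapsto\Psi(x,E)$ is entire. -/

import Mathlib

open scoped TensorProduct
open Filter Topology

noncomputable section

namespace ODEIM

/-! ### Simple Lie algebras of type ADE -/

/-- The simply laced Dynkin types. -/
inductive ADEType : Type
  | A (n : ℕ) (hn : 1 ≤ n)
  | D (n : ℕ) (hn : 4 ≤ n)
  | E6
  | E7
  | E8

namespace ADEType

/-- The rank of a simply laced Dynkin type. -/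
def rank : ADEType → ℕ
  | A n _ => n
  | D n _ => n
  | E6 => 6
  | E7 => 7
  | E8 => 8

/-- The Cartan matrix of a simply laced Dynkin type. -/
def cartanMatrix : (X : ADEType) → Matrix (Fin X.rank) (Fin X.rank) ℤ
  | A n _ => CartanMatrix.A n
  | D n _ => CartanMatrix.D n
  | E6 => CartanMatrix.E₆
  | E7 => CartanMatrix.E₇
  | E8 => CartanMatrix.E₈

/-- The dual Coxeter number of a simply laced Dynkin type. -/
def dualCoxeter : ADEType → ℕ
  | A n _ => n + 1
  | D n _ => 2 * n - 2
  | E6 => 12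
  | E7 => 18
  | E8 => 30

end ADEType

section Algebra

attribute [local instance 100] LieRing.ofAssociativeRing

variable {𝔤 : Type*} [LieRing 𝔤] [LieAlgebra ℂ 𝔤]

/-- `a` is a nonzero vector of the root space of the lowest root `-θ`: no `-θ - α i` is a weight
of the adjoint representation (that is, a root or zero). Here the Chevalley generators are
`b.e i`, `b.f i`, `b.h i`, and `b.baseSupp i` is the simple root `α i`. -/
def IsLowestRootVector {ι : Type*} [Fintype ι] {H : LieSubalgebra ℂ 𝔤} [H.IsCartanSubalgebra]
    (b : LieAlgebra.Basis ι H) (a : 𝔤) : Prop :=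
  a ≠ 0 ∧ ∃ β : Module.Dual ℂ H, β ≠ 0 ∧ a ∈ LieAlgebra.rootSpace H β ∧
    ∀ i, LieAlgebra.rootSpace H (β - b.baseSupp i : Module.Dual ℂ H) = ⊥

/-! ### The affine Kac-Moody algebra and its evaluation representations -/

variable (𝔤) in
/-- The invariant bilinear form `(a | b) = κ(a, b) / k`, with `κ` the Killing form. -/
def normalizedForm (k : ℕ) : LinearMap.BilinForm ℂ 𝔤 := (k : ℂ)⁻¹ • killingForm ℂ 𝔤

lemma neg_normalizedForm_invariant (k : ℕ) : (-normalizedForm 𝔤 k).lieInvariant 𝔤 := by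
  intro x y z
  have h := LieModule.traceForm_lieInvariant ℂ 𝔤 𝔤 x y z
  simp only [normalizedForm, killingForm, LinearMap.neg_apply, LinearMap.smul_apply] at h ⊢
  rw [h, smul_neg]

lemma neg_normalizedForm_symm (k : ℕ) : (-normalizedForm 𝔤 k).IsSymm := by
  constructor
  intro x y
  simp only [normalizedForm, killingForm, LinearMap.neg_apply, LinearMap.smul_apply]
  rw [LieModule.traceForm_comm]

variable (𝔤) in
/-- The affine cocycle `(f, g) ↦ Res (f' | g) dt` on `𝔤 ⊗ ℂ[t, t⁻¹]`. The Mathlib cocycle of a form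
`Φ` is `(f, g) ↦ Res Φ(f, g') dt = - Res Φ(f', g) dt`, whence the sign. -/
def affineCocycle (k : ℕ) :=
  LieAlgebra.LoopAlgebra.twoCocycleOfBilinear ℂ ℤ 𝔤 (-normalizedForm 𝔤 k)
    (neg_normalizedForm_invariant k) (neg_normalizedForm_symm k)

variable (𝔤) in
/-- The affine Kac-Moody algebra `𝔤 ⊗ ℂ[t, t⁻¹] ⊕ ℂ c` with bracket
`[a ⊗ f, b ⊗ g] = [a, b] ⊗ f g + (a | b) Res (f' g dt) c` and `c` central;
`k` is the dual Coxeter number of `𝔤`. -/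
abbrev Affine (k : ℕ) := LieAlgebra.ofTwoCocycle (affineCocycle 𝔤 k)

/-- The element `a ⊗ t ^ n` of the affine algebra. -/
def Affine.mon (k : ℕ) (n : ℤ) (a : 𝔤) : Affine 𝔤 k :=
  LieAlgebra.ofProd _ ((LaurentPolynomial.T n : LaurentPolynomial ℂ) ⊗ₜ[ℂ] a, 0)

/-- Evaluation `f ↦ f(ζ)` of Laurent polynomials, as a linear map. -/
def laurentEval (ζ : ℂˣ) : LaurentPolynomial ℂ →ₗ[ℂ] ℂ where
  toFun := LaurentPolynomial.eval₂ (RingHom.id ℂ) ζ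
  map_add' := map_add _
  map_smul' c f := by
    rw [LaurentPolynomial.smul_eq_C_mul, map_mul, LaurentPolynomial.eval₂_C]
    rfl

lemma laurentEval_mul (ζ : ℂˣ) (f g : LaurentPolynomial ℂ) :
    laurentEval ζ (f * g) = laurentEval ζ f * laurentEval ζ g :=
  map_mul (LaurentPolynomial.eval₂ (RingHom.id ℂ) ζ) f g

variable (V : Type*) [AddCommGroup V] [Module ℂ V] [LieRingModule 𝔤 V] [LieModule ℂ 𝔤 V]

/-- The linear map `𝔤 ⊗ ℂ[t, t⁻¹] → End V` given by `(a ⊗ f) v = f(ζ) (a v)`. -/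
def loopEval (ζ : ℂˣ) : LieAlgebra.loopAlgebra ℂ ℤ 𝔤 →ₗ[ℂ] Module.End ℂ V :=
  TensorProduct.lift
    ((LinearMap.lsmul ℂ (Module.End ℂ V) ∘ₗ laurentEval ζ).compl₂
      (LieModule.toEnd ℂ 𝔤 V : 𝔤 →ₗ[ℂ] Module.End ℂ V))

lemma loopEval_tmul (ζ : ℂˣ) (f : LaurentPolynomial ℂ) (a : 𝔤) :
    loopEval V ζ (f ⊗ₜ[ℂ] a) = laurentEval ζ f • LieModule.toEnd ℂ 𝔤 V a := rfl

lemma loopEval_lie (ζ : ℂˣ) (x y : LieAlgebra.loopAlgebra ℂ ℤ 𝔤) :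
    loopEval V ζ ⁅x, y⁆ = ⁅loopEval V ζ x, loopEval V ζ y⁆ := by
  have hl : ∀ u v w : LieAlgebra.loopAlgebra ℂ ℤ 𝔤, ⁅u + v, w⁆ = ⁅u, w⁆ + ⁅v, w⁆ :=
    fun u v w => add_lie (L := LieAlgebra.loopAlgebra ℂ ℤ 𝔤)
      (M := LieAlgebra.loopAlgebra ℂ ℤ 𝔤) u v w
  have hr : ∀ u v w : LieAlgebra.loopAlgebra ℂ ℤ 𝔤, ⁅u, v + w⁆ = ⁅u, v⁆ + ⁅u, w⁆ :=
    fun u v w => lie_add (L := LieAlgebra.loopAlgebra ℂ ℤ 𝔤)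
      (M := LieAlgebra.loopAlgebra ℂ ℤ 𝔤) u v w
  have hl0 : ∀ w : LieAlgebra.loopAlgebra ℂ ℤ 𝔤, ⁅(0 : LieAlgebra.loopAlgebra ℂ ℤ 𝔤), w⁆ = 0 :=
    fun w => zero_lie (L := LieAlgebra.loopAlgebra ℂ ℤ 𝔤)
      (M := LieAlgebra.loopAlgebra ℂ ℤ 𝔤) w
  have hr0 : ∀ w : LieAlgebra.loopAlgebra ℂ ℤ 𝔤, ⁅w, (0 : LieAlgebra.loopAlgebra ℂ ℤ 𝔤)⁆ = 0 :=
    fun w => lie_zero (L := LieAlgebra.loopAlgebra ℂ ℤ 𝔤)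
      (M := LieAlgebra.loopAlgebra ℂ ℤ 𝔤) w
  induction x using TensorProduct.induction_on with
  | zero => rw [hl0, map_zero, zero_lie]
  | add u v hu hv => rw [hl, map_add, map_add, add_lie, hu, hv]
  | tmul f a =>
    induction y using TensorProduct.induction_on with
    | zero => rw [hr0, map_zero, lie_zero]
    | add u v hu hv => rw [hr, map_add, map_add, lie_add, hu, hv]
    | tmul g b =>
      rw [LieAlgebra.ExtendScalars.bracket_tmul]
      erw [loopEval_tmul, loopEval_tmul, loopEval_tmul]
      rw [laurentEval_mul, LieHom.map_lie, smul_lie, lie_smul, smul_smul]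

/-- The evaluation representation `V(ζ)` of the affine algebra on a `𝔤`-module `V`:
`(a ⊗ f) v = f(ζ) (a v)` and `c v = 0`. -/
def evalRep (k : ℕ) (ζ : ℂˣ) : Affine 𝔤 k →ₗ⁅ℂ⁆ Module.End ℂ V where
  toFun x := loopEval V ζ ((LieAlgebra.ofProd _).symm x).1
  map_add' x y := by simp
  map_smul' c x := by simp
  map_lie' {x y} := by
    rw [LieAlgebra.bracket_ofTwoCocycle]
    exact loopEval_lie V ζ _ _

end Algebra

/-- A real number `lam` is a maximal eigenvalue of `A`: it is an eigenvalue of algebraic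
multiplicity one, and it exceeds the real part of every other eigenvalue. -/
def IsMaximalEigenvalue {V : Type*} [AddCommGroup V] [Module ℂ V] [FiniteDimensional ℂ V]
    (A : Module.End ℂ V) (lam : ℝ) : Prop :=
  A.HasEigenvalue (lam : ℂ) ∧ A.charpoly.rootMultiplicity (lam : ℂ) = 1 ∧
    ∀ μ : ℂ, A.HasEigenvalue μ → μ ≠ lam → μ.re < lam

/-! ### Potential, truncated root of the potential, and action

Complex powers and logarithms are principal, so all functions are considered on
`Complex.slitPlane`, the plane minus the non-positive real axis. The parameter `k` is the dual
Coxeter number. -/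

/-- The potential `p(x, E) = x ^ (M k) - E`. -/
def pot (M : ℝ) (k : ℕ) (x E : ℂ) : ℂ := x ^ ((M * k : ℝ) : ℂ) - E

/-- The truncation order `s = ⌊(M + 1) / (k M)⌋`. -/
def truncOrder (M : ℝ) (k : ℕ) : ℕ := ⌊(M + 1) / (k * M)⌋₊

/-- The coefficient `c_j(E)` of `x ^ (M (1 - k j))` in the expansion of `p(x, E) ^ (1 / k)` at
infinity, from the binomial series of `x ^ M (1 - E x ^ (-M k)) ^ (1 / k)`. -/
def coeff (k : ℕ) (j : ℕ) (E : ℂ) : ℂ := Ring.choose ((1 : ℂ) / k) j * (-E) ^ j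

/-- The `j`-th term `c_j(E) x ^ (M (1 - k j))` of the expansion of `p(x, E) ^ (1 / k)`. -/
def qTerm (M : ℝ) (k : ℕ) (j : ℕ) (x E : ℂ) : ℂ :=
  coeff k j E * x ^ ((M * (1 - k * j) : ℝ) : ℂ)

/-- `q(x, E) = x ^ M + ∑_{j = 1}^{s} c_j(E) x ^ (M (1 - k j))`; the term `j = 0` is `x ^ M`. -/
def q (M : ℝ) (k : ℕ) (x E : ℂ) : ℂ :=
  ∑ j ∈ Finset.range (truncOrder M k + 1), qTerm M k j x E

/-- The integral `∫_0^x F(y) dy` along the segment from `0` to `x`. -/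
def segInt (F : ℂ → ℂ) (x : ℂ) : ℂ := ∫ t in (0 : ℝ)..1, F (t * x) * x

open Classical in
/-- The action: `∫_0^x q(y, E) dy` if `(M + 1) / (k M)` is not an integer; otherwise the last term
of `q` is `c_s(E) / x` and contributes `c_s(E) log x`. -/
def action (M : ℝ) (k : ℕ) (x E : ℂ) : ℂ :=
  if (M + 1) / (k * M) = truncOrder M k then
    (∑ j ∈ Finset.range (truncOrder M k), segInt (fun y => qTerm M k j y E) x)
      + coeff k (truncOrder M k) E * Complex.log x
  else segInt (fun y => q M k y E) x

/-! ### The linear equation and the asymptotic behaviour -/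

section ODE

variable {V : Type*} [NormedAddCommGroup V] [NormedSpace ℂ V] [FiniteDimensional ℂ V]

/-- The operator `z ^ B = exp (log z • B)` on a finite dimensional space. -/
def opPow (z : ℂ) (B : Module.End ℂ V) : V →L[ℂ] V :=
  NormedSpace.exp (Complex.log z • LinearMap.toContinuousLinearMap B)

variable {𝔤 : Type*} [LieRing 𝔤] [LieAlgebra ℂ 𝔤] [LieRingModule 𝔤 V] [LieModule ℂ 𝔤 V]

/-- `Ψ` solves `Ψ' + (ℓ / x + e + p(x, E) e₀) Ψ = 0` on the slit plane, in the evaluation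
representation `V(ζ)`. -/
def IsSolution (M : ℝ) (k : ℕ) (ζ : ℂˣ) (ell e e₀ : Affine 𝔤 k) (E : ℂ) (Ψ : ℂ → V) : Prop :=
  ∀ x ∈ Complex.slitPlane,
    HasDerivAt Ψ (-(evalRep V k ζ (x⁻¹ • ell + e + pot M k x E • e₀) (Ψ x))) x

/-- `Ψ(x) = e ^ (-lam S(x, E)) q(x, E) ^ (-h) (ψ + o(1))` along the filter `F`, where `hV` is the
operator by which `h` acts. -/
def HasAsymptotics (M : ℝ) (k : ℕ) (lam : ℝ) (hV : Module.End ℂ V) (ψ : V) (E : ℂ)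
    (F : Filter ℂ) (Ψ : ℂ → V) : Prop :=
  ∃ r : ℂ → V, Tendsto r F (𝓝 0) ∧ ∀ᶠ x in F,
    Ψ x = Complex.exp (-lam * action M k x E) • opPow (q M k x E) (-hV) (ψ + r x)

end ODE

/-- The filter of real `x → +∞`, in the complex plane. -/
def realInfty : Filter ℂ := Filter.map ((↑) : ℝ → ℂ) atTop

/-- The filter of `x → ∞` inside the sector `|arg x| < φ`. -/
def sectorInfty (φ : ℝ) : Filter ℂ := Bornology.cobounded ℂ ⊓ 𝓟 {x | |x.arg| < φ}

end ODEIM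

end

/-!
The proof brings the equation to a form in which its solution is given by a Volterra integral
equation from infinity.

Gauge transformations. Since `[h, e] = e` and `[h, e₀] = -(k - 1) e₀`, conjugation by `q ^ (-h)`
turns `e + p e₀` into `q e + p q ^ (1 - k) e₀`, and this is `q Λ` up to an error of order `|x| ^ (-1
- κ)` with `κ > 0`: as `q` is the expansion of `p ^ (1 / k)` truncated at order `s`, the quotient `p
/ q ^ k` is `1` up to the order of truncation (`isBigO_rootDefect`). There remain the terms `(ℓ - M
h) / x`, not integrable at infinity. They belong to the Cartan subalgebra, which acts by commutators
with `Λ`: a combination `y` of the `f i` satisfies `[a, y] = 0` for a lowest root vector `a`, so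
that `[Λ, y] = [e, y]` is an arbitrary element of the Cartan subalgebra
(`exists_commutator_eq_evalRep`). Hence a further transformation `1 + n F` with `n = -1 / (x q)` and
`[Λ, F] = ℓ - M h` removes them. With `T = exp (-lam S) q ^ (-h) (1 + n F)` and `Ψ = T Z` the
equation becomes `Z' = -(q (Λ - lam) + R) Z` with `R = O(|x| ^ (-1 - κ))` (`GaugeData.hasDerivAt_T`,
`exists_region`), and the prescribed asymptotics say that `Z → ψ`.

The Volterra equation. Integration from infinity along a curve `x(s)` gives `Z(s) = ψ + ∫_s^∞ exp
((S(t) - S(s)) (Λ - lam)) R Z`. The curves are the trajectories of `x ↦ (x ^ (M + 1) + s) ^ (1 / (M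
+ 1))`, which preserve the sector `|arg x| < π / (2 (M + 1))` and along which `S(t) - S(s)` stays in
a narrow cone around the positive real axis. There `exp (z (Λ - lam))` is bounded, because `lam` is
a simple eigenvalue and the other eigenvalues have smaller real part (`exists_cone_bound`). So the
kernel is dominated by an integrable function of `t`, the Neumann series converges with `Z - ψ`
bounded by the tail of that function, and `Z` is holomorphic in `x` and `E`
(`RegionBound.hasDerivAt_gaugedSol`, `RegionBound.norm_gaugedSol_sub_le`,
`RegionBound.differentiableOn_gaugedSol`). The trajectories form a holomorphic flow, so the
solutions on different trajectories fit together to a solution in the sector, and `S` need only be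
estimated along the flow.

The continuation to the slit plane, with holomorphic dependence on `E`, solves the initial value
problem at a point of the positive real axis (`exists_hasDerivAt_starConvex`, a second use of the
Volterra equation). The difference of two solutions with the prescribed asymptotics on the real axis
gives a solution of the homogeneous Volterra equation tending to zero, which vanishes
(`RegionBound.eq_zero_of_hasLeading_zero`). All estimates are uniform for `E` in a disc; by
uniqueness the solutions obtained on larger and larger discs agree, and they are entire in `E`
(`exists_entire_solution`).
-/

/-! ### Volterra equations on a half-line -/

section

open MeasureTheory Set

/-- An integral depending holomorphically on a complex parameter is holomorphic, provided the
integrand is dominated uniformly in the parameter: the Cauchy estimate dominates its derivative as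
well. -/
theorem differentiableOn_integral_of_dominated {α W : Type*} [MeasurableSpace α]
    [NormedAddCommGroup W] [NormedSpace ℂ W] [CompleteSpace W]
    {μ : Measure α} {D : Set ℂ} (hD : IsOpen D) {F : ℂ → α → W} {b : α → ℝ}
    (hb : Integrable b μ) (hm : ∀ z ∈ D, AEStronglyMeasurable (F z) μ)
    (hF : ∀ᵐ t ∂μ, DifferentiableOn ℂ (fun z => F z t) D)
    (hle : ∀ᵐ t ∂μ, ∀ z ∈ D, ‖F z t‖ ≤ b t) :
    DifferentiableOn ℂ (fun z => ∫ t, F z t ∂μ) D := by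
  intro z hz
  obtain ⟨r, hr, hrD⟩ := Metric.isOpen_iff.1 hD z hz
  have hr2 : 0 < r / 2 := by positivity
  have hsub : ∀ w ∈ Metric.ball z (r / 2), Metric.closedBall w (r / 3) ⊆ D := by
    intro w hw y hy
    apply hrD
    rw [Metric.mem_ball] at hw ⊢
    rw [Metric.mem_closedBall] at hy
    linarith [dist_triangle y w z]
  have hderiv : ∀ᵐ t ∂μ, ∀ w ∈ Metric.ball z (r / 2),
      HasDerivAt (fun z => F z t) (deriv (fun z => F z t) w) w := by
    filter_upwards [hF] with t ht w hw
    exact (ht.differentiableAt (hD.mem_nhds (hsub w hw (Metric.mem_closedBall_self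
      (by positivity))))).hasDerivAt
  -- the derivative is measurable as a pointwise limit of difference quotients
  have hmeas : AEStronglyMeasurable (fun t => deriv (fun z => F z t) z) μ := by
    set u : ℕ → ℂ := fun n => z + ((r / 2 / (n + 1) : ℝ) : ℂ) with hu
    have hpos : ∀ n : ℕ, 0 < r / 2 / ((n : ℝ) + 1) := fun n => by positivity
    have hu0 : Tendsto (fun n : ℕ => r / 2 / ((n : ℝ) + 1)) atTop (𝓝 0) := by
      have := (tendsto_one_div_add_atTop_nhds_zero_nat (𝕜 := ℝ)).const_mul (r / 2)
      rw [mul_zero] at this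
      exact this.congr fun n => by ring
    have hu1 : Tendsto u atTop (𝓝 z) := by
      have := (Complex.continuous_ofReal.tendsto 0).comp hu0
      simpa [hu, Function.comp_def] using this.const_add z
    have hune : ∀ n, u n ≠ z := fun n h => by
      have : ((r / 2 / (n + 1) : ℝ) : ℂ) = 0 := by simpa [hu] using h
      exact (hpos n).ne' (by exact_mod_cast this)
    have huD : ∀ n, u n ∈ D := fun n => by
      apply hrD
      rw [Metric.mem_ball, dist_eq_norm]
      have : u n - z = ((r / 2 / (n + 1) : ℝ) : ℂ) := by simp [hu]
      rw [this, Complex.norm_real, Real.norm_of_nonneg (hpos n).le]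
      calc r / 2 / ((n : ℝ) + 1) ≤ r / 2 :=
            div_le_self hr2.le (by linarith [n.cast_nonneg (α := ℝ)])
        _ < r := by linarith
    refine aestronglyMeasurable_of_tendsto_ae atTop
      (f := fun n t => slope (fun z => F z t) z (u n)) (fun n => ?_) ?_
    · simp only [slope_def_module]
      exact ((hm _ (huD n)).sub (hm _ hz)).const_smul _
    · filter_upwards [hderiv] with t ht
      exact (ht z (Metric.mem_ball_self hr2)).tendsto_slope.comp
        (tendsto_nhdsWithin_iff.2 ⟨hu1, Eventually.of_forall hune⟩)
  have hint : Integrable (F z) μ :=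
    hb.mono' (hm z hz) (hle.mono fun t ht => ht z hz)
  refine (hasDerivAt_integral_of_dominated_loc_of_deriv_le (bound := fun t => b t / (r / 3))
    (F' := fun w t => deriv (fun z => F z t) w)
    (Metric.ball_mem_nhds z hr2) ?_ hint hmeas ?_ (hb.div_const _)
    hderiv).2.differentiableAt.differentiableWithinAt
  · filter_upwards [hD.mem_nhds hz] with w hw using hm w hw
  · filter_upwards [hF, hle] with t ht hlet w hw
    refine Complex.norm_deriv_le_of_forall_mem_sphere_norm_le (by positivity) ?_ ?_
    · refine DifferentiableOn.diffContOnCl ?_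
      rw [closure_ball _ (by positivity)]
      exact ht.mono (hsub w hw)
    · exact fun y hy => hlet y (hsub w hw (Metric.sphere_subset_closedBall hy))

section Volterra

variable {W : Type*} [NormedAddCommGroup W] [NormedSpace ℂ W]

noncomputable section

/-- The terms of the Neumann series of the Volterra equation
`Z(s) = ψ + A(s) ∫_s^∞ L(t) Z(t) dt`. -/
def volterraIter (A L : ℝ → W →L[ℂ] W) (ψ : W) : ℕ → ℝ → W
  | 0, _ => ψ
  | n + 1, s => A s (∫ t in Ioi s, L t (volterraIter A L ψ n t))

/-- The solution of the Volterra equation `Z(s) = ψ + A(s) ∫_s^∞ L(t) Z(t) dt`, defined by its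
Neumann series. -/
def volterraSol (A L : ℝ → W →L[ℂ] W) (ψ : W) (s : ℝ) : W := ∑' n, volterraIter A L ψ n s

end

/-- The kernel `A(s) L(t)`, `0 ≤ s ≤ t`, is dominated by an integrable function `g(t)`; the integral
of `g` over `(s, ∞)` is recorded by its value `G(s)`. The bound on `L` alone serves only to make the
integral of `L Z` converge. -/
structure VolterraBound (A L : ℝ → W →L[ℂ] W) (g G : ℝ → ℝ) : Prop where
  contA : ContinuousOn A (Ici 0)
  contL : ContinuousOn L (Ici 0)
  nonneg : ∀ s, 0 ≤ s → 0 ≤ g s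
  deriv : ∀ s, 0 ≤ s → HasDerivAt G (-g s) s
  lim : Tendsto G atTop (𝓝 0)
  bound : ∀ s t, 0 ≤ s → s ≤ t → ‖A s ∘L L t‖ ≤ g t
  boundL : ∃ c, ∀ t, 0 ≤ t → ‖L t‖ ≤ c * g t

namespace VolterraBound

variable {A L : ℝ → W →L[ℂ] W} {g G : ℝ → ℝ} {ψ : W} (h : VolterraBound A L g G)
include h

/-- The weight `exp (2 G)` is chosen so that integration against `g` over `(s, ∞)` halves it, up to
a constant; this makes the Volterra operator a contraction without any smallness of `g`. -/
theorem integrableOn_weight {s : ℝ} (hs : 0 ≤ s) :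
    IntegrableOn (fun t => g t * Real.exp (2 * G t)) (Ioi s) ∧
    ∫ t in Ioi s, g t * Real.exp (2 * G t) = (Real.exp (2 * G s) - 1) / 2 := by
  have hd : ∀ t ∈ Ici s, HasDerivAt (fun t => -(Real.exp (2 * G t) / 2))
      (g t * Real.exp (2 * G t)) t := by
    intro t ht
    have := (((h.deriv t (hs.trans ht)).const_mul 2).exp.div_const 2).neg
    convert! this using 1
    ring
  have hl : Tendsto (fun t => -(Real.exp (2 * G t) / 2)) atTop (𝓝 (-(1 / 2))) := by
    have := (((Real.continuous_exp.tendsto _).comp (h.lim.const_mul 2)).div_const 2).neg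
    simpa using this
  have hi := integrableOn_Ioi_deriv_of_nonneg' hd
    (fun t ht => mul_nonneg (h.nonneg t (hs.trans (le_of_lt ht))) (Real.exp_pos _).le) hl
  refine ⟨hi, ?_⟩
  rw [integral_Ioi_of_hasDerivAt_of_tendsto' hd hi hl]
  ring

theorem antitoneOn : AntitoneOn G (Ici 0) := by
  refine antitoneOn_of_deriv_nonpos (convex_Ici 0)
    (fun s hs => (h.deriv s hs).continuousAt.continuousWithinAt)
    (fun s hs => (h.deriv s (interior_subset hs)).differentiableAt.differentiableWithinAt) ?_
  intro s hs
  rw [(h.deriv s (interior_subset hs)).deriv]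
  linarith [h.nonneg s (interior_subset hs)]

theorem exp_le {s : ℝ} (hs : 0 ≤ s) : Real.exp (2 * G s) ≤ Real.exp (2 * G 0) :=
  Real.exp_le_exp.2 (by linarith [h.antitoneOn (mem_Ici.2 le_rfl) hs hs])

theorem norm_comp_le {f : ℝ → W} {c s t : ℝ}
    (hc : ∀ t, 0 ≤ t → ‖f t‖ ≤ c * Real.exp (2 * G t)) (hs : 0 ≤ s) (hst : s ≤ t) :
    ‖A s (L t (f t))‖ ≤ c * (g t * Real.exp (2 * G t)) := by
  calc ‖A s (L t (f t))‖ ≤ ‖A s ∘L L t‖ * ‖f t‖ := (A s ∘L L t).le_opNorm _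
    _ ≤ g t * (c * Real.exp (2 * G t)) := by
        gcongr
        · exact h.nonneg t (hs.trans hst)
        · exact h.bound s t hs hst
        · exact hc t (hs.trans hst)
    _ = _ := by ring

theorem integrableOn_apply {f : ℝ → W} (hf : ContinuousOn f (Ici 0)) {c : ℝ}
    (hc : ∀ t, 0 ≤ t → ‖f t‖ ≤ c * Real.exp (2 * G t)) :
    IntegrableOn (fun t => L t (f t)) (Ioi 0) := by
  obtain ⟨d, hd⟩ := h.boundL
  refine (((h.integrableOn_weight le_rfl).1.const_mul (d * c))).mono'
    (((h.contL.clm_apply hf).mono Ioi_subset_Ici_self).aestronglyMeasurable measurableSet_Ioi) ?_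
  refine (ae_restrict_iff' measurableSet_Ioi).2 (Eventually.of_forall fun t ht => ?_)
  have ht0 : (0 : ℝ) ≤ t := le_of_lt ht
  calc ‖L t (f t)‖ ≤ ‖L t‖ * ‖f t‖ := (L t).le_opNorm _
    _ ≤ (d * g t) * (c * Real.exp (2 * G t)) := by
        gcongr
        · exact (norm_nonneg _).trans (hd t ht0)
        · exact hd t ht0
        · exact hc t ht0
    _ = _ := by ring

theorem norm_integral_le [CompleteSpace W] {f : ℝ → W} (hf : ContinuousOn f (Ici 0)) {c : ℝ}
    (hc : ∀ t, 0 ≤ t → ‖f t‖ ≤ c * Real.exp (2 * G t)) {s : ℝ} (hs : 0 ≤ s) :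
    ‖A s (∫ t in Ioi s, L t (f t))‖ ≤ c / 2 * (Real.exp (2 * G s) - 1) := by
  rw [← (A s).integral_comp_comm ((h.integrableOn_apply hf hc).mono_set (Ioi_subset_Ioi hs))]
  have := h.integrableOn_weight hs
  calc _ ≤ ∫ t in Ioi s, c * (g t * Real.exp (2 * G t)) := by
        refine norm_integral_le_of_norm_le (this.1.const_mul c) ?_
        refine (ae_restrict_iff' measurableSet_Ioi).2 (Eventually.of_forall fun t ht => ?_)
        exact h.norm_comp_le hc hs (le_of_lt ht)
    _ = _ := by rw [integral_const_mul, this.2]; ring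

omit h in
theorem _root_.continuousOn_integral_Ioi {W : Type*} [NormedAddCommGroup W] [NormedSpace ℝ W]
    {F : ℝ → W} (hF : IntegrableOn F (Ioi 0)) :
    ContinuousOn (fun s => ∫ t in Ioi s, F t) (Ici 0) := by
  have hii : ∀ a b : ℝ, 0 ≤ a → 0 ≤ b → IntervalIntegrable F volume a b := by
    intro a b ha hb
    rw [intervalIntegrable_iff]
    refine hF.mono_set fun t ht => ?_
    exact (le_min ha hb).trans_lt ht.1
  have key : ∀ s ∈ Ici (0 : ℝ), ∫ t in Ioi s, F t =
      (∫ t in Ioi 0, F t) - ∫ t in (0 : ℝ)..s, F t := by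
    intro s hs
    have := intervalIntegral.integral_interval_add_Ioi' (hii 0 s le_rfl hs)
      (hF.mono_set (Ioi_subset_Ioi hs))
    rw [← this]; abel
  refine ContinuousOn.congr ?_ key
  refine continuousOn_const.sub ?_
  intro s hs
  have : ContinuousOn (fun s => ∫ t in (0 : ℝ)..s, F t) (Icc 0 (s + 1)) := by
    have := intervalIntegral.continuousOn_primitive_interval (a := (0 : ℝ)) (b := s + 1)
      (f := F) (μ := volume) ?_
    · rwa [uIcc_of_le (by linarith [mem_Ici.1 hs])] at this
    · rw [uIcc_of_le (by linarith [mem_Ici.1 hs]), integrableOn_Icc_iff_integrableOn_Ioc]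
      exact hF.mono_set Ioc_subset_Ioi_self
  refine (this s ⟨hs, by linarith⟩).mono_of_mem_nhdsWithin ?_
  rw [mem_nhdsWithin]
  exact ⟨Iio (s + 1), isOpen_Iio, by simp, fun t ht => ⟨ht.2, le_of_lt ht.1⟩⟩

theorem iter_spec [CompleteSpace W] (ψ : W) (n : ℕ) :
    ContinuousOn (volterraIter A L ψ n) (Ici 0) ∧
    ∀ s, 0 ≤ s → ‖volterraIter A L ψ n s‖ ≤ ‖ψ‖ * (1 / 2) ^ n * Real.exp (2 * G s) := by
  induction n with
  | zero =>
    refine ⟨continuousOn_const, fun s hs => ?_⟩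
    have : 0 ≤ G s := by
      refine le_of_tendsto h.lim ?_
      filter_upwards [eventually_ge_atTop s] with t ht
      exact h.antitoneOn hs (hs.trans ht) ht
    have : 1 ≤ Real.exp (2 * G s) := Real.one_le_exp (by linarith)
    simp only [volterraIter, pow_zero, mul_one]
    exact le_mul_of_one_le_right (norm_nonneg _) this
  | succ n ih =>
    refine ⟨h.contA.clm_apply (continuousOn_integral_Ioi (h.integrableOn_apply ih.1 ih.2)), ?_⟩
    intro s hs
    refine (h.norm_integral_le ih.1 ih.2 hs).trans ?_
    rw [pow_succ]
    have : 0 ≤ ‖ψ‖ * (1 / 2) ^ n := by positivity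
    nlinarith

theorem summable_iter [CompleteSpace W] (ψ : W) {s : ℝ} (hs : 0 ≤ s) :
    Summable fun n => volterraIter A L ψ n s := by
  refine Summable.of_norm_bounded (g := fun n => ‖ψ‖ * Real.exp (2 * G s) * (1 / 2) ^ n)
    (summable_geometric_two.mul_left _) fun n => ?_
  refine ((h.iter_spec ψ n).2 s hs).trans_eq (by ring)

theorem continuousOn_sol [CompleteSpace W] (ψ : W) : ContinuousOn (volterraSol A L ψ) (Ici 0) := by
  refine continuousOn_tsum (fun n => (h.iter_spec ψ n).1)
    (u := fun n => ‖ψ‖ * Real.exp (2 * G 0) * (1 / 2) ^ n)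
    (summable_geometric_two.mul_left _) fun n s hs => ?_
  refine ((h.iter_spec ψ n).2 s hs).trans ?_
  have := h.exp_le hs
  have h2 : 0 ≤ ‖ψ‖ * (1 / 2) ^ n := by positivity
  nlinarith

theorem norm_sol_le [CompleteSpace W] (ψ : W) {s : ℝ} (hs : 0 ≤ s) :
    ‖volterraSol A L ψ s‖ ≤ 2 * ‖ψ‖ * Real.exp (2 * G s) := by
  have := tsum_of_norm_bounded (f := fun n => volterraIter A L ψ n s)
    ((hasSum_geometric_two).mul_left (‖ψ‖ * Real.exp (2 * G s)))
    (fun n => ((h.iter_spec ψ n).2 s hs).trans_eq (by ring))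
  refine this.trans_eq (by ring)

theorem sol_eq [CompleteSpace W] (ψ : W) {s : ℝ} (hs : 0 ≤ s) :
    volterraSol A L ψ s = ψ + A s (∫ t in Ioi s, L t (volterraSol A L ψ t)) := by
  have h1 := (h.summable_iter ψ hs).tsum_eq_zero_add
  have hint : ∀ n, IntegrableOn (fun t => L t (volterraIter A L ψ n t)) (Ioi s) := fun n =>
    (h.integrableOn_apply (h.iter_spec ψ n).1 (h.iter_spec ψ n).2).mono_set (Ioi_subset_Ioi hs)
  obtain ⟨d, hd⟩ := h.boundL
  have hsum : Summable fun n => ∫ t in Ioi s, ‖L t (volterraIter A L ψ n t)‖ := by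
    refine Summable.of_nonneg_of_le (fun n => integral_nonneg fun t => norm_nonneg _)
      (fun n => ?_) (summable_geometric_two.mul_left
        (d * ‖ψ‖ * ∫ t in Ioi s, g t * Real.exp (2 * G t)))
    have hw := (h.integrableOn_weight hs).1
    calc _ ≤ ∫ t in Ioi s, d * (‖ψ‖ * (1 / 2) ^ n) * (g t * Real.exp (2 * G t)) := by
          refine setIntegral_mono_on (hint n).norm (hw.const_mul _) measurableSet_Ioi ?_
          intro t ht
          have ht0 : (0 : ℝ) ≤ t := hs.trans (le_of_lt ht)
          calc ‖L t (volterraIter A L ψ n t)‖ ≤ ‖L t‖ * ‖volterraIter A L ψ n t‖ :=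
                (L t).le_opNorm _
            _ ≤ (d * g t) * (‖ψ‖ * (1 / 2) ^ n * Real.exp (2 * G t)) := by
                gcongr
                · exact (norm_nonneg _).trans (hd t ht0)
                · exact hd t ht0
                · exact (h.iter_spec ψ n).2 t ht0
            _ = _ := by ring
      _ = _ := by rw [integral_const_mul]; ring
  have h2 := hasSum_integral_of_summable_integral_norm hint hsum
  have h3 : ∫ t in Ioi s, L t (volterraSol A L ψ t) =
      ∫ t in Ioi s, ∑' n, L t (volterraIter A L ψ n t) := by
    refine setIntegral_congr_fun measurableSet_Ioi fun t ht => ?_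
    exact (L t).map_tsum (h.summable_iter ψ (hs.trans (le_of_lt ht)))
  rw [volterraSol, h1, h3, ← h2.tsum_eq, (A s).map_tsum h2.summable]
  rfl

/-- The solution tends to `ψ`, at a rate controlled by the tail `G` alone. -/
theorem norm_sol_sub_le [CompleteSpace W] (ψ : W) {s : ℝ} (hs : 0 ≤ s) :
    ‖volterraSol A L ψ s - ψ‖ ≤ ‖ψ‖ * (Real.exp (2 * G s) - 1) := by
  rw [h.sol_eq ψ hs, add_sub_cancel_left]
  refine (h.norm_integral_le (h.continuousOn_sol ψ) (fun t ht => h.norm_sol_le ψ ht) hs).trans_eq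
    (by ring)

end VolterraBound

theorem volterraSol_shift (A L : ℝ → W →L[ℂ] W) (ψ : W) (a s : ℝ) :
    volterraSol (fun t => A (a + t)) (fun t => L (a + t)) ψ s = volterraSol A L ψ (a + s) := by
  have : ∀ n s, volterraIter (fun t => A (a + t)) (fun t => L (a + t)) ψ n s =
      volterraIter A L ψ n (a + s) := by
    intro n
    induction n with
    | zero => intro s; rfl
    | succ n ih =>
      intro s
      simp only [volterraIter, ih]
      congr 1
      have := (measurePreserving_add_left volume a).setIntegral_preimage_emb
        (measurableEmbedding_addLeft a) (fun t => L t (volterraIter A L ψ n t)) (Ioi (a + s))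
      simpa using this
  simp only [volterraSol, this]

theorem volterraSol_congr {A A' L L' : ℝ → W →L[ℂ] W} (ψ : W) {s : ℝ} (hs : 0 ≤ s)
    (hA : ∀ t, 0 ≤ t → A t = A' t) (hL : ∀ t, 0 ≤ t → L t = L' t) :
    volterraSol A L ψ s = volterraSol A' L' ψ s := by
  have : ∀ n s, 0 ≤ s → volterraIter A L ψ n s = volterraIter A' L' ψ n s := by
    intro n
    induction n with
    | zero => intro s _; rfl
    | succ n ih =>
      intro s hs
      simp only [volterraIter, hA s hs]
      congr 1
      refine setIntegral_congr_fun measurableSet_Ioi fun t ht => ?_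
      simp only [hL t (hs.trans (le_of_lt ht)), ih t (hs.trans (le_of_lt ht))]
  simp only [volterraSol, fun n => this n s hs]

theorem differentiableOn_volterraSol [CompleteSpace W] {D : Set ℂ} (hD : IsOpen D)
    {A L : ℂ → ℝ → W →L[ℂ] W} {ψ : ℂ → W} {g G : ℝ → ℝ} {c : ℝ}
    (h : ∀ z ∈ D, VolterraBound (A z) (L z) g G)
    (hA : ∀ s, 0 ≤ s → DifferentiableOn ℂ (fun z => A z s) D)
    (hL : ∀ s, 0 ≤ s → DifferentiableOn ℂ (fun z => L z s) D)
    (hψ : DifferentiableOn ℂ ψ D) (hc : ∀ z ∈ D, ‖ψ z‖ ≤ c) {s : ℝ} (hs : 0 ≤ s) :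
    DifferentiableOn ℂ (fun z => volterraSol (A z) (L z) (ψ z) s) D := by
  have hn : ∀ n s, 0 ≤ s →
      DifferentiableOn ℂ (fun z => volterraIter (A z) (L z) (ψ z) n s) D := by
    intro n
    induction n with
    | zero => exact fun _ _ => hψ
    | succ n ih =>
      intro s hs
      have hle : ∀ z ∈ D, ∀ t, 0 ≤ t → ‖volterraIter (A z) (L z) (ψ z) n t‖ ≤
          (c * (1 / 2) ^ n) * Real.exp (2 * G t) := by
        intro z hz t ht
        refine ((h z hz).iter_spec (ψ z) n).2 t ht |>.trans ?_
        gcongr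
        exact hc z hz
      have heq : ∀ z ∈ D, volterraIter (A z) (L z) (ψ z) (n + 1) s =
          ∫ t in Ioi s, A z s (L z t (volterraIter (A z) (L z) (ψ z) n t)) := by
        intro z hz
        exact ((A z s).integral_comp_comm (((h z hz).integrableOn_apply
          ((h z hz).iter_spec (ψ z) n).1 (hle z hz)).mono_set (Ioi_subset_Ioi hs))).symm
      refine DifferentiableOn.congr ?_ heq
      rcases D.eq_empty_or_nonempty with rfl | ⟨z0, hz0⟩
      · exact differentiableOn_empty
      refine differentiableOn_integral_of_dominated hD
        (((h z0 hz0).integrableOn_weight hs).1.const_mul (c * (1 / 2) ^ n)) ?_ ?_ ?_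
      · intro z hz
        refine ContinuousOn.aestronglyMeasurable ?_ measurableSet_Ioi
        refine continuousOn_const.clm_apply ((((h z hz).contL).clm_apply
          ((h z hz).iter_spec (ψ z) n).1).mono fun t ht => hs.trans (le_of_lt ht))
      · refine (ae_restrict_iff' measurableSet_Ioi).2 (Eventually.of_forall fun t ht => ?_)
        have ht0 : (0 : ℝ) ≤ t := hs.trans (le_of_lt ht)
        exact (hA s hs).clm_apply ((hL t ht0).clm_apply (ih t ht0))
      · refine (ae_restrict_iff' measurableSet_Ioi).2 (Eventually.of_forall fun t ht z hz => ?_)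
        exact (h z hz).norm_comp_le (hle z hz) hs (le_of_lt ht)
  refine Complex.differentiableOn_tsum_of_summable_norm
    (u := fun n => c * Real.exp (2 * G s) * (1 / 2) ^ n)
    (summable_geometric_two.mul_left _) (fun n => hn n s hs) hD ?_
  intro n z hz
  refine ((h z hz).iter_spec (ψ z) n).2 s hs |>.trans ?_
  have := hc z hz
  calc ‖ψ z‖ * (1 / 2) ^ n * Real.exp (2 * G s) ≤ c * (1 / 2) ^ n * Real.exp (2 * G s) := by gcongr
    _ = _ := by ring

end Volterra

end

/-! ### Volterra equations along holomorphic flows -/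

section

open MeasureTheory Set

section Flow

variable {W : Type*} [NormedAddCommGroup W] [NormedSpace ℂ W]

namespace VolterraBound

theorem hasDerivWithinAt_integral [CompleteSpace W] {A L : ℝ → W →L[ℂ] W} {g G : ℝ → ℝ}
    (h : VolterraBound A L g G) (ψ : W) :
    HasDerivWithinAt (fun s => ∫ t in Ioi s, L t (volterraSol A L ψ t))
      (-(L 0 (volterraSol A L ψ 0))) (Ici 0) 0 := by
  set Z := volterraSol A L ψ
  have hZ := h.continuousOn_sol ψ
  have hcont : ContinuousOn (fun t => L t (Z t)) (Ici 0) := h.contL.clm_apply hZ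
  have hint : IntegrableOn (fun t => L t (Z t)) (Ioi 0) :=
    h.integrableOn_apply hZ fun t ht => h.norm_sol_le ψ ht
  have key : ∀ s ∈ Ici (0 : ℝ), ∫ t in Ioi s, L t (Z t) =
      (∫ t in Ioi 0, L t (Z t)) - ∫ t in (0 : ℝ)..s, L t (Z t) := by
    intro s hs
    have hii : IntervalIntegrable (fun t => L t (Z t)) volume 0 s := by
      rw [intervalIntegrable_iff, uIoc_of_le hs]
      exact hint.mono_set Ioc_subset_Ioi_self
    have := intervalIntegral.integral_interval_add_Ioi' hii (hint.mono_set (Ioi_subset_Ioi hs))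
    rw [← this]; abel
  have hd : HasDerivWithinAt (fun s => ∫ t in (0 : ℝ)..s, L t (Z t)) (L 0 (Z 0)) (Ici 0) 0 := by
    refine intervalIntegral.integral_hasDerivWithinAt_right (t := Ioi 0) (by simp) ?_
      ((hcont 0 (by simp)).mono Ioi_subset_Ici_self)
    exact ⟨Ioi 0, self_mem_nhdsWithin,
      (hcont.mono Ioi_subset_Ici_self).aestronglyMeasurable measurableSet_Ioi⟩
  refine HasDerivWithinAt.congr ?_ key (key 0 (by simp))
  exact hd.const_sub _

end VolterraBound

/-- A one-parameter semigroup of holomorphic self-maps of an open set `D` of the plane. -/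
structure HolomorphicFlow (φ : ℝ → ℂ → ℂ) (D : Set ℂ) : Prop where
  isOpen : IsOpen D
  maps : ∀ s, 0 ≤ s → ∀ z ∈ D, φ s z ∈ D
  zero : ∀ z ∈ D, φ 0 z = z
  add : ∀ a s, 0 ≤ a → 0 ≤ s → ∀ z ∈ D, φ (a + s) z = φ s (φ a z)
  diff : ∀ s, 0 ≤ s → DifferentiableOn ℂ (φ s) D

namespace HolomorphicFlow

variable {φ : ℝ → ℂ → ℂ} {D : Set ℂ} (hφ : HolomorphicFlow φ D)
  {a l : ℂ → W →L[ℂ] W} (ψ : W)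

variable (φ a l) in
/-- The value at time zero of the solution of the Volterra equation along the trajectory of `z`. As
a function of `z` it restricts, on each trajectory, to the solution of the Volterra equation there.
-/
noncomputable def sol (z : ℂ) : W := volterraSol (fun s => a (φ s z)) (fun s => l (φ s z)) ψ 0

include hφ

theorem sol_flow {z : ℂ} (hz : z ∈ D) {s : ℝ} (hs : 0 ≤ s) :
    sol φ a l ψ (φ s z) = volterraSol (fun s => a (φ s z)) (fun s => l (φ s z)) ψ s := by
  have := volterraSol_shift (fun s => a (φ s z)) (fun s => l (φ s z)) ψ s 0
  rw [add_zero] at this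
  rw [← this, sol]
  refine volterraSol_congr ψ le_rfl (fun t ht => ?_) (fun t ht => ?_) <;>
  rw [hφ.add s t hs ht z hz]

variable [CompleteSpace W]

theorem differentiableOn_sol (ha : DifferentiableOn ℂ a D) (hl : DifferentiableOn ℂ l D)
    (h : ∀ z ∈ D, ∃ U ∈ 𝓝 z, ∃ g G, ∀ z' ∈ U ∩ D,
      VolterraBound (fun s => a (φ s z')) (fun s => l (φ s z')) g G) :
    DifferentiableOn ℂ (sol φ a l ψ) D := by
  intro z hz
  obtain ⟨U, hU, g, G, hb⟩ := h z hz
  obtain ⟨O, hOU, hO, hzO⟩ := mem_nhds_iff.1 hU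
  have := differentiableOn_volterraSol (D := O ∩ D) (hO.inter hφ.isOpen)
    (A := fun z s => a (φ s z)) (L := fun z s => l (φ s z)) (ψ := fun _ => ψ) (c := ‖ψ‖)
    (fun z' hz' => hb z' ⟨hOU hz'.1, hz'.2⟩)
    (fun s hs => (ha.comp (hφ.diff s hs) (hφ.maps s hs)).mono inter_subset_right)
    (fun s hs => (hl.comp (hφ.diff s hs) (hφ.maps s hs)).mono inter_subset_right)
    (differentiableOn_const _) (fun _ _ => le_rfl) le_rfl
  exact (this.differentiableAt
    ((hO.inter hφ.isOpen).mem_nhds ⟨hzO, hz⟩)).differentiableWithinAt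

/-- The differential equation satisfied by `sol`. Differentiating the Volterra equation along a
trajectory gives the derivative in the direction `X` of the flow, and `sol` is holomorphic. -/
theorem deriv_sol (ha : DifferentiableOn ℂ a D) (hl : DifferentiableOn ℂ l D)
    (h : ∀ z ∈ D, ∃ U ∈ 𝓝 z, ∃ g G, ∀ z' ∈ U ∩ D,
      VolterraBound (fun s => a (φ s z')) (fun s => l (φ s z')) g G)
    {z : ℂ} (hz : z ∈ D) {X : ℂ} (hX : HasDerivWithinAt (fun s => φ s z) X (Ici 0) 0)
    {a' b : W →L[ℂ] W} (ha' : HasDerivAt a a' z) (hb : ∀ v, b (a z v) = v) :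
    X • deriv (sol φ a l ψ) z =
      X • a' (b (sol φ a l ψ z - ψ)) - a z (l z (sol φ a l ψ z)) := by
  obtain ⟨U, hU, g, G, hbd⟩ := h z hz
  have hV := hbd z ⟨mem_of_mem_nhds hU, hz⟩
  have hsolz : volterraSol (fun s => a (φ s z)) (fun s => l (φ s z)) ψ 0 = sol φ a l ψ z := rfl
  have hdf := ((hφ.differentiableOn_sol ψ ha hl h).differentiableAt
    (hφ.isOpen.mem_nhds hz)).hasDerivAt
  have h0 : φ 0 z = z := hφ.zero z hz
  have h1 : HasDerivWithinAt (fun s => sol φ a l ψ (φ s z)) (X • deriv (sol φ a l ψ) z)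
      (Ici 0) 0 := by
    rw [← h0] at hdf
    have := hdf.scomp_hasDerivWithinAt (0 : ℝ) hX
    simpa [h0, Function.comp_def] using this
  have h2 : HasDerivWithinAt (fun s => a (φ s z)) (X • a') (Ici 0) 0 := by
    rw [← h0] at ha'
    exact ha'.scomp_hasDerivWithinAt (0 : ℝ) hX
  have h3 := hV.hasDerivWithinAt_integral ψ
  rw [hsolz, h0] at h3
  have h4 : HasDerivWithinAt (fun s => ψ + a (φ s z) (∫ t in Ioi s, l (φ t z)
      (volterraSol (fun s => a (φ s z)) (fun s => l (φ s z)) ψ t)))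
      ((X • a') (∫ t in Ioi 0, l (φ t z)
      (volterraSol (fun s => a (φ s z)) (fun s => l (φ s z)) ψ t)) +
        a (φ 0 z) (-(l z (sol φ a l ψ z)))) (Ici 0) 0 := by
    refine HasDerivWithinAt.const_add _ ?_
    let T : (W →L[ℂ] W) →L[ℝ] W →L[ℝ] W :=
      (ContinuousLinearMap.restrictScalarsL ℂ W W ℝ ℝ)
    exact (T.hasFDerivAt.comp_hasDerivWithinAt (0 : ℝ) h2).clm_apply h3
  have h5 := h1.congr (f := fun s => sol φ a l ψ (φ s z)) (fun s hs => rfl) rfl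
  have h6 : HasDerivWithinAt (fun s => sol φ a l ψ (φ s z)) _ (Ici 0) 0 :=
    h4.congr (fun s hs => (hφ.sol_flow ψ hz hs).trans (hV.sol_eq ψ hs))
      ((hφ.sol_flow ψ hz le_rfl).trans (hV.sol_eq ψ le_rfl))
  have h7 := (uniqueDiffWithinAt_Ici (0 : ℝ)).eq_deriv _ h1 h6
  rw [h7]
  have h8 := hV.sol_eq ψ le_rfl
  rw [hsolz, h0] at h8
  have h9 : (∫ t in Ioi 0, l (φ t z)
      (volterraSol (fun s => a (φ s z)) (fun s => l (φ s z)) ψ t)) = b (sol φ a l ψ z - ψ) := by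
    conv_rhs => rw [h8]
    rw [add_sub_cancel_left, hb]
  rw [h9, h0]
  simp [sub_eq_add_neg]

end HolomorphicFlow

theorem hasDerivAt_expDecay (C s : ℝ) :
    HasDerivAt (fun s => C * Real.exp (-s)) (-(C * Real.exp (-s))) s := by
  have := (((hasDerivAt_id s).neg).exp).const_mul C
  simpa using this

theorem volterraBound_of_exp {L : ℝ → W →L[ℂ] W} (hL : ContinuousOn L (Ici 0)) {C : ℝ}
    (hC : ∀ s, 0 ≤ s → ‖L s‖ ≤ C * Real.exp (-s)) :
    VolterraBound (fun _ => 1) L (fun s => C * Real.exp (-s)) (fun s => C * Real.exp (-s)) where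
  contA := continuousOn_const
  contL := hL
  nonneg s hs := (norm_nonneg _).trans (hC s hs)
  deriv s _ := hasDerivAt_expDecay C s
  lim := by simpa using Real.tendsto_exp_neg_atTop_nhds_zero.const_mul C
  bound s t hs hst := by
    simpa [ContinuousLinearMap.one_def] using hC t (hs.trans hst)
  boundL := ⟨1, fun t ht => by simpa using hC t ht⟩

/-- The flow which contracts a star-shaped set to its centre. -/
theorem holomorphicFlow_contract {Ω : Set ℂ} (hΩ : IsOpen Ω) {x₀ : ℂ} (hs : StarConvex ℝ x₀ Ω) :
    HolomorphicFlow (fun s x => x₀ + (Real.exp (-s) : ℂ) * (x - x₀)) Ω where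
  isOpen := hΩ
  maps s hs0 z hz := by
    have := hs.add_smul_sub_mem hz (Real.exp_pos (-s)).le (Real.exp_le_one_iff.2 (by linarith))
    simpa using this
  zero z _ := by simp
  add a s _ _ z _ := by
    rw [neg_add, Real.exp_add]
    push_cast
    ring
  diff s _ := by fun_prop

/-- The initial value problem for a holomorphic linear differential equation on a star-shaped
domain, with holomorphic dependence on a parameter. In the coordinate `s` of the contracting flow
`x₀ + exp (-s) (x - x₀)`, the initial point is at `s = ∞` and the equation is a Volterra equation
with exponentially decaying kernel. -/
theorem exists_hasDerivAt_starConvex [CompleteSpace W] {Ω D : Set ℂ} (hΩ : IsOpen Ω) (hD : IsOpen D)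
    {x₀ : ℂ} (hx₀ : x₀ ∈ Ω) (hs : StarConvex ℝ x₀ Ω) {𝒜 : ℂ → ℂ → W →L[ℂ] W}
    (h𝒜 : DifferentiableOn ℂ (fun p : ℂ × ℂ => 𝒜 p.1 p.2) (Ω ×ˢ D))
    {v : ℂ → W} (hv : DifferentiableOn ℂ v D) :
    ∃ Y : ℂ → ℂ → W, (∀ E ∈ D, Y x₀ E = v E ∧
      ∀ x ∈ Ω, HasDerivAt (fun x => Y x E) (𝒜 x E (Y x E)) x) ∧
      ∀ x ∈ Ω, DifferentiableOn ℂ (Y x) D := by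
  set φ : ℝ → ℂ → ℂ := fun s x => x₀ + (Real.exp (-s) : ℂ) * (x - x₀) with hφdef
  have hφ := holomorphicFlow_contract hΩ hs
  set l : ℂ → ℂ → W →L[ℂ] W := fun E x => (x - x₀) • 𝒜 x E with hl
  have hlφ : ∀ E s x, l E (φ s x) = (Real.exp (-s) : ℂ) • (x - x₀) • 𝒜 (φ s x) E := by
    intro E s x
    simp only [hl, hφdef, add_sub_cancel_left, mul_smul]
  -- the kernel decays like `exp (-s)`, locally uniformly in the point and in the parameter
  have hbound : ∀ x ∈ Ω, ∀ E ∈ D, ∃ U ∈ 𝓝 x, ∃ U' ∈ 𝓝 E, ∃ C, ∀ x' ∈ U ∩ Ω, ∀ E' ∈ U' ∩ D,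
      VolterraBound (fun _ => 1) (fun s => l E' (φ s x'))
        (fun s => C * Real.exp (-s)) (fun s => C * Real.exp (-s)) := by
    intro x hx E hE
    obtain ⟨r, hr, hrΩ⟩ := Metric.nhds_basis_closedBall.mem_iff.1 (hΩ.mem_nhds hx)
    obtain ⟨r', hr', hrD⟩ := Metric.nhds_basis_closedBall.mem_iff.1 (hD.mem_nhds hE)
    have hK : IsCompact (Icc (0 : ℝ) 1 ×ˢ Metric.closedBall x r ×ˢ Metric.closedBall E r') :=
      isCompact_Icc.prod ((isCompact_closedBall x r).prod (isCompact_closedBall E r'))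
    have hc : ContinuousOn (fun p : ℝ × ℂ × ℂ =>
        (p.2.1 - x₀) • 𝒜 (x₀ + (p.1 : ℂ) * (p.2.1 - x₀)) p.2.2)
        (Icc (0 : ℝ) 1 ×ˢ Metric.closedBall x r ×ˢ Metric.closedBall E r') := by
      refine ContinuousOn.fun_smul (by fun_prop) ?_
      refine h𝒜.continuousOn.comp (f := fun p : ℝ × ℂ × ℂ =>
        (x₀ + (p.1 : ℂ) * (p.2.1 - x₀), p.2.2)) (Continuous.continuousOn (by fun_prop)) ?_
      rintro ⟨τ, y, e⟩ ⟨hτ, hy, he⟩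
      refine ⟨?_, hrD he⟩
      have := hs.add_smul_sub_mem (hrΩ hy) hτ.1 hτ.2
      simpa using this
    obtain ⟨C, hC⟩ := hK.exists_bound_of_continuousOn hc
    refine ⟨_, Metric.closedBall_mem_nhds x hr, _, Metric.closedBall_mem_nhds E hr', C, ?_⟩
    intro x' hx' E' hE'
    refine volterraBound_of_exp ?_ ?_
    · simp only [hlφ]
      refine ContinuousOn.fun_smul (by fun_prop) (continuousOn_const.fun_smul ?_)
      refine h𝒜.continuousOn.comp (f := fun s : ℝ => (φ s x', E'))
        (Continuous.continuousOn (by fun_prop)) ?_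
      exact fun s hs' => ⟨hφ.maps s hs' x' hx'.2, hE'.2⟩
    · intro s hs'
      rw [hlφ, norm_smul, mul_comm, Complex.norm_real, Real.norm_of_nonneg (Real.exp_pos _).le]
      gcongr
      exact hC (Real.exp (-s), x', E')
        ⟨⟨(Real.exp_pos _).le, Real.exp_le_one_iff.2 (by linarith)⟩, hx'.1, hE'.1⟩
  have h𝒜x : ∀ E ∈ D, DifferentiableOn ℂ (fun x => 𝒜 x E) Ω := fun E hE =>
    h𝒜.comp (f := fun x => (x, E)) (by fun_prop) fun x hx => ⟨hx, hE⟩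
  have h𝒜E : ∀ x ∈ Ω, DifferentiableOn ℂ (fun E => 𝒜 x E) D := fun x hx =>
    h𝒜.comp (f := fun E => (x, E)) (by fun_prop) fun E hE => ⟨hx, hE⟩
  have hφ' : HolomorphicFlow φ Ω := hφ
  refine ⟨fun x E => HolomorphicFlow.sol φ (fun _ => 1) (l E) (v E) x, ?_, ?_⟩
  · intro E hE
    have hld : DifferentiableOn ℂ (l E) Ω :=
      (by fun_prop : DifferentiableOn ℂ (fun x => x - x₀) Ω).smul (h𝒜x E hE)
    have hb : ∀ z ∈ Ω, ∃ U ∈ 𝓝 z, ∃ g G, ∀ z' ∈ U ∩ Ω,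
        VolterraBound (fun s => (fun _ => (1 : W →L[ℂ] W)) (φ s z'))
          (fun s => l E (φ s z')) g G := by
      intro z hz
      obtain ⟨U, hU, U', hU', C, hC⟩ := hbound z hz E hE
      exact ⟨U, hU, _, _, fun z' hz' => hC z' hz' E ⟨mem_of_mem_nhds hU', hE⟩⟩
    set f := HolomorphicFlow.sol φ (fun _ => (1 : W →L[ℂ] W)) (l E) (v E) with hf
    have hfd : DifferentiableOn ℂ f Ω := hφ'.differentiableOn_sol (v E)
      (differentiableOn_const _) hld hb
    have hne : ∀ x ∈ Ω, x ≠ x₀ → deriv f x = 𝒜 x E (f x) := by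
      intro x hx hxne
      have hX : HasDerivWithinAt (fun s => φ s x) (-(x - x₀)) (Ici 0) 0 := by
        have h1 : HasDerivAt (fun s : ℝ => Real.exp (-s)) (-1) 0 := by
          simpa using hasDerivAt_expDecay 1 0
        have h2 := (h1.ofReal_comp.mul_const (x - x₀)).const_add x₀
        simpa [hφdef] using h2.hasDerivWithinAt (s := Ici 0)
      have := hφ'.deriv_sol (v E) (differentiableOn_const _) hld hb hx hX
        (hasDerivAt_const x 1) (b := 1) (fun v => rfl)
      rw [← hf] at this
      simp only [_root_.zero_apply, smul_zero, zero_sub, hl,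
        one_apply_eq_self, _root_.smul_apply, neg_smul] at this
      exact smul_right_injective W (sub_ne_zero.2 hxne) (neg_injective this)
    refine ⟨?_, fun x hx => ?_⟩
    · obtain ⟨U, hU, g, G, hbd⟩ := hb x₀ hx₀
      have := (hbd x₀ ⟨mem_of_mem_nhds hU, hx₀⟩).sol_eq (v E) le_rfl
      change volterraSol _ _ _ _ = _
      rw [this]
      simp [hl, hφdef]
    · have hdx := (hfd.differentiableAt (hΩ.mem_nhds hx)).hasDerivAt
      -- at the centre the flow is stationary, and the equation holds there by continuity
      rcases eq_or_ne x x₀ with rfl | hxne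
      · have hc1 : ContinuousAt (deriv f) x :=
          ((hfd.deriv hΩ).differentiableAt (hΩ.mem_nhds hx)).continuousAt
        have hc2 : ContinuousAt (fun y => 𝒜 y E (f y)) x :=
          ((h𝒜x E hE).clm_apply hfd).continuousOn.continuousAt (hΩ.mem_nhds hx)
        have he : ∀ᶠ y in 𝓝[≠] x, 𝒜 y E (f y) = deriv f y := by
          filter_upwards [self_mem_nhdsWithin, mem_nhdsWithin_of_mem_nhds (hΩ.mem_nhds hx)]
            with y hy hyΩ
          exact (hne y hyΩ hy).symm
        have := tendsto_nhds_unique (hc1.tendsto.mono_left nhdsWithin_le_nhds)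
          ((hc2.tendsto.mono_left nhdsWithin_le_nhds).congr' he)
        rw [this] at hdx
        exact hdx
      · rw [hne x hx hxne] at hdx
        exact hdx
  · intro x hx E hE
    obtain ⟨U, hU, U', hU', C, hC⟩ := hbound x hx E hE
    obtain ⟨c, hc⟩ : ∃ c, ∀ᶠ E' in 𝓝 E, ‖v E'‖ ≤ c :=
      ⟨‖v E‖ + 1, ((hv.continuousOn.continuousAt (hD.mem_nhds hE)).norm.eventually
        (gt_mem_nhds (lt_add_one _))).mono fun _ h => h.le⟩
    obtain ⟨O, hO, hOo, hEO⟩ := mem_nhds_iff.1 (inter_mem (inter_mem hU' (hD.mem_nhds hE)) hc)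
    have hOD : O ⊆ D := fun e he => (hO he).1.2
    have := differentiableOn_volterraSol (D := O) hOo
      (A := fun E s => 1) (L := fun E s => l E (φ s x)) (ψ := v) (c := c)
      (fun E' hE' => hC x ⟨mem_of_mem_nhds hU, hx⟩ E' (hO hE').1)
      (fun s hs => differentiableOn_const _)
      (fun s hs => ((h𝒜E _ (hφ'.maps s hs x hx)).const_smul (φ s x - x₀)).mono hOD)
      (hv.mono hOD) (fun E' hE' => (hO hE').2) le_rfl
    exact (this.differentiableAt (hOo.mem_nhds hEO)).differentiableWithinAt

/-- Uniqueness for the Volterra equation with `ψ = 0`, in differential form: a solution tending to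
zero at infinity vanishes. On a half-line where the kernel has mass at most `1 / 2`, every bound on
`f` can be halved. -/
theorem VolterraBound.eventually_eq_zero {A L U : ℝ → W →L[ℂ] W} {g G : ℝ → ℝ}
    (h : VolterraBound A L g G) {f : ℝ → W}
    (hf : ∀ s, 0 ≤ s → HasDerivAt (fun t => U t (f t)) (-(L s (f s))) s)
    (hAU : ∀ s, 0 ≤ s → ∀ v, A s (U s v) = v) {C : ℝ}
    (hC : ∀ s t, 0 ≤ s → s ≤ t → ‖A s ∘L U t‖ ≤ C) (hlim : Tendsto f atTop (𝓝 0)) :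
    ∀ᶠ s in atTop, f s = 0 := by
  have hG0 : ∀ s, 0 ≤ s → 0 ≤ G s := fun s hs => by
    refine le_of_tendsto h.lim ?_
    filter_upwards [eventually_ge_atTop s] with t ht
    exact h.antitoneOn hs (hs.trans ht) ht
  have h1 : ∀ᶠ s in atTop, G s ≤ 1 / 2 := h.lim.eventually_le_const (by norm_num)
  have h2 : ∀ᶠ s in atTop, ‖f s‖ ≤ 1 :=
    (tendsto_zero_iff_norm_tendsto_zero.1 hlim).eventually_le_const (by norm_num)
  obtain ⟨s₀, hs₀⟩ := eventually_atTop.1 ((h1.and h2).and (eventually_ge_atTop 0))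
  have hs00 : 0 ≤ s₀ := (hs₀ s₀ le_rfl).2
  have key : ∀ n : ℕ, ∀ s, s₀ ≤ s → ‖f s‖ ≤ (1 / 2) ^ n := by
    intro n
    induction n with
    | zero => intro s hs; simpa using (hs₀ s hs).1.2
    | succ n ih =>
      intro s hs
      have hs0 : 0 ≤ s := hs00.trans hs
      have hT : ∀ T, s ≤ T → ‖f s‖ ≤ C * ‖f T‖ + (1 / 2) ^ (n + 1) := by
        intro T hT
        have hd : ∀ t, s ≤ t → HasDerivAt (fun t => A s (U t (f t)) - f s)
            (A s (-(L t (f t)))) t := fun t ht =>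
          (((A s).hasFDerivAt.restrictScalars ℝ).comp_hasDerivAt t
            (hf t (hs0.trans ht))).sub_const _
        have := image_norm_le_of_norm_deriv_right_le_deriv_boundary'
          (f := fun t => A s (U t (f t)) - f s) (a := s) (b := T)
          (f' := fun t => A s (-(L t (f t))))
          (B := fun t => (1 / 2) ^ n * (G s - G t)) (B' := fun t => (1 / 2) ^ n * g t)
          (fun t ht => (hd t ht.1).continuousAt.continuousWithinAt)
          (fun t ht => (hd t ht.1).hasDerivWithinAt) (by simp [hAU s hs0])
          ?_ ?_ ?_ (right_mem_Icc.2 hT)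
        · have hAT : ‖A s (U T (f T))‖ ≤ C * ‖f T‖ :=
            ((A s ∘L U T).le_opNorm _).trans (by gcongr; exact hC s T hs0 hT)
          have hb : (1 / 2 : ℝ) ^ n * (G s - G T) ≤ (1 / 2) ^ (n + 1) := by
            rw [pow_succ]
            gcongr
            linarith [(hs₀ s hs).1.1, hG0 T (hs0.trans hT)]
          have := norm_sub_norm_le (f s) (A s (U T (f T)))
          rw [norm_sub_rev] at this
          linarith
        · intro t ht
          exact ((((h.deriv t (hs0.trans ht.1)).const_sub (G s)).const_mul
            ((1 / 2 : ℝ) ^ n))).continuousAt.continuousWithinAt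
        · intro t ht
          simpa using (((h.deriv t (hs0.trans ht.1)).const_sub (G s)).const_mul
            ((1 / 2 : ℝ) ^ n)).hasDerivWithinAt
        · intro t ht
          rw [map_neg, norm_neg]
          calc ‖A s (L t (f t))‖ ≤ ‖A s ∘L L t‖ * ‖f t‖ := (A s ∘L L t).le_opNorm _
            _ ≤ g t * (1 / 2) ^ n := by
              gcongr
              · exact h.nonneg t (hs0.trans ht.1)
              · exact h.bound s t hs0 ht.1
              · exact ih t (hs.trans ht.1)
            _ = _ := mul_comm _ _
      have hl : Tendsto (fun T => C * ‖f T‖ + (1 / 2 : ℝ) ^ (n + 1)) atTop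
          (𝓝 (C * 0 + (1 / 2) ^ (n + 1))) :=
        ((tendsto_zero_iff_norm_tendsto_zero.1 hlim).const_mul C).add_const _
      have := ge_of_tendsto hl ((eventually_ge_atTop s).mono hT)
      simpa using this
  filter_upwards [eventually_ge_atTop s₀] with s hs
  have : ‖f s‖ ≤ 0 := ge_of_tendsto' (tendsto_pow_atTop_nhds_zero_of_lt_one
    (by norm_num : (0 : ℝ) ≤ 1 / 2) (by norm_num)) fun n => key n s hs
  exact norm_le_zero_iff.1 this

end Flow

end

/-! ### Exponentials and maximal eigenvalues -/

section

open MeasureTheory Set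

section BanachExp

variable {𝔸 : Type*} [NormedRing 𝔸] [NormedAlgebra ℂ 𝔸] [CompleteSpace 𝔸]

theorem exp_add_smul_one (x : 𝔸) (c : ℂ) :
    NormedSpace.exp (x + c • (1 : 𝔸)) = Complex.exp c • NormedSpace.exp x := by
  let _ : NormedAlgebra ℚ 𝔸 := .restrictScalars ℚ ℂ _
  rw [NormedSpace.exp_add_of_commute (((Commute.one_right x)).smul_right c),
    ← Algebra.algebraMap_eq_smul_one, ← NormedSpace.algebraMap_exp_comm, Complex.exp_eq_exp_ℂ,
    ← Algebra.commutes, Algebra.smul_def]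

theorem exp_smul_mul_of_commutator {h y : 𝔸} {r : ℂ} (hy : h * y = y * h + r • y) (c : ℂ) :
    NormedSpace.exp (c • h) * y = Complex.exp (c * r) • (y * NormedSpace.exp (c • h)) := by
  let _ : NormedAlgebra ℚ 𝔸 := .restrictScalars ℚ ℂ _
  have hs : SemiconjBy y (c • h + (c * r) • (1 : 𝔸)) (c • h) := by
    rw [SemiconjBy, smul_mul_assoc, hy, mul_add, mul_smul_comm, mul_smul_comm, mul_one, smul_add,
      smul_smul]
  have := hs.exp_right
  rw [exp_add_smul_one, SemiconjBy, mul_smul_comm] at this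
  exact this.symm

theorem exp_smul_mul_exp_smul (h : 𝔸) (a b : ℂ) :
    NormedSpace.exp (a • h) * NormedSpace.exp (b • h) = NormedSpace.exp ((a + b) • h) := by
  let _ : NormedAlgebra ℚ 𝔸 := .restrictScalars ℚ ℂ _
  rw [add_smul, NormedSpace.exp_add_of_commute
    (((Commute.refl h).smul_left a).smul_right b)]

theorem exp_neg_smul_mul_exp_smul (h : 𝔸) (a : ℂ) :
    NormedSpace.exp (-a • h) * NormedSpace.exp (a • h) = 1 := by
  rw [exp_smul_mul_exp_smul, neg_add_cancel, zero_smul, NormedSpace.exp_zero]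

theorem exp_smul_mul_exp_neg_smul (h : 𝔸) (a : ℂ) :
    NormedSpace.exp (a • h) * NormedSpace.exp (-a • h) = 1 := by
  rw [exp_smul_mul_exp_smul, add_neg_cancel, zero_smul, NormedSpace.exp_zero]

end BanachExp

section Cone

variable {V : Type*} [NormedAddCommGroup V] [NormedSpace ℂ V]

theorem exp_smul_apply_of_pow_apply_eq_zero [CompleteSpace V] {N : V →L[ℂ] V} {v : V} {k : ℕ}
    (hk : (N ^ k) v = 0) (z : ℂ) :
    NormedSpace.exp (z • N) v =
      ∑ j ∈ Finset.range k, (z ^ j / (j.factorial : ℂ)) • (N ^ j) v := by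
  have h1 := NormedSpace.exp_series_hasSum_exp' (𝕂 := ℂ) (z • N)
  have h2 := h1.mapL (ContinuousLinearMap.apply ℂ V v)
  rw [ContinuousLinearMap.apply_apply] at h2
  rw [← h2.tsum_eq, tsum_eq_sum (s := Finset.range k)]
  · refine Finset.sum_congr rfl fun j _ => ?_
    simp [smul_pow, smul_smul, div_eq_inv_mul]
  · intro j hj
    obtain ⟨i, rfl⟩ := Nat.exists_eq_add_of_le (not_lt.1 (Finset.mem_range.not.1 hj))
    have : (N ^ (k + i)) v = 0 := by
      rw [add_comm, pow_add]
      simp [hk]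
    simp [smul_pow, this]

theorem cone_re_mul_le {ν z : ℂ} {τ : ℝ} (hν : ν.re < 0)
    (hz : ‖z - τ‖ ≤ -ν.re / (2 * ‖ν‖) * τ) : (z * ν).re ≤ τ * ν.re / 2 := by
  have hν0 : 0 < ‖ν‖ := norm_pos_iff.2 fun h => by simp [h] at hν
  have h1 : (z * ν).re = τ * ν.re + ((z - τ) * ν).re := by
    simp
    ring
  have h2 : ((z - τ) * ν).re ≤ ‖z - τ‖ * ‖ν‖ := by
    rw [← norm_mul]; exact Complex.re_le_norm _
  have h3 : ‖z - τ‖ * ‖ν‖ ≤ -ν.re / 2 * τ := by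
    calc _ ≤ (-ν.re / (2 * ‖ν‖) * τ) * ‖ν‖ := by gcongr
      _ = _ := by field_simp
  linarith

/-- On a generalized eigenvector of `A` for an eigenvalue `μ` with `Re μ < Re lam`, the operators
`exp (z (A - lam))` are bounded uniformly for `z` in a narrow cone around the positive real axis. -/
theorem exists_bound_exp_maxGenEigenspace [CompleteSpace V] (A : V →L[ℂ] V) {μ lam : ℂ} {v : V}
    {k : ℕ} (hk : ((A - μ • (1 : V →L[ℂ] V)) ^ k) v = 0) (hμ : (μ - lam).re < 0) :
    ∃ ε > 0, ∃ C, ∀ τ : ℝ, 0 ≤ τ → ∀ z : ℂ, ‖z - τ‖ ≤ ε * τ →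
      ‖NormedSpace.exp (z • (A - lam • (1 : V →L[ℂ] V))) v‖ ≤ C := by
  set ν := μ - lam with hνdef
  set N := A - μ • (1 : V →L[ℂ] V)
  have hν0 : 0 < ‖ν‖ := norm_pos_iff.2 fun h => by simp [h] at hμ
  set ε := -ν.re / (2 * ‖ν‖)
  have hε : 0 < ε := div_pos (by linarith) (by positivity)
  set c := -ν.re / 2 with hc
  have hc0 : 0 < c := by simp only [hc]; linarith
  refine ⟨ε, hε, ∑ j ∈ Finset.range k, ((1 + ε) / c) ^ j * ‖(N ^ j) v‖, ?_⟩
  intro τ hτ z hz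
  have h1 : z • (A - lam • (1 : V →L[ℂ] V)) = z • N + (z * ν) • (1 : V →L[ℂ] V) := by
    simp only [N, hνdef]
    module
  rw [h1, exp_add_smul_one, _root_.smul_apply, norm_smul, Complex.norm_exp,
    exp_smul_apply_of_pow_apply_eq_zero hk]
  have hre : (z * ν).re ≤ -(c * τ) := by
    have := cone_re_mul_le hμ hz
    simp only [hc]; linarith
  have hzn : ‖z‖ ≤ (1 + ε) * τ := by
    calc ‖z‖ = ‖(z - τ) + τ‖ := by simp
      _ ≤ ‖z - τ‖ + ‖(τ : ℂ)‖ := norm_add_le _ _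
      _ ≤ ε * τ + τ := by
        rw [Complex.norm_real, Real.norm_of_nonneg hτ]; gcongr
      _ = _ := by ring
  calc _ ≤ Real.exp (-(c * τ)) * ∑ j ∈ Finset.range k, ‖z‖ ^ j / j.factorial * ‖(N ^ j) v‖ := by
        gcongr
        refine (norm_sum_le _ _).trans (Finset.sum_le_sum fun j _ => ?_)
        rw [norm_smul]
        simp
    _ ≤ _ := by
        rw [Finset.mul_sum]
        refine Finset.sum_le_sum fun j _ => ?_
        rw [← mul_assoc]
        gcongr
        have h2 : (c * τ) ^ j / j.factorial ≤ Real.exp (c * τ) :=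
          Real.pow_div_factorial_le_exp _ (by positivity) j
        calc Real.exp (-(c * τ)) * (‖z‖ ^ j / j.factorial)
            ≤ Real.exp (-(c * τ)) * (((1 + ε) * τ) ^ j / j.factorial) := by gcongr
          _ = ((1 + ε) / c) ^ j * (Real.exp (-(c * τ)) * ((c * τ) ^ j / j.factorial)) := by
              rw [div_pow, mul_pow, mul_pow]
              field_simp
          _ ≤ ((1 + ε) / c) ^ j * (Real.exp (-(c * τ)) * Real.exp (c * τ)) := by gcongr
          _ = _ := by rw [← Real.exp_add]; simp

variable [FiniteDimensional ℂ V]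

/-- If `lam` is a maximal eigenvalue of `A`, then the operators `exp (z (A - lam))` are bounded
uniformly for `z` in a narrow cone around the positive real axis. This is where the simplicity of
the maximal eigenvalue enters: a Jordan block would make the operators grow polynomially. -/
theorem exists_cone_bound {A : Module.End ℂ V} {lam : ℝ} (h : ODEIM.IsMaximalEigenvalue A lam) :
    ∃ ε > 0, ∃ C, ∀ τ : ℝ, 0 ≤ τ → ∀ z : ℂ, ‖z - τ‖ ≤ ε * τ →
      ‖NormedSpace.exp (z • (LinearMap.toContinuousLinearMap A - (lam : ℂ) • (1 : V →L[ℂ] V)))‖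
        ≤ C := by
  have _ : CompleteSpace V := FiniteDimensional.complete ℂ V
  obtain ⟨hev, hmult, hmax⟩ := h
  set A' := LinearMap.toContinuousLinearMap A
  set P : V → Prop := fun v => ∃ ε > 0, ∃ C, ∀ τ : ℝ, 0 ≤ τ → ∀ z : ℂ, ‖z - τ‖ ≤ ε * τ →
      ‖NormedSpace.exp (z • (A' - (lam : ℂ) • (1 : V →L[ℂ] V))) v‖ ≤ C with hP
  have hall : ∀ v, P v := by
    intro v
    have hv : v ∈ ⨆ μ : ℂ, A.maxGenEigenspace μ := by
      rw [Module.End.iSup_maxGenEigenspace_eq_top]; trivial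
    induction hv using Submodule.iSup_induction' with
    | zero => exact ⟨1, one_pos, 0, by simp⟩
    | add x y hx hy ihx ihy =>
      obtain ⟨ε, hε, C, hC⟩ := ihx
      obtain ⟨ε', hε', C', hC'⟩ := ihy
      refine ⟨min ε ε', lt_min hε hε', C + C', fun τ hτ z hz => ?_⟩
      rw [map_add]
      refine (norm_add_le _ _).trans (add_le_add (hC τ hτ z (hz.trans ?_))
        (hC' τ hτ z (hz.trans ?_)))
      · gcongr; exact min_le_left _ _
      · gcongr; exact min_le_right _ _
    | mem μ v hv =>
      have hpow : ∀ k : ℕ, ∀ w, ((A' - μ • (1 : V →L[ℂ] V)) ^ k) w =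
          ((A - μ • (1 : Module.End ℂ V)) ^ k) w := by
        intro k
        induction k with
        | zero => intro w; rfl
        | succ k ih => intro w; rw [pow_succ, pow_succ]; exact ih _
      by_cases hμ : μ = lam
      · subst hμ
        -- both are one-dimensional, `lam` being a simple root of the characteristic polynomial
        have heq : A.eigenspace (lam : ℂ) = A.maxGenEigenspace (lam : ℂ) := by
          refine Submodule.eq_of_le_of_finrank_le Module.End.eigenspace_le_maxGenEigenspace ?_
          rw [A.finrank_maxGenEigenspace_eq, hmult]
          exact Submodule.one_le_finrank_iff.2 hev
        rw [← heq, Module.End.mem_eigenspace_iff] at hv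
        refine ⟨1, one_pos, ‖v‖, fun τ hτ z hz => ?_⟩
        rw [exp_smul_apply_of_pow_apply_eq_zero (k := 1)]
        · simp
        · rw [hpow]; simp [hv]
      · by_cases hv0 : v = 0
        · subst hv0; exact ⟨1, one_pos, 0, by simp⟩
        obtain ⟨k, hk⟩ := (A.mem_maxGenEigenspace μ v).1 hv
        have hμev : A.HasEigenvalue μ := by
          refine Module.End.hasEigenvalue_of_hasGenEigenvalue (k := k) ?_
          refine Module.End.HasUnifEigenvector.hasUnifEigenvalue (x := v) ⟨?_, hv0⟩
          rw [Module.End.mem_genEigenspace_nat, LinearMap.mem_ker]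
          exact hk
        refine exists_bound_exp_maxGenEigenspace A' (k := k) (by rw [hpow]; exact hk) ?_
        have := hmax μ hμev hμ
        simpa using this
  -- the opening of the cone depends on the vector; finitely many basis vectors suffice
  have hfin : ∃ ε > 0, ∃ C : V → ℝ, ∀ i ∈ range (Module.finBasis ℂ V), ∀ τ : ℝ, 0 ≤ τ → ∀ z : ℂ,
      ‖z - τ‖ ≤ ε * τ → ‖NormedSpace.exp (z • (A' - (lam : ℂ) • (1 : V →L[ℂ] V))) i‖ ≤ C i := by
    choose e he C hC using hall
    obtain ⟨ε, hε, hmin⟩ : ∃ ε > 0, ∀ i, ε ≤ e (Module.finBasis ℂ V i) := by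
      rcases isEmpty_or_nonempty (Fin (Module.finrank ℂ V)) with hE | hE
      · exact ⟨1, one_pos, fun i => hE.elim i⟩
      · obtain ⟨i, hi⟩ := Finite.exists_min (fun i => e (Module.finBasis ℂ V i))
        exact ⟨_, he _, hi⟩
    refine ⟨ε, hε, C, ?_⟩
    rintro _ ⟨i, rfl⟩ τ hτ z hz
    refine hC _ τ hτ z (hz.trans ?_)
    gcongr
    exact hmin i
  obtain ⟨ε, hε, C, hC⟩ := hfin
  let b := Module.finBasis ℂ V
  obtain ⟨K, hK0, hK⟩ := b.exists_opNorm_le (F := V)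
  set M := ∑ i, |C (b i)|
  refine ⟨ε, hε, K * M, fun τ hτ z hz => ?_⟩
  refine hK (M := M) (Finset.sum_nonneg fun i _ => abs_nonneg _) fun i => ?_
  refine (hC _ ⟨i, rfl⟩ τ hτ z hz).trans ((le_abs_self _).trans ?_)
  exact Finset.single_le_sum (f := fun i => |C (b i)|) (fun i _ => abs_nonneg _) (Finset.mem_univ i)

end Cone

end

/-! ### The evaluation representation -/

section LieAlgebraPart

open ODEIM

attribute [local instance 100] LieRing.ofAssociativeRing

variable {𝔤 : Type*} [LieRing 𝔤] [LieAlgebra ℂ 𝔤]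
  {V : Type*} [AddCommGroup V] [Module ℂ V] [LieRingModule 𝔤 V] [LieModule ℂ 𝔤 V]

theorem evalRep_mon (k : ℕ) (ζ : ℂˣ) (n : ℤ) (x : 𝔤) :
    evalRep V k ζ (Affine.mon k n x) = (ζ : ℂ) ^ n • LieModule.toEnd ℂ 𝔤 V x := by
  change loopEval V ζ (LaurentPolynomial.T n ⊗ₜ[ℂ] x) = _
  erw [loopEval_tmul]
  simp [laurentEval]

section Basis

variable {H : LieSubalgebra ℂ 𝔤} [H.IsCartanSubalgebra]
  {ι : Type*} [Fintype ι] (b : LieAlgebra.Basis ι H)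

theorem f_mem_rootSpace (i : ι) :
    b.f i ∈ LieAlgebra.rootSpace H (-b.baseSupp i : Module.Dual ℂ H) := by
  refine (LieModule.weightSpace_le_genWeightSpace 𝔤 _) ?_
  rw [LieModule.mem_weightSpace]
  intro x
  have := b.baseSupp_apply_smul_f i x
  rw [LinearMap.neg_apply, neg_smul, this, neg_neg]

/-- A lowest root vector commutes with the lowering operators. -/
theorem lie_lowest_f {a : 𝔤} (ha : IsLowestRootVector b a) (i : ι) : ⁅a, b.f i⁆ = 0 := by
  obtain ⟨-, β, -, haβ, hβ⟩ := ha
  have h := LieAlgebra.lie_mem_genWeightSpace_of_mem_genWeightSpace haβ (f_mem_rootSpace b i)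
  have h2 : (β + -(b.baseSupp i) : H → ℂ) = (β - b.baseSupp i : Module.Dual ℂ H) := by
    ext x; simp [sub_eq_add_neg]
  have h3 := hβ i
  rw [← h2] at h3
  have h4 : ⁅a, b.f i⁆ ∈ LieAlgebra.rootSpace H (β + -(b.baseSupp i) : H → ℂ) := h
  rw [h3] at h4
  simpa using h4

/-- Every element of the Cartan subalgebra is a commutator `[e, y]` with `y` a combination of the
lowering operators `f i`; such a `y` commutes with the lowest root vector. -/
theorem exists_lie_eq_cartan {a : 𝔤} (ha : IsLowestRootVector b a) (x : H) :
    ∃ y : 𝔤, ⁅∑ i, b.e i, y⁆ = (x : 𝔤) ∧ ⁅a, y⁆ = 0 := by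
  classical
  have hx : (x : 𝔤) ∈ Submodule.span ℂ (Set.range b.h) := by
    rw [← b.coe_cartan_eq_span]; exact x.2
  obtain ⟨c, hc⟩ := (Submodule.mem_span_range_iff_exists_fun ℂ).1 hx
  refine ⟨∑ i, c i • b.f i, ?_, ?_⟩
  · rw [← hc, lie_sum]
    refine Finset.sum_congr rfl fun i _ => ?_
    rw [lie_smul, sum_lie, Finset.sum_eq_single i]
    · rw [(b.sl2 i).lie_e_f]
    · intro j _ hj
      exact b.lie_e_f_ne j i hj
    · simp
  · rw [lie_sum]
    refine Finset.sum_eq_zero fun i _ => ?_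
    rw [lie_smul, lie_lowest_f b ha, smul_zero]

/-- The Cartan subalgebra acts by commutators with `Λ = e₀ + e`. -/
theorem exists_commutator_eq_evalRep (k : ℕ) (ζ : ℂˣ) {e e₀ : Affine 𝔤 k}
    (he : e = ∑ i, Affine.mon k 0 (b.e i)) {a : 𝔤} (ha : IsLowestRootVector b a)
    (he₀ : e₀ = Affine.mon k 1 a) (x : H) :
    ∃ F : Module.End ℂ V, evalRep V k ζ (e₀ + e) * F - F * evalRep V k ζ (e₀ + e) =
      evalRep V k ζ (Affine.mon k 0 (x : 𝔤)) := by
  obtain ⟨y, hy1, hy2⟩ := exists_lie_eq_cartan b ha x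
  refine ⟨LieModule.toEnd ℂ 𝔤 V y, ?_⟩
  have h1 : evalRep V k ζ e = LieModule.toEnd ℂ 𝔤 V (∑ i, b.e i) := by
    rw [he, map_sum, map_sum]
    refine Finset.sum_congr rfl fun i _ => ?_
    rw [evalRep_mon]; simp
  have h2 : evalRep V k ζ e₀ = (ζ : ℂ) • LieModule.toEnd ℂ 𝔤 V a := by
    rw [he₀, evalRep_mon]; simp
  rw [← LieRing.of_associative_ring_bracket, map_add, add_lie, h1, h2, smul_lie,
    ← LieHom.map_lie, ← LieHom.map_lie, hy1, hy2, evalRep_mon]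
  simp

omit [H.IsCartanSubalgebra] in
include b in
theorem evalRep_cartan_commute (k : ℕ) (ζ : ℂˣ) (x y : H) :
    evalRep V k ζ (Affine.mon k 0 (x : 𝔤)) * evalRep V k ζ (Affine.mon k 0 (y : 𝔤)) =
      evalRep V k ζ (Affine.mon k 0 (y : 𝔤)) * evalRep V k ζ (Affine.mon k 0 (x : 𝔤)) := by
  have := b.isLieAbelian_cartan
  have h : ⁅(x : 𝔤), (y : 𝔤)⁆ = 0 := by
    rw [← LieSubalgebra.coe_bracket, trivial_lie_zero]; rfl
  rw [← sub_eq_zero, ← LieRing.of_associative_ring_bracket, evalRep_mon, evalRep_mon]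
  simp only [zpow_zero, one_smul]
  rw [← LieHom.map_lie, h, map_zero]

end Basis

theorem evalRep_mul_of_lie_eq_smul (k : ℕ) (ζ : ℂˣ) {x y : Affine 𝔤 k} {r : ℂ}
    (h : ⁅x, y⁆ = r • y) :
    evalRep V k ζ x * evalRep V k ζ y =
      evalRep V k ζ y * evalRep V k ζ x + r • evalRep V k ζ y := by
  rw [← sub_eq_iff_eq_add', ← LieRing.of_associative_ring_bracket, ← LieHom.map_lie, h, map_smul]

end LieAlgebraPart

theorem ODEIM.ADEType.two_le_dualCoxeter (X : ODEIM.ADEType) : 2 ≤ X.dualCoxeter := by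
  cases X <;> simp only [ODEIM.ADEType.dualCoxeter] <;> omega

/-! ### The truncated root and the action -/

section

open MeasureTheory Set

section Root

open Polynomial

theorem binomialSeries_pow (r : ℂ) (n : ℕ) :
    PowerSeries.binomialSeries ℂ r ^ n = PowerSeries.binomialSeries ℂ (n * r) := by
  induction n with
  | zero => simp
  | succ n ih =>
    rw [pow_succ, ih, ← PowerSeries.binomialSeries_add]
    congr 1
    push_cast; ring

/-- The Taylor polynomial `Q` of degree `s` of `(1 + v) ^ (1 / k)`. -/
noncomputable def rootPoly (k s : ℕ) : ℂ[X] :=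
  ∑ j ∈ Finset.range (s + 1), C (Ring.choose ((1 : ℂ) / k) j) * X ^ j

theorem rootPoly_coeff (k s d : ℕ) :
    (rootPoly k s).coeff d = if d < s + 1 then Ring.choose ((1 : ℂ) / k) d else 0 := by
  simp [rootPoly, Polynomial.coeff_X_pow]

theorem rootPoly_eq_trunc (k s : ℕ) :
    rootPoly k s = (PowerSeries.binomialSeries ℂ ((1 : ℂ) / k)).trunc (s + 1) := by
  ext d
  rw [rootPoly_coeff, PowerSeries.coeff_trunc]
  simp

/-- The truncated root is a root up to the order of truncation: `Q ^ k = 1 + X` modulo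
`X ^ (s + 1)`. -/
theorem X_pow_dvd_rootPoly_pow_sub {k : ℕ} (hk : k ≠ 0) (s : ℕ) :
    (X : ℂ[X]) ^ (s + 1) ∣ rootPoly k s ^ k - (1 + X) := by
  rw [Polynomial.X_pow_dvd_iff]
  intro d hd
  have h1 : ((rootPoly k s ^ k : ℂ[X])).coeff d =
      ((PowerSeries.trunc (s + 1)) ((PowerSeries.binomialSeries ℂ ((1 : ℂ) / k)) ^ k)).coeff d := by
    rw [← PowerSeries.trunc_trunc_pow, ← rootPoly_eq_trunc, PowerSeries.coeff_trunc, if_pos hd,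
      ← Polynomial.coe_pow, Polynomial.coeff_coe]
  rw [Polynomial.coeff_sub, h1, PowerSeries.coeff_trunc, if_pos hd, binomialSeries_pow,
    mul_one_div_cancel (by exact_mod_cast hk : (k : ℂ) ≠ 0)]
  have h2 := PowerSeries.binomialSeries_nat (R := ℂ) (A := ℂ) 1
  rw [Nat.cast_one, pow_one] at h2
  rw [h2]
  have h3 : (1 + PowerSeries.X : PowerSeries ℂ) = ((1 + X : ℂ[X]) : PowerSeries ℂ) := by simp
  rw [h3, Polynomial.coeff_coe, sub_self]

/-- The polynomial `Q₁` with `x q'(x) = x ^ M Q₁(v)`, where `q(x) = x ^ M Q(v)`, `Q` is the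
truncated root and `v = -E x ^ (-M k)`. -/
noncomputable def rootPolyDeriv (M : ℝ) (k s : ℕ) : ℂ[X] :=
  ∑ j ∈ Finset.range (s + 1), C (((M * (1 - k * j) : ℝ) : ℂ) * Ring.choose ((1 : ℂ) / k) j) * X ^ j

theorem rootPoly_eval_zero (k s : ℕ) : (rootPoly k s).eval 0 = 1 := by
  rw [← Polynomial.coeff_zero_eq_eval_zero, rootPoly_coeff]
  simp

theorem X_dvd_rootPolyDeriv_sub (M : ℝ) (k s : ℕ) :
    X ∣ rootPolyDeriv M k s - C (M : ℂ) * rootPoly k s := by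
  rw [Polynomial.X_dvd_iff, Polynomial.coeff_sub, Polynomial.coeff_C_mul, rootPoly_coeff]
  simp [rootPolyDeriv, Polynomial.coeff_X_pow]

end Root

namespace ODEIM

/-- The variable `v = -E x ^ (-M k)`, small at infinity, in which `p = x ^ (M k) (1 + v)`. -/
noncomputable def smallVar (M : ℝ) (k : ℕ) (x E : ℂ) : ℂ := -E * x ^ ((-(M * k) : ℝ) : ℂ)

theorem cpow_step {x : ℂ} (hx : x ≠ 0) (M : ℝ) (k j : ℕ) :
    x ^ ((M * (1 - k * j) : ℝ) : ℂ) = x ^ (M : ℂ) * (x ^ ((-(M * k) : ℝ) : ℂ)) ^ j := by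
  rw [← Complex.cpow_mul_nat, ← Complex.cpow_add _ _ hx]
  congr 1
  push_cast; ring

theorem qTerm_eq {x : ℂ} (hx : x ≠ 0) (M : ℝ) (k j : ℕ) (E : ℂ) :
    qTerm M k j x E = x ^ (M : ℂ) * (Ring.choose ((1 : ℂ) / k) j * smallVar M k x E ^ j) := by
  rw [qTerm, coeff, cpow_step hx, smallVar, mul_pow]
  ring

theorem q_eq {x : ℂ} (hx : x ≠ 0) (M : ℝ) (k : ℕ) (E : ℂ) :
    q M k x E = x ^ (M : ℂ) * (rootPoly k (truncOrder M k)).eval (smallVar M k x E) := by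
  simp only [q, qTerm_eq hx, rootPoly, Polynomial.eval_finsetSum, Finset.mul_sum]
  simp

theorem pot_eq {x : ℂ} (hx : x ≠ 0) (M : ℝ) (k : ℕ) (E : ℂ) :
    pot M k x E = x ^ ((M * k : ℝ) : ℂ) * (1 + smallVar M k x E) := by
  have : x ^ ((M * k : ℝ) : ℂ) * x ^ ((-(M * k) : ℝ) : ℂ) = 1 := by
    rw [← Complex.cpow_add _ _ hx]; simp
  rw [pot, smallVar, mul_add, mul_one, mul_left_comm, this]
  ring

/-- The derivative of `q` with respect to `x`. -/
noncomputable def qDeriv (M : ℝ) (k : ℕ) (x E : ℂ) : ℂ :=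
  x⁻¹ * (x ^ (M : ℂ) * (rootPolyDeriv M k (truncOrder M k)).eval (smallVar M k x E))

theorem hasDerivAt_q {x : ℂ} (hx : x ∈ Complex.slitPlane) (M : ℝ) (k : ℕ) (E : ℂ) :
    HasDerivAt (fun x => q M k x E) (qDeriv M k x E) x := by
  have hx0 := Complex.slitPlane_ne_zero hx
  have h : HasDerivAt (fun x => q M k x E) (∑ j ∈ Finset.range (truncOrder M k + 1),
      coeff k j E * (((M * (1 - k * j) : ℝ) : ℂ) * x ^ (((M * (1 - k * j) : ℝ) : ℂ) - 1) * 1))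
      x := by
    simp only [q, qTerm]
    exact HasDerivAt.fun_sum fun j _ => ((hasDerivAt_id x).cpow_const hx).const_mul _
  convert! h using 1
  simp only [qDeriv, rootPolyDeriv, Polynomial.eval_finsetSum, Finset.mul_sum]
  refine Finset.sum_congr rfl fun j _ => ?_
  rw [Complex.cpow_sub _ _ hx0, Complex.cpow_one, cpow_step hx0]
  simp only [Polynomial.eval_mul, Polynomial.eval_C, Polynomial.eval_pow, Polynomial.eval_X,
    coeff, smallVar, mul_pow]
  field_simp

/-- The primitive of `x ^ a` on the slit plane which vanishes at `0` if `a > -1`, and is `log x` if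
`a = -1`. -/
noncomputable def powPrim (a : ℝ) (x : ℂ) : ℂ :=
  if a = -1 then Complex.log x else x ^ ((a : ℂ) + 1) / ((a : ℂ) + 1)

theorem hasDerivAt_powPrim {x : ℂ} (hx : x ∈ Complex.slitPlane) (a : ℝ) :
    HasDerivAt (powPrim a) (x ^ (a : ℂ)) x := by
  have hx0 := Complex.slitPlane_ne_zero hx
  by_cases ha : a = -1
  · have : powPrim a = Complex.log := by ext; simp [powPrim, ha]
    rw [this, ha]
    push_cast
    rw [Complex.cpow_neg_one]
    exact Complex.hasDerivAt_log hx
  · have : powPrim a = fun x => x ^ ((a : ℂ) + 1) / ((a : ℂ) + 1) := by ext; simp [powPrim, ha]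
    rw [this]
    have hne : (a : ℂ) + 1 ≠ 0 := by
      intro h
      apply ha
      have : ((a + 1 : ℝ) : ℂ) = 0 := by push_cast; exact h
      have : a + 1 = 0 := by exact_mod_cast this
      linarith
    have := (((hasDerivAt_id x).cpow_const (c := (a : ℂ) + 1) hx).div_const ((a : ℂ) + 1))
    convert! this using 1
    simp
    field_simp

/-- For `t = 0` both sides are zero unless `a = 0`, and then both are one. -/
theorem ofReal_mul_cpow {a : ℝ} {x : ℂ} (hx : x ≠ 0) {t : ℝ} (ht : 0 ≤ t) :
    ((t : ℂ) * x) ^ (a : ℂ) = (t : ℂ) ^ (a : ℂ) * x ^ (a : ℂ) := by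
  rcases ht.eq_or_lt with rfl | ht
  · by_cases ha : a = 0
    · simp [ha]
    · have : (a : ℂ) ≠ 0 := by exact_mod_cast ha
      simp [Complex.zero_cpow this]
  · have ht0 : (t : ℂ) ≠ 0 := by exact_mod_cast ht.ne'
    rw [Complex.cpow_def_of_ne_zero (mul_ne_zero ht0 hx), Complex.cpow_def_of_ne_zero ht0,
      Complex.cpow_def_of_ne_zero hx, Complex.log_ofReal_mul ht hx, ← Complex.exp_add,
      ← Complex.ofReal_log ht.le, add_mul]

theorem segInt_eqOn {a : ℝ} {c x : ℂ} (hx : x ≠ 0) :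
    EqOn (fun t : ℝ => c * ((t : ℂ) * x) ^ (a : ℂ) * x)
      (fun t : ℝ => (c * x ^ (a : ℂ) * x) * (t : ℂ) ^ (a : ℂ)) (uIcc 0 1) := by
  intro t ht
  rw [uIcc_of_le zero_le_one] at ht
  simp only
  rw [ofReal_mul_cpow hx ht.1]
  ring

theorem segInt_pow {a : ℝ} (ha : -1 < a) (c : ℂ) {x : ℂ} (hx : x ≠ 0) :
    segInt (fun y => c * y ^ (a : ℂ)) x = c * powPrim a x := by
  rw [segInt, intervalIntegral.integral_congr (segInt_eqOn hx),
    intervalIntegral.integral_const_mul, integral_cpow (Or.inl (by simpa using ha)), powPrim,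
    if_neg ha.ne', Complex.cpow_add _ _ hx]
  have hne : (a : ℂ) + 1 ≠ 0 := by
    intro h
    have : ((a + 1 : ℝ) : ℂ) = 0 := by push_cast; exact h
    have : a + 1 = 0 := by exact_mod_cast this
    linarith
  simp [Complex.zero_cpow hne]
  ring

theorem intervalIntegrable_pow {a : ℝ} (ha : -1 < a) (c : ℂ) {x : ℂ} (hx : x ≠ 0) :
    IntervalIntegrable (fun t : ℝ => c * ((t : ℂ) * x) ^ (a : ℂ) * x) volume 0 1 := by
  have h := (intervalIntegral.intervalIntegrable_cpow' (a := 0) (b := 1) (r := (a : ℂ))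
    (by simpa using ha)).const_mul (c * x ^ (a : ℂ) * x)
  refine h.congr ?_
  intro t ht
  exact (segInt_eqOn hx (uIoc_subset_uIcc ht)).symm

theorem truncOrder_le {M : ℝ} (hM : 0 < M) {k : ℕ} (hk : k ≠ 0) :
    (truncOrder M k : ℝ) * (k * M) ≤ M + 1 := by
  have hkM : 0 < (k : ℝ) * M := mul_pos (by positivity) hM
  rw [← le_div_iff₀ hkM]
  exact Nat.floor_le (by positivity)

theorem lt_truncOrder_succ {M : ℝ} (hM : 0 < M) {k : ℕ} (hk : k ≠ 0) :
    M + 1 < ((truncOrder M k : ℝ) + 1) * (k * M) := by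
  have hkM : 0 < (k : ℝ) * M := mul_pos (by positivity) hM
  rw [← div_lt_iff₀ hkM]
  exact Nat.lt_floor_add_one _

/-- The action is the sum of the primitives of the terms of `q`, whether or not the last term is a
multiple of `1 / x`. -/
theorem action_eq {M : ℝ} (hM : 0 < M) {k : ℕ} (hk : k ≠ 0) {x : ℂ} (hx : x ≠ 0) (E : ℂ) :
    action M k x E = ∑ j ∈ Finset.range (truncOrder M k + 1),
      coeff k j E * powPrim (M * (1 - k * j)) x := by
  have hk0 : (0 : ℝ) < k := by positivity
  have hle := truncOrder_le hM hk
  have hkM : 0 < (k : ℝ) * M := mul_pos (by positivity) hM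
  have hlt : ∀ j : ℕ, j < truncOrder M k → -1 < M * (1 - k * (j : ℝ)) := by
    intro j hj
    have : (j : ℝ) < truncOrder M k := by exact_mod_cast hj
    nlinarith
  rw [action]
  split_ifs with h
  · rw [Finset.sum_range_succ]
    congr 1
    · exact Finset.sum_congr rfl fun j hj => segInt_pow (hlt j (Finset.mem_range.1 hj)) _ hx
    · rw [powPrim, if_pos]
      rw [← h]
      field_simp
      ring
  · have hs : -1 < M * (1 - k * (truncOrder M k : ℝ)) := by
      have hne : (truncOrder M k : ℝ) * (k * M) ≠ M + 1 := by
        intro h'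
        apply h
        rw [← h', mul_div_cancel_right₀ _ hkM.ne']
      have := lt_of_le_of_ne hle hne
      nlinarith
    have hle' : ∀ j ∈ Finset.range (truncOrder M k + 1), -1 < M * (1 - k * (j : ℝ)) := by
      intro j hj
      rcases (Nat.lt_succ_iff.1 (Finset.mem_range.1 hj)).eq_or_lt with rfl | hj
      · exact hs
      · exact hlt j hj
    rw [segInt]
    simp only [q, Finset.sum_mul, qTerm]
    rw [intervalIntegral.integral_finsetSum
      fun j hj => intervalIntegrable_pow (hle' j hj) _ hx]
    exact Finset.sum_congr rfl fun j hj => segInt_pow (hle' j hj) _ hx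

theorem hasDerivAt_action {M : ℝ} (hM : 0 < M) {k : ℕ} (hk : k ≠ 0) {x : ℂ}
    (hx : x ∈ Complex.slitPlane) (E : ℂ) :
    HasDerivAt (fun x => action M k x E) (q M k x E) x := by
  have h : HasDerivAt (fun x => ∑ j ∈ Finset.range (truncOrder M k + 1),
      coeff k j E * powPrim (M * (1 - k * j)) x) (q M k x E) x := by
    simp only [q, qTerm]
    exact HasDerivAt.fun_sum fun j _ => (hasDerivAt_powPrim hx _).const_mul _
  refine h.congr_of_eventuallyEq ?_
  filter_upwards [Complex.isOpen_slitPlane.mem_nhds hx] with y hy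
  exact action_eq hM hk (Complex.slitPlane_ne_zero hy) E

section Joint

variable {M : ℝ} {k : ℕ} {p : ℂ × ℂ} (hp : p.1 ∈ Complex.slitPlane)
include hp

theorem differentiableAt_fst_cpow (a : ℂ) :
    DifferentiableAt ℂ (fun p : ℂ × ℂ => p.1 ^ a) p :=
  DifferentiableAt.cpow_const differentiableAt_fst hp

theorem differentiableAt_pot : DifferentiableAt ℂ (fun p : ℂ × ℂ => pot M k p.1 p.2) p :=
  (differentiableAt_fst_cpow hp _).sub differentiableAt_snd

theorem differentiableAt_smallVar :
    DifferentiableAt ℂ (fun p : ℂ × ℂ => smallVar M k p.1 p.2) p :=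
  (differentiableAt_snd.neg).mul (differentiableAt_fst_cpow hp _)

omit hp in
theorem differentiable_coeff (k j : ℕ) : Differentiable ℂ (coeff k j) := by
  unfold coeff; fun_prop

theorem differentiableAt_q : DifferentiableAt ℂ (fun p : ℂ × ℂ => q M k p.1 p.2) p := by
  simp only [q, qTerm]
  exact DifferentiableAt.fun_sum fun j _ =>
    (((differentiable_coeff k j) _).comp p differentiableAt_snd).mul
      (differentiableAt_fst_cpow hp _)

theorem differentiableAt_qDeriv :
    DifferentiableAt ℂ (fun p : ℂ × ℂ => qDeriv M k p.1 p.2) p := by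
  unfold qDeriv
  refine (differentiableAt_fst.inv (Complex.slitPlane_ne_zero hp)).mul
    ((differentiableAt_fst_cpow hp _).mul ?_)
  exact ((Polynomial.differentiable _) _).comp p (differentiableAt_smallVar hp)

theorem differentiableAt_action (hM : 0 < M) (hk : k ≠ 0) :
    DifferentiableAt ℂ (fun p : ℂ × ℂ => action M k p.1 p.2) p := by
  have h : DifferentiableAt ℂ (fun p : ℂ × ℂ => ∑ j ∈ Finset.range (truncOrder M k + 1),
      coeff k j p.2 * powPrim (M * (1 - k * j)) p.1) p :=
    DifferentiableAt.fun_sum fun j _ =>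
      (((differentiable_coeff k j) _).comp p differentiableAt_snd).mul
        ((hasDerivAt_powPrim hp _).differentiableAt.comp p differentiableAt_fst)
  refine h.congr_of_eventuallyEq ?_
  filter_upwards [(continuous_fst.continuousAt (x := p)).preimage_mem_nhds
    (Complex.isOpen_slitPlane.mem_nhds hp)] with y hy
  exact action_eq hM hk (Complex.slitPlane_ne_zero hy) y.2

end Joint

end ODEIM

end

/-! ### Gauge transformations -/

section

open MeasureTheory Set

namespace ODEIM

/-- The operators which enter the linear equation, in an abstract algebra: `e`, `e₀`, the grading
element `h`, the residue `ell`, and elements `Fh`, `Fell` whose commutators with `Λ = e₀ + e` are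
`h` and `ell`. -/
structure GaugeData (𝔸 : Type*) [Ring 𝔸] [Algebra ℂ 𝔸] (k : ℕ) where
  e : 𝔸
  e₀ : 𝔸
  h : 𝔸
  ell : 𝔸
  Fh : 𝔸
  Fell : 𝔸
  h_mul_e : h * e = e * h + (1 : ℂ) • e
  h_mul_e₀ : h * e₀ = e₀ * h + (-((k : ℂ) - 1)) • e₀
  h_mul_ell : h * ell = ell * h
  comm_Fh : (e₀ + e) * Fh - Fh * (e₀ + e) = h
  comm_Fell : (e₀ + e) * Fell - Fell * (e₀ + e) = ell

namespace GaugeData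

noncomputable section

variable {𝔸 : Type*} [NormedRing 𝔸] [NormedAlgebra ℂ 𝔸] {k : ℕ} (d : GaugeData 𝔸 k)
  (M : ℝ) (lam : ℂ) (x E : ℂ)

/-- An element whose commutator with `Λ` is `ell - M h`, the leading coefficient of the terms of
order `1 / x` of the equation after the gauge transformation by `q ^ (-h)`. -/
def F : 𝔸 := d.Fell - (M : ℂ) • d.Fh

/-- The coefficient `n = -1 / (x q)` of the second gauge transformation `1 + n F`. -/
def _root_.ODEIM.gaugeScalar (M : ℝ) (k : ℕ) (x E : ℂ) : ℂ := -(x * q M k x E)⁻¹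

/-- The derivative of `gaugeScalar` with respect to `x`. -/
def _root_.ODEIM.gaugeScalarDeriv (M : ℝ) (k : ℕ) (x E : ℂ) : ℂ :=
  (q M k x E + x * qDeriv M k x E) / (x * q M k x E) ^ 2

/-- The error `p / q ^ (k - 1) - q`, which vanishes for the exact root `q = p ^ (1 / k)`. -/
def _root_.ODEIM.rootDefect (M : ℝ) (k : ℕ) (x E : ℂ) : ℂ :=
  pot M k x E / q M k x E ^ (k - 1) - q M k x E

/-- The gauge transformation `1 + n F`, which removes the terms of order `1 / x`. -/
def G : 𝔸 := 1 + gaugeScalar M k x E • d.F M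

/-- The gauge transformation `q ^ (-h)`, which makes the leading term of the equation `q Λ`. -/
def P : 𝔸 := NormedSpace.exp (-Complex.log (q M k x E) • d.h)

/-- The total gauge transformation `exp (-lam S) q ^ (-h) (1 + n F)`. -/
def T : 𝔸 := Complex.exp (-lam * action M k x E) • (d.P M x E * d.G M x E)

/-- The remainder of the transformed equation, before division by `1 + n F`. -/
def Rt : 𝔸 :=
  gaugeScalarDeriv M k x E • d.F M +
    (x⁻¹ • d.ell - (qDeriv M k x E / q M k x E) • d.h + rootDefect M k x E • d.e₀) *
      (gaugeScalar M k x E • d.F M) +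
    rootDefect M k x E • d.e₀ - (qDeriv M k x E / q M k x E - M * x⁻¹) • d.h

/-- The remainder of the transformed equation `Z' = -(q (Λ - lam) + R) Z`. -/
def R : 𝔸 := Ring.inverse (d.G M x E) * d.Rt M x E

/-- The coefficient `ℓ / x + e + p e₀` of the linear equation. -/
def conn : 𝔸 := x⁻¹ • d.ell + d.e + pot M k x E • d.e₀

variable {M x E}

theorem comm_F : (d.e₀ + d.e) * d.F M - d.F M * (d.e₀ + d.e) = d.ell - (M : ℂ) • d.h := by
  rw [← d.comm_Fell, ← d.comm_Fh, F, mul_sub, sub_mul, mul_smul_comm, smul_mul_assoc, smul_sub]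
  abel

theorem _root_.ODEIM.hasDerivAt_gaugeScalar (hx : x ∈ Complex.slitPlane) (hq : q M k x E ≠ 0) :
    HasDerivAt (fun x => gaugeScalar M k x E) (gaugeScalarDeriv M k x E) x := by
  have hx0 := Complex.slitPlane_ne_zero hx
  have := (((hasDerivAt_id x).mul (hasDerivAt_q hx M k E)).inv (mul_ne_zero hx0 hq)).neg
  convert! this using 1
  simp [gaugeScalarDeriv]
  ring

variable [CompleteSpace 𝔸]

theorem hasDerivAt_P (hx : x ∈ Complex.slitPlane) (hq : q M k x E ∈ Complex.slitPlane) :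
    HasDerivAt (fun x => d.P M x E) (-(qDeriv M k x E / q M k x E) • (d.h * d.P M x E)) x := by
  have h1 := ((hasDerivAt_q hx M k E).clog hq).neg
  exact (hasDerivAt_exp_smul_const' d.h _).scomp x h1

theorem h_mul_P : d.h * d.P M x E = d.P M x E * d.h := by
  have := exp_smul_mul_of_commutator (h := d.h) (y := d.h) (r := 0) (by simp)
    (-Complex.log (q M k x E))
  simpa [P] using this.symm

theorem ell_mul_P : d.ell * d.P M x E = d.P M x E * d.ell := by
  have := exp_smul_mul_of_commutator (h := d.h) (y := d.ell) (r := 0) (by simp [d.h_mul_ell])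
    (-Complex.log (q M k x E))
  simpa [P] using this.symm

theorem e_mul_P (hq : q M k x E ≠ 0) :
    d.e * d.P M x E = q M k x E • (d.P M x E * d.e) := by
  have := exp_smul_mul_of_commutator d.h_mul_e (-Complex.log (q M k x E))
  rw [mul_one, Complex.exp_neg, Complex.exp_log hq] at this
  rw [P, this, smul_smul, mul_inv_cancel₀ hq, one_smul]

/-- Conjugation by `q ^ (-h)` multiplies `e` by `q` and `e₀` by `q ^ (1 - k)`. -/
theorem e₀_mul_P (hk : k ≠ 0) (hq : q M k x E ≠ 0) :
    d.e₀ * d.P M x E = (q M k x E ^ (k - 1))⁻¹ • (d.P M x E * d.e₀) := by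
  have := exp_smul_mul_of_commutator d.h_mul_e₀ (-Complex.log (q M k x E))
  have h2 : -Complex.log (q M k x E) * -((k : ℂ) - 1) =
      ((k - 1 : ℕ) : ℂ) * Complex.log (q M k x E) := by
    rw [Nat.cast_sub (Nat.one_le_iff_ne_zero.2 hk)]; push_cast; ring
  rw [h2, Complex.exp_nat_mul, Complex.exp_log hq] at this
  rw [P, this, smul_smul, inv_mul_cancel₀ (pow_ne_zero _ hq), one_smul]

omit [CompleteSpace 𝔸] in
/-- The terms of order `1 / x` cancel, because `n q = -1 / x` and `[Λ, F] = ell - M h`. -/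
theorem gauge_identity (hx : x ≠ 0) (hq : q M k x E ≠ 0) :
    gaugeScalarDeriv M k x E • d.F M - (qDeriv M k x E / q M k x E) • (d.h * d.G M x E)
        - (lam * q M k x E) • d.G M x E =
      -((x⁻¹ • d.ell + q M k x E • d.e + (pot M k x E / q M k x E ^ (k - 1)) • d.e₀) * d.G M x E)
      + d.G M x E * (q M k x E • (d.e₀ + d.e - lam • 1)) + d.Rt M x E := by
  have hcomm := d.comm_F (M := M)
  have hn : x⁻¹ = -(q M k x E * gaugeScalar M k x E) := by
    rw [gaugeScalar]; field_simp
  rw [G, Rt, rootDefect, hn]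
  set n := gaugeScalar M k x E
  set n' := gaugeScalarDeriv M k x E
  set w := q M k x E
  set w' := qDeriv M k x E / w
  set p := pot M k x E / w ^ (k - 1)
  set F := d.F M
  simp only [mul_add, add_mul, mul_sub, sub_mul, smul_mul_assoc, mul_smul_comm, smul_add, smul_sub,
    mul_one, one_mul, smul_smul] at hcomm ⊢
  have h0 : d.e₀ * F = d.ell - (M : ℂ) • d.h + F * d.e₀ + F * d.e - d.e * F := by
    rw [← hcomm]; abel
  rw [h0]
  module

/-- If `Z' = -(q (Λ - lam) + R) Z` then `T Z` solves the linear equation. -/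
theorem hasDerivAt_T (hM : 0 < M) (hk : k ≠ 0) (hx : x ∈ Complex.slitPlane)
    (hq : q M k x E ∈ Complex.slitPlane) (hG : IsUnit (d.G M x E)) :
    HasDerivAt (fun x => d.T M lam x E) (-(d.conn M x E * d.T M lam x E) +
      d.T M lam x E * (q M k x E • (d.e₀ + d.e - lam • 1) + d.R M x E)) x := by
  have hq0 := Complex.slitPlane_ne_zero hq
  have h1 := ((hasDerivAt_action hM hk hx E).const_mul (-lam)).cexp
  have h2 := d.hasDerivAt_P hx hq
  have h3 : HasDerivAt (fun x => d.G M x E) (gaugeScalarDeriv M k x E • d.F M) x :=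
    ((hasDerivAt_gaugeScalar hx hq0).smul_const _).const_add 1
  have h4 := h1.smul (h2.mul h3)
  convert! h4 using 1
  have hid := d.gauge_identity lam (Complex.slitPlane_ne_zero hx) hq0
  have hGR : d.G M x E * d.R M x E = d.Rt M x E := by
    rw [R, ← mul_assoc, Ring.mul_inverse_cancel _ hG, one_mul]
  rw [← hGR] at hid
  have hid2 := congrArg (fun y => Complex.exp (-lam * action M k x E) • (d.P M x E * y)) hid
  simp only [T, conn]
  set c := Complex.exp (-lam * action M k x E)
  have ha := d.h_mul_P (M := M) (x := x) (E := E)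
  have hb := d.ell_mul_P (M := M) (x := x) (E := E)
  have hc := d.e_mul_P hq0
  have hd := d.e₀_mul_P hk hq0
  set Q := d.P M x E
  set Γ := d.G M x E
  have hb' : (x⁻¹ • d.ell + d.e + pot M k x E • d.e₀) * Q =
      Q * (x⁻¹ • d.ell + q M k x E • d.e + (pot M k x E / q M k x E ^ (k - 1)) • d.e₀) := by
    rw [add_mul, add_mul, smul_mul_assoc, smul_mul_assoc, hb, hc, hd, mul_add, mul_add,
      mul_smul_comm, mul_smul_comm, mul_smul_comm, smul_smul, div_eq_mul_inv]
  rw [mul_smul_comm, ← mul_assoc, hb', ha]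
  simp only [smul_mul_assoc, mul_assoc] at hid2 ⊢
  set Y := x⁻¹ • d.ell + q M k x E • d.e + (pot M k x E / q M k x E ^ (k - 1)) • d.e₀
  have e1 : -(c • (Q * (Y * Γ))) + c • (Q * (Γ * (q M k x E • (d.e₀ + d.e - lam • 1) + d.R M x E)))
      = c • (Q * (-(Y * Γ) + Γ * q M k x E • (d.e₀ + d.e - lam • 1) + Γ * d.R M x E)) := by
    simp only [mul_add, mul_neg, smul_add, smul_neg]
    abel
  rw [e1, ← hid2]
  simp only [mul_sub, mul_smul_comm, smul_add, smul_sub, smul_smul, neg_smul, neg_mul]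
  module

end

end GaugeData

end ODEIM

end

/-! ### Estimates at infinity -/

section

open MeasureTheory Set Asymptotics

namespace ODEIM

/-- The half-opening `π / (2 (M + 1))` of the sector, in which `x ^ (M + 1)` has positive real
part. -/
noncomputable def halfAngle (M : ℝ) : ℝ := Real.pi / (2 * (M + 1))

theorem halfAngle_pos {M : ℝ} (hM : 0 < M) : 0 < halfAngle M := by
  have := Real.pi_pos
  unfold halfAngle; positivity

theorem succ_mul_halfAngle {M : ℝ} (hM : 0 < M) : (M + 1) * halfAngle M = Real.pi / 2 := by
  unfold halfAngle
  field_simp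

theorem halfAngle_lt {M : ℝ} (hM : 0 < M) : halfAngle M < Real.pi / 2 := by
  nlinarith [succ_mul_halfAngle hM, halfAngle_pos hM]

theorem mem_slitPlane_of_abs_arg_lt {x : ℂ} {φ : ℝ} (hφ : φ ≤ Real.pi) (hx : x ≠ 0)
    (h : |x.arg| < φ) : x ∈ Complex.slitPlane := by
  rw [Complex.mem_slitPlane_iff_arg]
  exact ⟨fun h' => by rw [h', abs_of_pos Real.pi_pos] at h; linarith, hx⟩

/-- The filter of `x → ∞` in the sector `|arg x| < φ`, uniformly for `E` in the disc of
radius `ρ`. -/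
noncomputable def unifInfty (φ ρ : ℝ) : Filter (ℂ × ℂ) := sectorInfty φ ×ˢ 𝓟 (Metric.ball 0 ρ)

variable {M ρ φ : ℝ} {k : ℕ}

theorem tendsto_norm_fst_unifInfty :
    Tendsto (fun p : ℂ × ℂ => ‖p.1‖) (unifInfty φ ρ) atTop :=
  tendsto_norm_cobounded_atTop.comp (tendsto_fst.mono_right inf_le_left)

theorem eventually_arg_unifInfty : ∀ᶠ p in unifInfty φ ρ, |p.1.arg| < φ :=
  (tendsto_fst (f := sectorInfty φ) (g := 𝓟 (Metric.ball (0 : ℂ) ρ))).eventually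
    (mem_inf_of_right (mem_principal_self _))

theorem eventually_snd_unifInfty : ∀ᶠ p in unifInfty φ ρ, ‖p.2‖ < ρ := by
  have := (tendsto_snd (f := sectorInfty φ) (g := 𝓟 (Metric.ball (0 : ℂ) ρ))).eventually
    (mem_principal_self _)
  exact this.mono fun _ hp => by simpa using hp

theorem eventually_ne_unifInfty : ∀ᶠ p in unifInfty φ ρ, p.1 ≠ 0 :=
  (tendsto_norm_fst_unifInfty.eventually_gt_atTop 0).mono fun _ hp => norm_pos_iff.1 hp

theorem exists_of_eventually_unifInfty {P : ℂ × ℂ → Prop} (h : ∀ᶠ p in unifInfty φ ρ, P p) :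
    ∃ N : ℝ, ∀ x E : ℂ, N < ‖x‖ → |x.arg| < φ → ‖E‖ < ρ → P (x, E) := by
  rw [unifInfty, eventually_prod_principal_iff, sectorInfty, eventually_inf_principal,
    ← comap_norm_atTop, eventually_comap] at h
  obtain ⟨N, hN⟩ := eventually_atTop.1 h
  exact ⟨N, fun x E hx ha hE => hN ‖x‖ hx.le x rfl ha E (by simpa using hE)⟩

theorem isBigO_cpow (a : ℝ) : (fun p : ℂ × ℂ => p.1 ^ (a : ℂ)) =O[unifInfty φ ρ]
    (fun p => ‖p.1‖ ^ a) :=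
  IsBigO.of_norm_eventuallyLE (Eventually.of_forall fun _ => (Complex.norm_cpow_real _ _).le)

theorem isBigO_rpow_rpow {a b : ℝ} (hab : a ≤ b) : (fun p : ℂ × ℂ => ‖p.1‖ ^ a)
    =O[unifInfty φ ρ] (fun p => ‖p.1‖ ^ b) := by
  refine IsBigO.of_norm_eventuallyLE ?_
  filter_upwards [tendsto_norm_fst_unifInfty.eventually_ge_atTop 1] with p hp
  rw [Real.norm_of_nonneg (by positivity)]
  exact Real.rpow_le_rpow_of_exponent_le hp hab

theorem tendsto_rpow_unifInfty {a : ℝ} (ha : a < 0) :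
    Tendsto (fun p : ℂ × ℂ => ‖p.1‖ ^ a) (unifInfty φ ρ) (𝓝 0) := by
  have := (tendsto_rpow_neg_atTop (y := -a) (by linarith)).comp
    (tendsto_norm_fst_unifInfty (φ := φ) (ρ := ρ))
  simpa [Function.comp_def] using this

theorem isBigO_smallVar : (fun p : ℂ × ℂ => smallVar M k p.1 p.2) =O[unifInfty φ ρ]
    (fun p => ‖p.1‖ ^ (-(M * k))) := by
  have h1 : (fun p : ℂ × ℂ => -p.2) =O[unifInfty φ ρ] (fun _ => (1 : ℝ)) := by
    refine IsBigO.of_bound ρ ?_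
    filter_upwards [eventually_snd_unifInfty] with p hp
    simpa using hp.le
  simpa [smallVar] using h1.mul (isBigO_cpow (-(M * k)))

theorem tendsto_smallVar (hM : 0 < M) (hk : k ≠ 0) :
    Tendsto (fun p : ℂ × ℂ => smallVar M k p.1 p.2) (unifInfty φ ρ) (𝓝 0) := by
  refine isBigO_smallVar.trans_tendsto (tendsto_rpow_unifInfty ?_)
  have : 0 < M * k := by positivity
  linarith

theorem tendsto_eval_smallVar (hM : 0 < M) (hk : k ≠ 0) (P : Polynomial ℂ) :
    Tendsto (fun p : ℂ × ℂ => P.eval (smallVar M k p.1 p.2)) (unifInfty φ ρ) (𝓝 (P.eval 0)) :=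
  (P.continuous.tendsto 0).comp (tendsto_smallVar hM hk)

theorem isBigO_eval_smallVar (hM : 0 < M) (hk : k ≠ 0) (P : Polynomial ℂ) :
    (fun p : ℂ × ℂ => P.eval (smallVar M k p.1 p.2)) =O[unifInfty φ ρ] (fun _ => (1 : ℝ)) :=
  (tendsto_eval_smallVar hM hk P).isBigO_one ℝ

/-- The quotient `q / x ^ M = Q(v)`, the value of the truncated root. -/
noncomputable def rootVal (M : ℝ) (k : ℕ) (p : ℂ × ℂ) : ℂ :=
  (rootPoly k (truncOrder M k)).eval (smallVar M k p.1 p.2)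

theorem tendsto_rootVal (hM : 0 < M) (hk : k ≠ 0) :
    Tendsto (rootVal M k) (unifInfty φ ρ) (𝓝 1) := by
  have := tendsto_eval_smallVar (φ := φ) (ρ := ρ) hM hk (rootPoly k (truncOrder M k))
  rwa [rootPoly_eval_zero] at this

theorem eventually_rootVal_ne (hM : 0 < M) (hk : k ≠ 0) :
    ∀ᶠ p in unifInfty φ ρ, rootVal M k p ≠ 0 :=
  (tendsto_rootVal hM hk).eventually_ne one_ne_zero

theorem isBigO_rootVal_inv (hM : 0 < M) (hk : k ≠ 0) :
    (fun p => (rootVal M k p)⁻¹) =O[unifInfty φ ρ] (fun _ => (1 : ℝ)) :=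
  ((tendsto_rootVal hM hk).inv₀ one_ne_zero).isBigO_one ℝ

theorem isBigO_inv_fst : (fun p : ℂ × ℂ => p.1⁻¹) =O[unifInfty φ ρ] (fun p => ‖p.1‖ ^ (-1 : ℝ)) :=
  IsBigO.of_norm_eventuallyLE (Eventually.of_forall fun p => by simp [Real.rpow_neg_one])

theorem isBigO_inv_one : (fun p : ℂ × ℂ => p.1⁻¹) =O[unifInfty φ ρ] (fun _ => (1 : ℝ)) := by
  refine isBigO_inv_fst.trans ?_
  simpa using isBigO_rpow_rpow (φ := φ) (ρ := ρ) (a := -1) (b := 0) (by norm_num)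

theorem rpow_mul_eventuallyEq (a b : ℝ) :
    (fun p : ℂ × ℂ => ‖p.1‖ ^ a * ‖p.1‖ ^ b) =ᶠ[unifInfty φ ρ] (fun p => ‖p.1‖ ^ (a + b)) := by
  filter_upwards [eventually_ne_unifInfty] with p hp
  rw [Real.rpow_add (norm_pos_iff.2 hp)]

theorem isBigO_gaugeScalar (hM : 0 < M) (hk : k ≠ 0) :
    (fun p : ℂ × ℂ => gaugeScalar M k p.1 p.2) =O[unifInfty φ ρ] (fun p => ‖p.1‖ ^ (-1 - M)) := by
  have h := ((isBigO_inv_fst (φ := φ) (ρ := ρ)).mul (isBigO_cpow (-M))).mul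
    (isBigO_rootVal_inv hM hk)
  simp only [mul_one] at h
  refine (h.neg_left.congr' ?_ (rpow_mul_eventuallyEq _ _))
  filter_upwards [eventually_ne_unifInfty] with p hp
  rw [gaugeScalar, q_eq hp, rootVal, mul_inv, mul_inv, Complex.ofReal_neg, Complex.cpow_neg,
    mul_assoc]

theorem isBigO_gaugeScalarDeriv (hM : 0 < M) (hk : k ≠ 0) :
    (fun p : ℂ × ℂ => gaugeScalarDeriv M k p.1 p.2) =O[unifInfty φ ρ]
      (fun p => ‖p.1‖ ^ (-1 - M)) := by
  have h := (((isBigO_inv_fst (φ := φ) (ρ := ρ)).mul (isBigO_cpow (-M))).mul isBigO_inv_one).mul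
    ((isBigO_eval_smallVar hM hk (rootPoly k (truncOrder M k) +
      rootPolyDeriv M k (truncOrder M k))).mul
      ((isBigO_rootVal_inv hM hk).mul (isBigO_rootVal_inv hM hk)))
  simp only [mul_one] at h
  refine (h.congr' ?_ (rpow_mul_eventuallyEq _ _))
  filter_upwards [eventually_ne_unifInfty, eventually_rootVal_ne hM hk] with p hp hQ
  have hxM : p.1 ^ (M : ℂ) ≠ 0 := by simp [Complex.cpow_eq_zero_iff, hp]
  rw [gaugeScalarDeriv, qDeriv, q_eq hp, Complex.ofReal_neg, Complex.cpow_neg, rootVal,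
    Polynomial.eval_add]
  rw [rootVal] at hQ
  field_simp

theorem qDeriv_div_q {p : ℂ × ℂ} (hp : p.1 ≠ 0) :
    qDeriv M k p.1 p.2 / q M k p.1 p.2 = p.1⁻¹ *
      ((rootPolyDeriv M k (truncOrder M k)).eval (smallVar M k p.1 p.2) *
        (rootVal M k p)⁻¹) := by
  have hxM : p.1 ^ (M : ℂ) ≠ 0 := by simp [Complex.cpow_eq_zero_iff, hp]
  rw [qDeriv, q_eq hp, rootVal]
  field_simp

theorem isBigO_qDeriv_div_q (hM : 0 < M) (hk : k ≠ 0) :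
    (fun p : ℂ × ℂ => qDeriv M k p.1 p.2 / q M k p.1 p.2) =O[unifInfty φ ρ]
      (fun _ => (1 : ℝ)) := by
  have h := (isBigO_inv_one (φ := φ) (ρ := ρ)).mul ((isBigO_eval_smallVar hM hk
    (rootPolyDeriv M k (truncOrder M k))).mul (isBigO_rootVal_inv hM hk))
  simp only [mul_one] at h
  refine h.congr' ?_ EventuallyEq.rfl
  filter_upwards [eventually_ne_unifInfty] with p hp
  rw [qDeriv_div_q hp]

theorem isBigO_qDeriv_div_q_sub (hM : 0 < M) (hk : k ≠ 0) :
    (fun p : ℂ × ℂ => qDeriv M k p.1 p.2 / q M k p.1 p.2 - M * p.1⁻¹) =O[unifInfty φ ρ]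
      (fun p => ‖p.1‖ ^ (-1 - M * k)) := by
  obtain ⟨P, hP⟩ := X_dvd_rootPolyDeriv_sub M k (truncOrder M k)
  have h := ((isBigO_inv_fst (φ := φ) (ρ := ρ)).mul (isBigO_smallVar (M := M) (k := k))).mul
    ((isBigO_eval_smallVar hM hk P).mul (isBigO_rootVal_inv hM hk))
  simp only [mul_one] at h
  refine h.congr' ?_ (rpow_mul_eventuallyEq _ _)
  filter_upwards [eventually_ne_unifInfty, eventually_rootVal_ne hM hk] with p hp hQ
  have hP' := congrArg (Polynomial.eval (smallVar M k p.1 p.2)) hP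
  simp only [Polynomial.eval_sub, Polynomial.eval_mul, Polynomial.eval_X, Polynomial.eval_C]
    at hP'
  rw [qDeriv_div_q hp]
  have h2 : (rootPoly k (truncOrder M k)).eval (smallVar M k p.1 p.2) = rootVal M k p := rfl
  rw [h2] at hP'
  rw [mul_assoc, ← mul_assoc (smallVar M k p.1 p.2), ← hP']
  field_simp

/-- The truncation order is such that the exponent is smaller than `-1`. -/
theorem isBigO_rootDefect (hM : 0 < M) (hk : k ≠ 0) :
    (fun p : ℂ × ℂ => rootDefect M k p.1 p.2) =O[unifInfty φ ρ]
      (fun p => ‖p.1‖ ^ (M - M * k * (truncOrder M k + 1))) := by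
  obtain ⟨P, hP⟩ := X_pow_dvd_rootPoly_pow_sub hk (truncOrder M k)
  have h := ((isBigO_cpow (φ := φ) (ρ := ρ) M).mul
    ((isBigO_smallVar (M := M) (k := k)).pow (truncOrder M k + 1))).mul
    ((isBigO_eval_smallVar hM hk P).mul ((isBigO_rootVal_inv hM hk).pow (k - 1)))
  simp only [mul_one, one_pow] at h
  refine h.neg_left.congr' ?_ ?_
  · filter_upwards [eventually_ne_unifInfty, eventually_rootVal_ne hM hk] with p hp hQ
    have hP' := congrArg (Polynomial.eval (smallVar M k p.1 p.2)) hP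
    simp only [Polynomial.eval_sub, Polynomial.eval_mul, Polynomial.eval_X, Polynomial.eval_pow,
      Polynomial.eval_add, Polynomial.eval_one] at hP'
    have h2 : (rootPoly k (truncOrder M k)).eval (smallVar M k p.1 p.2) = rootVal M k p := rfl
    rw [h2] at hP'
    have hxM : p.1 ^ (M : ℂ) ≠ 0 := by simp [Complex.cpow_eq_zero_iff, hp]
    obtain ⟨m, rfl⟩ := Nat.exists_eq_succ_of_ne_zero hk
    have hpow : p.1 ^ ((M * (m + 1 : ℕ) : ℝ) : ℂ) = (p.1 ^ (M : ℂ)) ^ (m + 1) := by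
      rw [← Complex.cpow_mul_nat]; push_cast; rfl
    rw [rootDefect, q_eq hp, pot_eq hp, h2, hpow]
    rw [mul_assoc (p.1 ^ (M : ℂ)), ← mul_assoc (_ ^ (truncOrder M _ + 1)), ← hP']
    simp only [Nat.succ_eq_add_one, Nat.add_sub_cancel, inv_pow] at hQ ⊢
    have hQm := pow_ne_zero m hQ
    field_simp
    ring
  · filter_upwards [eventually_ne_unifInfty] with p hp
    have hp' := norm_pos_iff.2 hp
    rw [← Real.rpow_natCast, ← Real.rpow_mul hp'.le, ← Real.rpow_add hp']
    congr 1
    push_cast; ring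

/-- The exponent `κ > 0` for which the remainder is `O(|x| ^ (-1 - κ))`. -/
noncomputable def decayRate (M : ℝ) (k : ℕ) : ℝ :=
  min M (M * k * (truncOrder M k + 1) - M - 1)

theorem decayRate_pos (hM : 0 < M) (hk : k ≠ 0) : 0 < decayRate M k := by
  have := lt_truncOrder_succ hM hk
  exact lt_min hM (by linarith)

variable {𝔸 : Type*} [NormedRing 𝔸] [NormedAlgebra ℂ 𝔸] (d : GaugeData 𝔸 k)

theorem isBigO_Rt (hM : 0 < M) (hk : k ≠ 0) :
    (fun p : ℂ × ℂ => d.Rt M p.1 p.2) =O[unifInfty φ ρ]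
      (fun p => ‖p.1‖ ^ (-1 - decayRate M k)) := by
  have hκ1 : decayRate M k ≤ M := min_le_left _ _
  have hκ2 : decayRate M k ≤ M * k * (truncOrder M k + 1) - M - 1 := min_le_right _ _
  have hκ0 := decayRate_pos hM hk
  have hMk : M ≤ M * k := le_mul_of_one_le_right hM.le
    (by exact_mod_cast Nat.one_le_iff_ne_zero.2 hk)
  have hc : ∀ y : 𝔸, (fun _ : ℂ × ℂ => y) =O[unifInfty φ ρ] (fun _ => (1 : ℝ)) :=
    fun y => isBigO_const_const y one_ne_zero _
  have h1 := (isBigO_gaugeScalarDeriv (φ := φ) (ρ := ρ) hM hk).trans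
    (isBigO_rpow_rpow (b := -1 - decayRate M k) (by linarith))
  have h2 := (isBigO_gaugeScalar (φ := φ) (ρ := ρ) hM hk).trans
    (isBigO_rpow_rpow (b := -1 - decayRate M k) (by linarith))
  have h3 := (isBigO_rootDefect (φ := φ) (ρ := ρ) hM hk).trans
    (isBigO_rpow_rpow (b := -1 - decayRate M k) (by linarith))
  have h4 := (isBigO_qDeriv_div_q_sub (φ := φ) (ρ := ρ) hM hk).trans
    (isBigO_rpow_rpow (b := -1 - decayRate M k) (by linarith))
  have h5 : (fun p : ℂ × ℂ => rootDefect M k p.1 p.2) =O[unifInfty φ ρ] (fun _ => (1 : ℝ)) := by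
    refine h3.trans ?_
    simpa using isBigO_rpow_rpow (φ := φ) (ρ := ρ) (a := -1 - decayRate M k) (b := 0)
      (by linarith)
  have hs : ∀ {f : ℂ × ℂ → ℂ} {g : ℂ × ℂ → ℝ} (_ : f =O[unifInfty φ ρ] g) (y : 𝔸),
      (fun p => f p • y) =O[unifInfty φ ρ] g := fun hf y => by simpa using hf.smul (hc y)
  have h6 := ((hs isBigO_inv_one d.ell).sub
    (hs (isBigO_qDeriv_div_q hM hk) d.h)).add (hs h5 d.e₀)
  have h8 := h6.mul (hs h2 (d.F M))
  simp only [one_mul] at h8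
  exact (((hs h1 (d.F M)).add h8).add (hs h3 d.e₀)).sub (hs h4 d.h)

theorem tendsto_G (hM : 0 < M) (hk : k ≠ 0) :
    Tendsto (fun p : ℂ × ℂ => d.G M p.1 p.2) (unifInfty φ ρ) (𝓝 1) := by
  have h1 : Tendsto (fun p : ℂ × ℂ => gaugeScalar M k p.1 p.2) (unifInfty φ ρ) (𝓝 0) :=
    (isBigO_gaugeScalar hM hk).trans_tendsto (tendsto_rpow_unifInfty (by linarith))
  have := (h1.smul_const (d.F M)).const_add (1 : 𝔸)
  simpa [GaugeData.G] using this

variable [CompleteSpace 𝔸]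

theorem isBigO_R (hM : 0 < M) (hk : k ≠ 0) :
    (fun p : ℂ × ℂ => d.R M p.1 p.2) =O[unifInfty φ ρ]
      (fun p => ‖p.1‖ ^ (-1 - decayRate M k)) := by
  have h1 : ContinuousAt Ring.inverse (1 : 𝔸) := by
    simpa using NormedRing.inverse_continuousAt (1 : 𝔸ˣ)
  have h2 := ((h1.tendsto.comp (tendsto_G (φ := φ) (ρ := ρ) d hM hk)).isBigO_one ℝ).mul
    (isBigO_Rt d hM hk)
  simpa [GaugeData.R] using h2

theorem eventually_isUnit_G (hM : 0 < M) (hk : k ≠ 0) :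
    ∀ᶠ p : ℂ × ℂ in unifInfty φ ρ, IsUnit (d.G M p.1 p.2) :=
  (tendsto_G d hM hk).eventually (Units.isOpen.mem_nhds isUnit_one)

omit [CompleteSpace 𝔸] in
theorem cos_mul_norm_cpow_le_re {x : ℂ} (hM : 0 < M) (hx : x ≠ 0) (ha : |x.arg| < halfAngle M) :
    Real.cos (M * halfAngle M) * ‖x ^ (M : ℂ)‖ ≤ (x ^ (M : ℂ)).re := by
  rw [Complex.norm_cpow_real, Complex.cpow_def_of_ne_zero hx, Complex.exp_re]
  have h1 : (Complex.log x * M).re = Real.log ‖x‖ * M := by simp [Complex.log_re]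
  have h2 : (Complex.log x * M).im = x.arg * M := by simp [Complex.log_im]
  rw [h1, h2, ← Real.rpow_def_of_pos (norm_pos_iff.2 hx), mul_comm]
  gcongr
  rw [← Real.cos_abs (x.arg * M), abs_mul, abs_of_pos hM, mul_comm]
  have hpos := halfAngle_pos hM
  refine Real.cos_le_cos_of_nonneg_of_le_pi (by positivity) ?_ ?_
  · nlinarith [succ_mul_halfAngle hM, Real.pi_pos]
  · rw [mul_comm]
    rw [mul_comm (halfAngle M)]
    exact mul_le_mul_of_nonneg_left ha.le hM.le

omit [CompleteSpace 𝔸] in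
theorem eventually_q_re_pos (hM : 0 < M) (hk : k ≠ 0) :
    ∀ᶠ p in unifInfty (halfAngle M) ρ, 0 < (q M k p.1 p.2).re := by
  have hpos := halfAngle_pos hM
  have hcos : 0 < Real.cos (M * halfAngle M) := by
    apply Real.cos_pos_of_mem_Ioo
    constructor
    · nlinarith [Real.pi_pos]
    · nlinarith [succ_mul_halfAngle hM]
  have h1 := (tendsto_rootVal (φ := halfAngle M) (ρ := ρ) hM hk).eventually
    (Metric.ball_mem_nhds 1 hcos)
  filter_upwards [h1, eventually_ne_unifInfty, eventually_arg_unifInfty] with p hp hp0 ha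
  rw [dist_eq_norm] at hp
  have hre := cos_mul_norm_cpow_le_re hM hp0 ha
  have hxM : 0 < ‖p.1 ^ (M : ℂ)‖ := by
    rw [Complex.norm_cpow_real]; exact Real.rpow_pos_of_pos (norm_pos_iff.2 hp0) _
  have h2 : q M k p.1 p.2 = p.1 ^ (M : ℂ) + p.1 ^ (M : ℂ) * (rootVal M k p - 1) := by
    rw [q_eq hp0, rootVal]; ring
  have h3 : |(p.1 ^ (M : ℂ) * (rootVal M k p - 1)).re| ≤ ‖p.1 ^ (M : ℂ)‖ * ‖rootVal M k p - 1‖ := by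
    rw [← norm_mul]; exact Complex.abs_re_le_norm _
  rw [h2, Complex.add_re]
  have h4 := (abs_le.1 h3).1
  nlinarith

/-- The estimates at infinity, on one truncated sector for all `E` in a disc. -/
theorem exists_region (hM : 0 < M) (hk : k ≠ 0) (ρ : ℝ) {ε : ℝ} (hε : 0 < ε) :
    ∃ N : ℝ, 1 ≤ N ∧ ∃ C : ℝ, 0 < C ∧ ∀ x E : ℂ, N < ‖x‖ → |x.arg| < halfAngle M → ‖E‖ < ρ →
      ‖rootVal M k (x, E) - 1‖ ≤ ε ∧ 0 < (q M k x E).re ∧ IsUnit (d.G M x E) ∧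
        ‖d.R M x E‖ ≤ C * ‖x‖ ^ (-1 - decayRate M k) := by
  obtain ⟨C, hC0, hC⟩ := (isBigO_R (φ := halfAngle M) (ρ := ρ) d hM hk).exists_pos
  have h1 := (tendsto_rootVal (φ := halfAngle M) (ρ := ρ) hM hk).eventually
    (Metric.closedBall_mem_nhds 1 hε)
  obtain ⟨N, hN⟩ := exists_of_eventually_unifInfty
    (h1.and ((eventually_q_re_pos hM hk).and ((eventually_isUnit_G d hM hk).and hC.bound)))
  refine ⟨max N 1, le_max_right _ _, C, hC0, fun x E hx ha hE => ?_⟩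
  obtain ⟨h1, h2, h3, h4⟩ := hN x E ((le_max_left _ _).trans_lt hx) ha hE
  refine ⟨by simpa [dist_eq_norm] using h1, h2, h3, ?_⟩
  rwa [Real.norm_of_nonneg (by positivity)] at h4

end ODEIM

end

/-! ### The flow of translations in `x ^ (M + 1)` -/

section

open MeasureTheory Set

namespace ODEIM

theorem log_cpow_real {x : ℂ} (hx : x ≠ 0) {a : ℝ} (h : |a * x.arg| < Real.pi) :
    Complex.log (x ^ (a : ℂ)) = a * Complex.log x := by
  have him : (Complex.log x * a).im = a * x.arg := by simp [Complex.log_im, mul_comm]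
  rw [Complex.cpow_def_of_ne_zero hx, Complex.log_exp, mul_comm]
  · rw [him]; exact (abs_lt.1 h).1
  · rw [him]; exact (abs_lt.1 h).2.le

theorem arg_cpow_real {x : ℂ} (hx : x ≠ 0) {a : ℝ} (h : |a * x.arg| < Real.pi) :
    (x ^ (a : ℂ)).arg = a * x.arg := by
  rw [← Complex.log_im, log_cpow_real hx h]
  simp [Complex.log_im]

theorem cpow_cpow_real {x : ℂ} (hx : x ≠ 0) {a : ℝ} (h : |a * x.arg| < Real.pi) (b : ℝ) :
    (x ^ (a : ℂ)) ^ (b : ℂ) = x ^ ((a * b : ℝ) : ℂ) := by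
  have h0 : x ^ (a : ℂ) ≠ 0 := by simp [Complex.cpow_eq_zero_iff, hx]
  rw [Complex.cpow_def_of_ne_zero h0, log_cpow_real hx h, Complex.cpow_def_of_ne_zero hx]
  congr 1
  push_cast; ring

/-- The part `|x| > N` of the sector `|arg x| < π / (2 (M + 1))`. -/
def truncSector (M N : ℝ) : Set ℂ := {x | N < ‖x‖ ∧ |x.arg| < halfAngle M}

/-- The flow `x ↦ (x ^ (M + 1) + s) ^ (1 / (M + 1))`, a translation in the coordinate
`x ^ (M + 1)`. -/
noncomputable def powFlow (M : ℝ) (s : ℝ) (x : ℂ) : ℂ :=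
  (x ^ ((M + 1 : ℝ) : ℂ) + s) ^ (((M + 1)⁻¹ : ℝ) : ℂ)

/-- The velocity of `powFlow`. -/
noncomputable def powSpeed (M : ℝ) (x : ℂ) : ℂ := (((M + 1 : ℝ) : ℂ) * x ^ (M : ℂ))⁻¹

section Flow

variable {M N : ℝ} (hM : 0 < M) (hN : 0 ≤ N) {x : ℂ} (hx : x ∈ truncSector M N)
include hM hN hx

omit hM in
theorem truncSector.ne_zero : x ≠ 0 := norm_pos_iff.1 (hN.trans_lt hx.1)

theorem truncSector.mem_slitPlane : x ∈ Complex.slitPlane :=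
  mem_slitPlane_of_abs_arg_lt (by linarith [halfAngle_lt hM, Real.pi_pos])
    (truncSector.ne_zero hN hx) hx.2

omit hN in
theorem truncSector.abs_arg : |(M + 1) * x.arg| < Real.pi / 2 := by
  rw [abs_mul, abs_of_pos (by linarith), ← succ_mul_halfAngle hM]
  exact mul_lt_mul_of_pos_left hx.2 (by linarith)

theorem truncSector.re_pos : 0 < (x ^ ((M + 1 : ℝ) : ℂ)).re := by
  have h0 := truncSector.ne_zero hN hx
  have h1 := truncSector.abs_arg hM hx
  have h2 := arg_cpow_real h0 (h1.trans (by linarith [Real.pi_pos]))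
  rw [← h2, Complex.abs_arg_lt_pi_div_two_iff] at h1
  rcases h1 with h1 | h1
  · exact h1
  · simp [Complex.cpow_eq_zero_iff, h0] at h1

theorem truncSector.re_add_pos {s : ℝ} (hs : 0 ≤ s) :
    0 < (x ^ ((M + 1 : ℝ) : ℂ) + s).re := by
  have := truncSector.re_pos hM hN hx
  rw [Complex.add_re, Complex.ofReal_re]; linarith

theorem powFlow_pow {s : ℝ} (hs : 0 ≤ s) :
    powFlow M s x ^ ((M + 1 : ℝ) : ℂ) = x ^ ((M + 1 : ℝ) : ℂ) + s := by
  have h := truncSector.re_add_pos hM hN hx hs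
  have h0 : x ^ ((M + 1 : ℝ) : ℂ) + s ≠ 0 := fun h' => by rw [h'] at h; simp at h
  have h1 : |(x ^ ((M + 1 : ℝ) : ℂ) + s).arg| < Real.pi / 2 :=
    Complex.abs_arg_lt_pi_div_two_iff.2 (Or.inl h)
  rw [powFlow, cpow_cpow_real h0, inv_mul_cancel₀ (by linarith)]
  · simp
  · rw [abs_mul, abs_of_pos (by positivity)]
    have : (M + 1)⁻¹ ≤ 1 := inv_le_one_of_one_le₀ (by linarith)
    nlinarith [abs_nonneg (x ^ ((M + 1 : ℝ) : ℂ) + s).arg, Real.pi_pos]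

theorem norm_powFlow_rpow {s : ℝ} (hs : 0 ≤ s) :
    ‖powFlow M s x‖ ^ (M + 1) = ‖x ^ ((M + 1 : ℝ) : ℂ) + s‖ := by
  rw [← powFlow_pow hM hN hx hs, Complex.norm_cpow_real]

theorem le_norm_add {s : ℝ} (hs : 0 ≤ s) :
    ‖x‖ ^ (M + 1) ≤ ‖x ^ ((M + 1 : ℝ) : ℂ) + s‖ ∧ s ≤ ‖x ^ ((M + 1 : ℝ) : ℂ) + s‖ := by
  have hre := truncSector.re_pos hM hN hx
  constructor
  · rw [← Complex.norm_cpow_real]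
    rw [← abs_of_nonneg (norm_nonneg (x ^ ((M + 1 : ℝ) : ℂ))),
      ← abs_of_nonneg (norm_nonneg (x ^ ((M + 1 : ℝ) : ℂ) + s)), ← sq_le_sq,
      Complex.sq_norm, Complex.sq_norm, Complex.normSq_apply, Complex.normSq_apply]
    simp only [Complex.add_re, Complex.add_im, Complex.ofReal_re, Complex.ofReal_im]
    nlinarith
  · refine le_trans ?_ (Complex.re_le_norm _)
    rw [Complex.add_re, Complex.ofReal_re]; linarith

theorem half_le_norm_powFlow {s : ℝ} (hs : 0 ≤ s) :
    (‖x‖ ^ (M + 1) + s) / 2 ≤ ‖powFlow M s x‖ ^ (M + 1) := by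
  rw [norm_powFlow_rpow hM hN hx hs]
  linarith [(le_norm_add hM hN hx hs).1, (le_norm_add hM hN hx hs).2]

theorem powFlow_mem {s : ℝ} (hs : 0 ≤ s) : powFlow M s x ∈ truncSector M N := by
  have h := truncSector.re_add_pos hM hN hx hs
  have h0 : x ^ ((M + 1 : ℝ) : ℂ) + s ≠ 0 := fun h' => by rw [h'] at h; simp at h
  have h1 : |(x ^ ((M + 1 : ℝ) : ℂ) + s).arg| < Real.pi / 2 :=
    Complex.abs_arg_lt_pi_div_two_iff.2 (Or.inl h)
  have hpos : 0 < M + 1 := by linarith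
  have h2 : |(M + 1)⁻¹ * (x ^ ((M + 1 : ℝ) : ℂ) + s).arg| < halfAngle M := by
    rw [abs_mul, abs_of_pos (by positivity), inv_mul_lt_iff₀ hpos, succ_mul_halfAngle hM]
    exact h1
  constructor
  · refine hx.1.trans_le ?_
    have := (le_norm_add hM hN hx hs).1
    rw [← norm_powFlow_rpow hM hN hx hs] at this
    exact (Real.rpow_le_rpow_iff (norm_nonneg _) (norm_nonneg _) hpos).1 this
  · rw [powFlow, arg_cpow_real h0 (h2.trans (by linarith [halfAngle_lt hM, Real.pi_pos]))]
    exact h2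

theorem hasDerivAt_powFlow {s : ℝ} (hs : 0 ≤ s) :
    HasDerivAt (fun s => powFlow M s x) (powSpeed M (powFlow M s x)) s := by
  have hmem := powFlow_mem hM hN hx hs
  have h := truncSector.re_add_pos hM hN hx hs
  have hpow := powFlow_pow hM hN hx hs
  have hy0 := truncSector.ne_zero hN hmem
  have h1 : HasDerivAt (fun s : ℝ => x ^ ((M + 1 : ℝ) : ℂ) + (s : ℂ)) 1 s :=
    Complex.ofRealCLM.hasDerivAt.const_add _
  have h2 : HasDerivAt (fun w : ℂ => w ^ (((M + 1)⁻¹ : ℝ) : ℂ)) _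
      (x ^ ((M + 1 : ℝ) : ℂ) + (s : ℂ)) :=
    (hasDerivAt_id _).cpow_const (c := (((M + 1)⁻¹ : ℝ) : ℂ)) (Or.inl h)
  have h3 := h2.scomp s h1
  convert! h3 using 1
  have hw0 : x ^ ((M + 1 : ℝ) : ℂ) + (s : ℂ) ≠ 0 := fun h' => by rw [h'] at h; simp at h
  simp only [id, mul_one, one_smul]
  rw [Complex.cpow_sub _ _ hw0, Complex.cpow_one]
  change _ = _ * (powFlow M s x / _)
  rw [← hpow, Complex.ofReal_add, Complex.cpow_add _ _ hy0, Complex.ofReal_one, Complex.cpow_one,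
    powSpeed]
  have h5 : powFlow M s x ^ (M : ℂ) ≠ 0 := by simp [Complex.cpow_eq_zero_iff, hy0]
  have h6 : (M : ℂ) + 1 ≠ 0 := by
    have : ((M + 1 : ℝ) : ℂ) ≠ 0 := by exact_mod_cast (by linarith : M + 1 ≠ 0)
    simpa using this
  push_cast
  field_simp

theorem norm_powSpeed_le : ‖powSpeed M x‖ ≤ ‖x‖ ^ (-M) := by
  have hx0 := norm_pos_iff.2 (truncSector.ne_zero hN hx)
  rw [powSpeed, norm_inv, norm_mul, Complex.norm_real, Complex.norm_cpow_real,
    Real.norm_of_nonneg (by linarith), Real.rpow_neg hx0.le]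
  refine inv_anti₀ (Real.rpow_pos_of_pos hx0 _) ?_
  exact le_mul_of_one_le_left (Real.rpow_nonneg hx0.le _) (by linarith)

theorem powSpeed_ne_zero : powSpeed M x ≠ 0 := by
  have h6 : ((M + 1 : ℝ) : ℂ) ≠ 0 := by exact_mod_cast (by linarith : M + 1 ≠ 0)
  rw [powSpeed]
  refine inv_ne_zero (mul_ne_zero h6 ?_)
  simp [Complex.cpow_eq_zero_iff, truncSector.ne_zero hN hx]

omit hM in
/-- The action grows along the flow at a rate close to `1 / (M + 1)`. -/
theorem q_mul_powSpeed (k : ℕ) (E : ℂ) :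
    powSpeed M x * q M k x E = (((M + 1)⁻¹ : ℝ) : ℂ) * rootVal M k (x, E) := by
  have hx0 := truncSector.ne_zero hN hx
  have h5 : x ^ (M : ℂ) ≠ 0 := by simp [Complex.cpow_eq_zero_iff, hx0]
  rw [powSpeed, q_eq hx0, rootVal, mul_inv, Complex.ofReal_inv]
  field_simp

end Flow

theorem isOpen_truncSector {M N : ℝ} (hM : 0 < M) (hN : 0 ≤ N) : IsOpen (truncSector M N) := by
  rw [isOpen_iff_mem_nhds]
  intro x hx
  have h1 := (Complex.continuousAt_arg (truncSector.mem_slitPlane hM hN hx)).abs.eventually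
    (gt_mem_nhds hx.2)
  have h2 := (continuous_norm.continuousAt (x := x)).eventually (lt_mem_nhds hx.1)
  filter_upwards [h1, h2] with y h1 h2 using ⟨h2, h1⟩

theorem holomorphicFlow_powFlow {M N : ℝ} (hM : 0 < M) (hN : 0 ≤ N) :
    HolomorphicFlow (powFlow M) (truncSector M N) where
  isOpen := isOpen_truncSector hM hN
  maps _ hs _ hz := powFlow_mem hM hN hz hs
  zero z hz := by
    have h := (truncSector.abs_arg hM hz).trans (by linarith [Real.pi_pos] : _ < Real.pi)
    rw [powFlow, Complex.ofReal_zero, add_zero, cpow_cpow_real (truncSector.ne_zero hN hz) h,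
      mul_inv_cancel₀ (by linarith)]
    simp
  add a s ha hs z hz := by
    rw [powFlow, powFlow, powFlow_pow hM hN hz ha]
    push_cast
    rw [add_assoc]
  diff s hs := by
    intro z hz
    refine DifferentiableAt.differentiableWithinAt ?_
    refine DifferentiableAt.cpow_const ?_ (Or.inl (truncSector.re_add_pos hM hN hz hs))
    exact (differentiableAt_id.cpow_const (truncSector.mem_slitPlane hM hN hz)).add_const _

/-- The comparison function `K (N₀ + s) ^ (-1 - β)` and its integral over `(s, ∞)`. -/
theorem powBound_facts {K β N₀ : ℝ} (hK : 0 ≤ K) (hβ : 0 < β) (hN₀ : 0 < N₀) :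
    (∀ s : ℝ, 0 ≤ s → 0 ≤ K * (N₀ + s) ^ (-1 - β)) ∧
    (∀ s : ℝ, 0 ≤ s → HasDerivAt (fun s : ℝ => K / β * (N₀ + s) ^ (-β))
      (-(K * (N₀ + s) ^ (-1 - β))) s) ∧
    Tendsto (fun s : ℝ => K / β * (N₀ + s) ^ (-β)) atTop (𝓝 0) := by
  refine ⟨?_, ?_, ?_⟩
  · intro s hs
    have : 0 ≤ N₀ + s := by linarith
    positivity
  · intro s hs
    have h1 : HasDerivAt (fun s : ℝ => N₀ + s) 1 s := (hasDerivAt_id s).const_add _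
    have h2 := (h1.rpow_const (p := -β) (Or.inl (by linarith))).const_mul (K / β)
    convert! h2 using 1
    rw [show -β - 1 = -1 - β by ring]
    field_simp
  · have h1 : Tendsto (fun s : ℝ => N₀ + s) atTop atTop :=
      tendsto_atTop_add_const_left _ _ tendsto_id
    have := ((tendsto_rpow_neg_atTop hβ).comp h1).const_mul (K / β)
    simpa [Function.comp_def] using this

end ODEIM

end

/-! ### Solutions in a truncated sector -/

section

open MeasureTheory Set

namespace ODEIM

theorem differentiableAt_fun_div {U : Type*} [NormedAddCommGroup U] [NormedSpace ℂ U]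
    {f g : U → ℂ} {p : U} (hf : DifferentiableAt ℂ f p) (hg : DifferentiableAt ℂ g p)
    (h0 : g p ≠ 0) : DifferentiableAt ℂ (fun p => f p / g p) p := by
  simp only [div_eq_mul_inv]
  exact hf.fun_mul (hg.fun_inv h0)

section GaugeDifferentiable

variable {𝔸 : Type*} [NormedRing 𝔸] [NormedAlgebra ℂ 𝔸] [CompleteSpace 𝔸] {k : ℕ}
  (d : GaugeData 𝔸 k) {M : ℝ} {lam : ℂ} {p : ℂ × ℂ}

theorem differentiable_exp_smul (y : 𝔸) : Differentiable ℂ fun z : ℂ => NormedSpace.exp (z • y) :=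
  fun z => (hasDerivAt_exp_smul_const y z).differentiableAt

omit [CompleteSpace 𝔸] in
theorem differentiableAt_G (hp : p.1 ∈ Complex.slitPlane) (hq : q M k p.1 p.2 ≠ 0) :
    DifferentiableAt ℂ (fun p : ℂ × ℂ => d.G M p.1 p.2) p := by
  refine DifferentiableAt.const_add _ (DifferentiableAt.smul_const ?_ _)
  exact ((differentiableAt_fst.mul (differentiableAt_q hp)).inv
    (mul_ne_zero (Complex.slitPlane_ne_zero hp) hq)).neg

theorem differentiableAt_R (hp : p.1 ∈ Complex.slitPlane) (hq : q M k p.1 p.2 ≠ 0)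
    (hG : IsUnit (d.G M p.1 p.2)) : DifferentiableAt ℂ (fun p : ℂ × ℂ => d.R M p.1 p.2) p := by
  have hp0 := Complex.slitPlane_ne_zero hp
  have hxq : DifferentiableAt ℂ (fun p : ℂ × ℂ => p.1 * q M k p.1 p.2) p :=
    differentiableAt_fst.fun_mul (differentiableAt_q hp)
  have hxq0 : p.1 * q M k p.1 p.2 ≠ 0 := mul_ne_zero hp0 hq
  have hn : DifferentiableAt ℂ (fun p : ℂ × ℂ => gaugeScalar M k p.1 p.2) p := (hxq.inv hxq0).neg
  have hxq2 : DifferentiableAt ℂ (fun p : ℂ × ℂ => (p.1 * q M k p.1 p.2) ^ 2) p := hxq.fun_pow 2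
  have hqd : DifferentiableAt ℂ (fun p : ℂ × ℂ => q M k p.1 p.2 + p.1 * qDeriv M k p.1 p.2) p :=
    (differentiableAt_q hp).fun_add (differentiableAt_fst.fun_mul (differentiableAt_qDeriv hp))
  have hn' : DifferentiableAt ℂ (fun p : ℂ × ℂ => gaugeScalarDeriv M k p.1 p.2) p :=
    differentiableAt_fun_div hqd hxq2 (pow_ne_zero _ hxq0)
  have hqk : DifferentiableAt ℂ (fun p : ℂ × ℂ => q M k p.1 p.2 ^ (k - 1)) p :=
    (differentiableAt_q hp).fun_pow _
  have hr : DifferentiableAt ℂ (fun p : ℂ × ℂ => rootDefect M k p.1 p.2) p :=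
    (differentiableAt_fun_div (differentiableAt_pot hp) hqk (pow_ne_zero _ hq)).sub
      (differentiableAt_q hp)
  have hl : DifferentiableAt ℂ (fun p : ℂ × ℂ => qDeriv M k p.1 p.2 / q M k p.1 p.2) p :=
    differentiableAt_fun_div (differentiableAt_qDeriv hp) (differentiableAt_q hp) hq
  have hi : DifferentiableAt ℂ (fun p : ℂ × ℂ => p.1⁻¹) p := differentiableAt_fst.inv hp0
  refine DifferentiableAt.mul ?_ ?_
  · have h1 := differentiableAt_inverse (𝕜 := ℂ) hG
    exact h1.comp p (differentiableAt_G d hp hq)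
  · exact (((hn'.smul_const _).add ((((hi.smul_const _).sub (hl.smul_const _)).add
      (hr.smul_const _)).mul (hn.smul_const _))).add (hr.smul_const _)).sub
      ((hl.sub (hi.const_mul _)).smul_const _)

theorem differentiableAt_T (hM : 0 < M) (hk : k ≠ 0) (hp : p.1 ∈ Complex.slitPlane)
    (hq : q M k p.1 p.2 ∈ Complex.slitPlane) :
    DifferentiableAt ℂ (fun p : ℂ × ℂ => d.T M lam p.1 p.2) p := by
  have hq0 := Complex.slitPlane_ne_zero hq
  refine DifferentiableAt.fun_smul ?_ (DifferentiableAt.mul ?_ (differentiableAt_G d hp hq0))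
  · exact ((differentiableAt_action hp hM hk).const_mul _).cexp
  · exact ((differentiable_exp_smul d.h) _).comp p ((differentiableAt_q hp).clog hq).neg

omit [CompleteSpace 𝔸] in
theorem differentiableAt_conn (hp : p.1 ∈ Complex.slitPlane) :
    DifferentiableAt ℂ (fun p : ℂ × ℂ => d.conn M p.1 p.2) p :=
  (((differentiableAt_fst.inv (Complex.slitPlane_ne_zero hp)).smul_const _).add_const _).add
    ((differentiableAt_pot hp).smul_const _)

theorem isUnit_P (x E : ℂ) : IsUnit (d.P M x E) := by
  refine ⟨⟨d.P M x E, NormedSpace.exp (Complex.log (q M k x E) • d.h), ?_, ?_⟩, rfl⟩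
  · exact exp_neg_smul_mul_exp_smul _ _
  · exact exp_smul_mul_exp_neg_smul _ _

theorem isUnit_T {x E : ℂ} (hG : IsUnit (d.G M x E)) : IsUnit (d.T M lam x E) := by
  have := (isUnit_P d (M := M) x E).mul hG
  have h2 := this.smul (Units.mk0 _ (Complex.exp_ne_zero (-lam * action M k x E)))
  exact h2

variable (M lam)

/-- The operator `Λ - lam`. -/
def GaugeData.B : 𝔸 := d.e₀ + d.e - lam • 1

/-- The outer factor `exp (-S (Λ - lam))` of the Volterra kernel. -/
noncomputable def GaugeData.flowA (E x : ℂ) : 𝔸 := NormedSpace.exp (-action M k x E • d.B lam)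

/-- The inner factor `exp (S (Λ - lam)) R` of the Volterra kernel, in the time of the flow
`powFlow`. -/
noncomputable def GaugeData.flowL (E x : ℂ) : 𝔸 :=
  NormedSpace.exp (action M k x E • d.B lam) * (powSpeed M x • d.R M x E)

end GaugeDifferentiable

/-- The estimates that hold on a truncated sector for all `|E| < ρ`: `q` has positive real part and
`q / x ^ M` is within `ε` of `1`, the gauge transformation `1 + n F` is invertible, and the
remainder is `O(|x| ^ (-1 - κ))`. They come with the bound on `exp (z (Λ - lam))` in the cone of
opening `ε`. -/
structure RegionBound {𝔸 : Type*} [NormedRing 𝔸] [NormedAlgebra ℂ 𝔸] {k : ℕ} (d : GaugeData 𝔸 k)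
    (M : ℝ) (lam : ℂ) (ρ ε Cc C N : ℝ) : Prop where
  hM : 0 < M
  hk : k ≠ 0
  one_le : 1 ≤ N
  C_pos : 0 < C
  cone : ∀ τ : ℝ, 0 ≤ τ → ∀ z : ℂ, ‖z - τ‖ ≤ ε * τ → ‖NormedSpace.exp (z • d.B lam)‖ ≤ Cc
  near : ∀ x ∈ truncSector M N, ∀ E : ℂ, ‖E‖ < ρ → ‖rootVal M k (x, E) - 1‖ ≤ ε
  re_pos : ∀ x ∈ truncSector M N, ∀ E : ℂ, ‖E‖ < ρ → 0 < (q M k x E).re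
  unit : ∀ x ∈ truncSector M N, ∀ E : ℂ, ‖E‖ < ρ → IsUnit (d.G M x E)
  bound : ∀ x ∈ truncSector M N, ∀ E : ℂ, ‖E‖ < ρ →
    ‖d.R M x E‖ ≤ C * ‖x‖ ^ (-1 - decayRate M k)

namespace RegionBound

variable {W : Type*} [NormedAddCommGroup W] [NormedSpace ℂ W] [CompleteSpace W] {k : ℕ}
  {d : GaugeData (W →L[ℂ] W) k} {M : ℝ} {lam : ℂ} {ρ ε Cc C N : ℝ}
  (h : RegionBound d M lam ρ ε Cc C N) {x E : ℂ} (hx : x ∈ truncSector M N) (hE : ‖E‖ < ρ)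
include h

omit [CompleteSpace W] in
theorem N_nonneg : 0 ≤ N := zero_le_one.trans h.one_le

omit [CompleteSpace W] in
theorem Cc_nonneg : 0 ≤ Cc := (norm_nonneg _).trans (h.cone 0 le_rfl 0 (by simp))

omit [CompleteSpace W] in
include hE in
theorem q_mem_slitPlane {x : ℂ} (hx : x ∈ truncSector M N) : q M k x E ∈ Complex.slitPlane :=
  Or.inl (h.re_pos x hx E hE)

omit [CompleteSpace W] in
include hx hE in
/-- Along the flow the action advances inside the cone of opening `ε`. -/
theorem norm_action_sub_le {s t : ℝ} (hs : 0 ≤ s) (hst : s ≤ t) :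
    ‖action M k (powFlow M t x) E - action M k (powFlow M s x) E
      - (((t - s) * (M + 1)⁻¹ : ℝ) : ℂ)‖ ≤ ε * ((t - s) * (M + 1)⁻¹) := by
  have hd : ∀ τ ∈ Icc s t, HasDerivAt (fun τ : ℝ => action M k (powFlow M τ x) E -
      (((M + 1)⁻¹ : ℝ) : ℂ) * (τ : ℂ))
      ((((M + 1)⁻¹ : ℝ) : ℂ) * (rootVal M k (powFlow M τ x, E) - 1)) τ := by
    intro τ hτ
    have hτ0 := hs.trans hτ.1
    have hm := powFlow_mem h.hM h.N_nonneg hx hτ0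
    have h1 := (hasDerivAt_action h.hM h.hk (truncSector.mem_slitPlane h.hM h.N_nonneg hm) E).scomp
      τ (hasDerivAt_powFlow h.hM h.N_nonneg hx hτ0)
    have h2 : HasDerivAt (fun τ : ℝ => (((M + 1)⁻¹ : ℝ) : ℂ) * (τ : ℂ))
        ((((M + 1)⁻¹ : ℝ) : ℂ) * 1) τ := Complex.ofRealCLM.hasDerivAt.const_mul _
    have h3 := h1.sub h2
    convert! h3 using 1
    rw [smul_eq_mul, q_mul_powSpeed h.N_nonneg hm]
    ring
  have h1 := norm_image_sub_le_of_norm_deriv_le_segment'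
    (fun τ hτ => (hd τ hτ).hasDerivWithinAt) (C := (M + 1)⁻¹ * ε) (fun τ hτ => ?_) t
    (right_mem_Icc.2 hst)
  · have h2 : action M k (powFlow M t x) E - action M k (powFlow M s x) E
        - (((t - s) * (M + 1)⁻¹ : ℝ) : ℂ) = (action M k (powFlow M t x) E -
      (((M + 1)⁻¹ : ℝ) : ℂ) * (t : ℂ)) - (action M k (powFlow M s x) E -
      (((M + 1)⁻¹ : ℝ) : ℂ) * (s : ℂ)) := by push_cast; ring
    rw [h2]
    exact h1.trans_eq (by ring)
  · have hM := h.hM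
    have hpos : 0 ≤ (M + 1)⁻¹ := by positivity
    rw [norm_mul, Complex.norm_real, Real.norm_of_nonneg hpos]
    exact mul_le_mul_of_nonneg_left
      (h.near _ (powFlow_mem hM h.N_nonneg hx (hs.trans hτ.1)) E hE) hpos

include hx hE in
theorem norm_exp_action_sub_le {s t : ℝ} (hs : 0 ≤ s) (hst : s ≤ t) :
    ‖d.flowA M lam E (powFlow M s x) *
      NormedSpace.exp (action M k (powFlow M t x) E • d.B lam)‖ ≤ Cc := by
  rw [GaugeData.flowA, exp_smul_mul_exp_smul, neg_add_eq_sub]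
  have hM := h.hM
  exact h.cone ((t - s) * (M + 1)⁻¹)
    (mul_nonneg (by linarith) (inv_nonneg.2 (by linarith))) _ (h.norm_action_sub_le hx hE hs hst)

omit [CompleteSpace W] in
include hx hE in
theorem norm_speed_R_le {N₀ : ℝ} (hN₀ : 0 < N₀) (hN₀x : N₀ ≤ ‖x‖ ^ (M + 1)) {t : ℝ} (ht : 0 ≤ t) :
    ‖powSpeed M (powFlow M t x) • d.R M (powFlow M t x) E‖ ≤
      C * 2 ^ (1 + decayRate M k / (M + 1)) * (N₀ + t) ^ (-1 - decayRate M k / (M + 1)) := by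
  have hM := h.hM
  have hκ := decayRate_pos hM h.hk
  have hm := powFlow_mem hM h.N_nonneg hx ht
  have hy0 : 0 < ‖powFlow M t x‖ := norm_pos_iff.2 (truncSector.ne_zero h.N_nonneg hm)
  have hN0t : 0 < N₀ + t := by linarith
  set y := powFlow M t x
  set β := decayRate M k / (M + 1) with hβ
  have hβ0 : 0 < β := by positivity
  have hC := h.C_pos
  rw [norm_smul]
  calc ‖powSpeed M y‖ * ‖d.R M y E‖ ≤ ‖y‖ ^ (-M) * (C * ‖y‖ ^ (-1 - decayRate M k)) := by
        gcongr
        · exact norm_powSpeed_le hM h.N_nonneg hm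
        · exact h.bound y hm E hE
    _ = C * (‖y‖ ^ (M + 1)) ^ (-(1 + β)) := by
        rw [← Real.rpow_mul hy0.le, mul_left_comm, ← Real.rpow_add hy0]
        congr 2
        rw [hβ]; field_simp; ring
    _ ≤ C * ((N₀ + t) / 2) ^ (-(1 + β)) := by
        refine mul_le_mul_of_nonneg_left ?_ hC.le
        refine Real.rpow_le_rpow_of_nonpos (by positivity) ?_ (by linarith)
        refine le_trans ?_ (half_le_norm_powFlow hM h.N_nonneg hx ht)
        linarith
    _ = _ := by
        rw [Real.div_rpow hN0t.le zero_le_two, Real.rpow_neg zero_le_two, div_inv_eq_mul,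
          show -(1 + β) = -1 - β by ring]
        ring

theorem differentiableAt_flowA (hx : x ∈ truncSector M N) :
    DifferentiableAt ℂ (fun p : ℂ × ℂ => d.flowA M lam p.2 p.1) (x, E) :=
  ((differentiable_exp_smul (d.B lam)) _).comp (x, E) ((differentiableAt_action (p := (x, E))
    (truncSector.mem_slitPlane h.hM h.N_nonneg hx) h.hM h.hk).neg)

theorem differentiableAt_flowL (hx : x ∈ truncSector M N) (hE : ‖E‖ < ρ) :
    DifferentiableAt ℂ (fun p : ℂ × ℂ => d.flowL M lam p.2 p.1) (x, E) := by
  have hs := truncSector.mem_slitPlane h.hM h.N_nonneg hx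
  have h0 := truncSector.ne_zero h.N_nonneg hx
  refine DifferentiableAt.mul ?_ (DifferentiableAt.fun_smul ?_ ?_)
  · exact ((differentiable_exp_smul (d.B lam)) _).comp (x, E)
      (differentiableAt_action (p := (x, E)) hs h.hM h.hk)
  · have hM := h.hM
    refine DifferentiableAt.inv ((differentiableAt_fst_cpow (p := (x, E)) hs _).const_mul _) ?_
    have h6 : ((M + 1 : ℝ) : ℂ) ≠ 0 := by exact_mod_cast (by linarith : M + 1 ≠ 0)
    exact mul_ne_zero h6 (by simp [Complex.cpow_eq_zero_iff, h0])
  · exact differentiableAt_R d (p := (x, E)) hs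
      (Complex.slitPlane_ne_zero (h.q_mem_slitPlane hE hx)) (h.unit x hx E hE)

theorem differentiableOn_flowA_left :
    DifferentiableOn ℂ (d.flowA M lam E) (truncSector M N) := fun x hx =>
  ((h.differentiableAt_flowA (E := E) hx).comp x (f := fun x => (x, E))
    (by fun_prop)).differentiableWithinAt

include hE in
theorem differentiableOn_flowL_left :
    DifferentiableOn ℂ (d.flowL M lam E) (truncSector M N) := fun x hx =>
  ((h.differentiableAt_flowL (E := E) hx hE).comp x (f := fun x => (x, E))
    (by fun_prop)).differentiableWithinAt

/-- The constant in the bound of the Volterra kernel along the flow. -/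
noncomputable def _root_.ODEIM.boundConst (M : ℝ) (k : ℕ) (Cc C : ℝ) : ℝ :=
  Cc * (C * 2 ^ (1 + decayRate M k / (M + 1)))

include hx hE in
/-- The kernel `exp ((S_t - S_s) (Λ - lam)) R` is integrable along the flow: its first factor is
bounded, and `R` is `O(|x| ^ (-1 - κ))` while `|x|` grows like `s ^ (1 / (M + 1))`. -/
theorem volterraBound {N₀ : ℝ} (hN₀ : 0 < N₀) (hN₀x : N₀ ≤ ‖x‖ ^ (M + 1)) :
    VolterraBound (fun s => d.flowA M lam E (powFlow M s x))
      (fun s => d.flowL M lam E (powFlow M s x))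
      (fun s => boundConst M k Cc C * (N₀ + s) ^ (-1 - decayRate M k / (M + 1)))
      (fun s => boundConst M k Cc C / (decayRate M k / (M + 1)) *
        (N₀ + s) ^ (-(decayRate M k / (M + 1)))) := by
  have hM := h.hM
  have hC := h.C_pos
  have hκ := decayRate_pos hM h.hk
  have hK : 0 ≤ boundConst M k Cc C := by
    have := h.Cc_nonneg
    unfold boundConst; positivity
  obtain ⟨f2, f3, f4⟩ := powBound_facts hK
    (by positivity : 0 < decayRate M k / (M + 1)) hN₀
  have hφ : ContinuousOn (fun s => powFlow M s x) (Ici 0) := fun s hs =>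
    (hasDerivAt_powFlow hM h.N_nonneg hx hs).continuousAt.continuousWithinAt
  have hmaps : MapsTo (fun s => powFlow M s x) (Ici 0) (truncSector M N) := fun s hs =>
    powFlow_mem hM h.N_nonneg hx hs
  have hbd : ∀ s t : ℝ, 0 ≤ s → s ≤ t → ‖d.flowA M lam E (powFlow M s x) ∘L
      d.flowL M lam E (powFlow M t x)‖ ≤
        boundConst M k Cc C * (N₀ + t) ^ (-1 - decayRate M k / (M + 1)) := by
    intro s t hs hst
    change ‖d.flowA M lam E (powFlow M s x) * d.flowL M lam E (powFlow M t x)‖ ≤ _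
    rw [GaugeData.flowL, ← mul_assoc, boundConst, mul_assoc Cc]
    refine (norm_mul_le _ _).trans (mul_le_mul (h.norm_exp_action_sub_le hx hE hs hst)
      (h.norm_speed_R_le hx hE hN₀ hN₀x (hs.trans hst)) (norm_nonneg _) h.Cc_nonneg)
  refine ⟨h.differentiableOn_flowA_left.continuousOn.comp hφ hmaps,
    (h.differentiableOn_flowL_left hE).continuousOn.comp hφ hmaps, f2, f3, f4, hbd,
    ‖NormedSpace.exp (action M k (powFlow M 0 x) E • d.B lam)‖, fun t ht => ?_⟩
  have h1 : d.flowL M lam E (powFlow M t x) =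
      NormedSpace.exp (action M k (powFlow M 0 x) E • d.B lam) *
        (d.flowA M lam E (powFlow M 0 x) * d.flowL M lam E (powFlow M t x)) := by
    have h2 : NormedSpace.exp (action M k (powFlow M 0 x) E • d.B lam) *
        d.flowA M lam E (powFlow M 0 x) = 1 := exp_smul_mul_exp_neg_smul _ _
    rw [← mul_assoc, h2, one_mul]
  rw [h1]
  exact (norm_mul_le _ _).trans (mul_le_mul_of_nonneg_left (hbd 0 t le_rfl ht) (norm_nonneg _))

/-- The solution of the transformed equation `Z' = -(q (Λ - lam) + R) Z` which tends to `ψ`. -/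
noncomputable def _root_.ODEIM.gaugedSol (d : GaugeData (W →L[ℂ] W) k) (M : ℝ) (lam : ℂ) (ψ : W)
    (x E : ℂ) : W :=
  HolomorphicFlow.sol (powFlow M) (d.flowA M lam E) (d.flowL M lam E) ψ x

include hE in
theorem localBound : ∀ z ∈ truncSector M N, ∃ U ∈ 𝓝 z, ∃ g G, ∀ z' ∈ U ∩ truncSector M N,
    VolterraBound (fun s => d.flowA M lam E (powFlow M s z'))
      (fun s => d.flowL M lam E (powFlow M s z')) g G := by
  intro z hz
  refine ⟨univ, univ_mem, _, _, fun z' hz' => h.volterraBound hz'.2 hE one_pos ?_⟩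
  have hM := h.hM
  exact Real.one_le_rpow (h.one_le.trans hz'.2.1.le) (by linarith)

include hx hE in
theorem hasDerivAt_gaugedSol {ψ : W} (hψ : d.B lam ψ = 0) :
    HasDerivAt (fun x => gaugedSol d M lam ψ x E)
      (-((q M k x E • d.B lam + d.R M x E) (gaugedSol d M lam ψ x E))) x := by
  have hM := h.hM
  have hN := h.N_nonneg
  have hφ := holomorphicFlow_powFlow hM hN
  have hA := h.differentiableOn_flowA_left (E := E)
  have hL := h.differentiableOn_flowL_left hE
  have hdf := ((hφ.differentiableOn_sol ψ hA hL (h.localBound hE)).differentiableAt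
    (hφ.isOpen.mem_nhds hx)).hasDerivAt
  have hx1 := truncSector.mem_slitPlane hM hN hx
  have hX : HasDerivWithinAt (fun s => powFlow M s x) (powSpeed M x) (Ici 0) 0 := by
    have := hasDerivAt_powFlow hM hN hx le_rfl
    rw [hφ.zero x hx] at this
    exact this.hasDerivWithinAt
  have ha' : HasDerivAt (d.flowA M lam E) (-q M k x E • (d.B lam * d.flowA M lam E x)) x :=
    (hasDerivAt_exp_smul_const' (d.B lam) _).scomp x (hasDerivAt_action hM h.hk hx1 E).neg
  have hAb : d.flowA M lam E x * NormedSpace.exp (action M k x E • d.B lam) = 1 :=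
    exp_neg_smul_mul_exp_smul _ _
  have hAb₂ : NormedSpace.exp (action M k x E • d.B lam) * d.flowA M lam E x = 1 :=
    exp_smul_mul_exp_neg_smul _ _
  have hb : ∀ v, NormedSpace.exp (action M k x E • d.B lam) (d.flowA M lam E x v) = v :=
    fun v => DFunLike.congr_fun hAb₂ v
  have hAb' : ∀ v, d.flowA M lam E x (NormedSpace.exp (action M k x E • d.B lam) v) = v :=
    fun v => DFunLike.congr_fun hAb v
  have key := hφ.deriv_sol ψ hA hL (h.localBound hE) hx hX ha' hb
  set Z := HolomorphicFlow.sol (powFlow M) (d.flowA M lam E) (d.flowL M lam E) ψ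
  have h1 : (-q M k x E • (d.B lam * d.flowA M lam E x))
      (NormedSpace.exp (action M k x E • d.B lam) (Z x - ψ)) = -q M k x E • d.B lam (Z x) := by
    simp only [_root_.smul_apply, mul_apply_eq_comp, hAb', map_sub, hψ,
      smul_zero, sub_zero]
  have h2 : d.flowA M lam E x (d.flowL M lam E x (Z x)) = powSpeed M x • d.R M x E (Z x) := by
    simp only [GaugeData.flowL, mul_apply_eq_comp, hAb', _root_.smul_apply]
  rw [h1, h2, ← smul_sub] at key
  have hd := smul_right_injective W (powSpeed_ne_zero hM hN hx) key
  rw [hd] at hdf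
  convert! hdf using 1
  change -((q M k x E • d.B lam + d.R M x E) (Z x)) = _
  simp only [_root_.add_apply, _root_.smul_apply, neg_smul]
  abel

include hx hE in
theorem norm_gaugedSol_sub_le (ψ : W) :
    ‖gaugedSol d M lam ψ x E - ψ‖ ≤ ‖ψ‖ * (Real.exp (2 * (boundConst M k Cc C /
      (decayRate M k / (M + 1)) * (‖x‖ ^ (M + 1)) ^ (-(decayRate M k / (M + 1))))) - 1) := by
  have hx0 : 0 < ‖x‖ := norm_pos_iff.2 (truncSector.ne_zero h.N_nonneg hx)
  have := (h.volterraBound hx hE (Real.rpow_pos_of_pos hx0 _) le_rfl).norm_sol_sub_le ψ le_rfl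
  simpa [gaugedSol, HolomorphicFlow.sol] using this

include hx in
theorem differentiableOn_gaugedSol (ψ : W) :
    DifferentiableOn ℂ (gaugedSol d M lam ψ x) (Metric.ball 0 ρ) := by
  have hM := h.hM
  have hb : ∀ E ∈ Metric.ball (0 : ℂ) ρ, ‖E‖ < ρ := fun E hE => by simpa using hE
  refine differentiableOn_volterraSol (D := Metric.ball 0 ρ) Metric.isOpen_ball
    (A := fun E s => d.flowA M lam E (powFlow M s x))
    (L := fun E s => d.flowL M lam E (powFlow M s x)) (ψ := fun _ => ψ) (c := ‖ψ‖)
    (fun E hE => h.volterraBound hx (hb E hE) one_pos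
      (Real.one_le_rpow (h.one_le.trans hx.1.le) (by linarith)))
    (fun s hs E hE => ?_) (fun s hs E hE => ?_)
    (differentiableOn_const _) (fun _ _ => le_rfl) le_rfl
  · exact ((h.differentiableAt_flowA (E := E) (powFlow_mem hM h.N_nonneg hx hs)).comp E
      (f := fun E => (powFlow M s x, E)) (by fun_prop)).differentiableWithinAt
  · exact ((h.differentiableAt_flowL (E := E) (powFlow_mem hM h.N_nonneg hx hs) (hb E hE)).comp E
      (f := fun E => (powFlow M s x, E)) (by fun_prop)).differentiableWithinAt

end RegionBound

end ODEIM

end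

/-! ### Continuation, uniqueness and dependence on `E` -/

section

open MeasureTheory Set

namespace ODEIM

section LinearUniqueness

variable {W : Type*} [NormedAddCommGroup W] [NormedSpace ℂ W] {Ω : Set ℂ} {𝒜 : ℂ → W →L[ℂ] W}
  {f : ℂ → W}

/-- A solution of a linear equation which vanishes at one end of a path vanishes at the other end.
-/
theorem eq_zero_of_hasDerivAt_of_path (h𝒜 : ContinuousOn 𝒜 Ω)
    (hf : ∀ x ∈ Ω, HasDerivAt f (𝒜 x (f x)) x) {γ γ' : ℝ → ℂ}
    (hγ : ∀ t ∈ Icc (0 : ℝ) 1, HasDerivAt γ (γ' t) t) (hγ' : ContinuousOn γ' (Icc 0 1))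
    (hγΩ : MapsTo γ (Icc 0 1) Ω) (h0 : f (γ 0) = 0) : f (γ 1) = 0 := by
  have hγc : ContinuousOn γ (Icc 0 1) := fun t ht => (hγ t ht).continuousAt.continuousWithinAt
  have hd : ∀ t ∈ Icc (0 : ℝ) 1, HasDerivAt (f ∘ γ) (γ' t • 𝒜 (γ t) (f (γ t))) t :=
    fun t ht => (hf _ (hγΩ ht)).scomp t (hγ t ht)
  obtain ⟨K, hK⟩ := isCompact_Icc.exists_bound_of_continuousOn (hγ'.smul (h𝒜.comp hγc hγΩ))
  refine eq_zero_of_abs_deriv_le_mul_abs_self_of_eq_zero_right (f := f ∘ γ) (K := K)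
    (fun t ht => (hd t ht).continuousAt.continuousWithinAt)
    (fun t ht => (hd t (Ico_subset_Icc_self ht)).hasDerivWithinAt) h0 (fun t ht => ?_) 1
    (by simp)
  exact ((γ' t • 𝒜 (γ t)).le_opNorm (f (γ t))).trans
    (mul_le_mul_of_nonneg_right (hK t (Ico_subset_Icc_self ht)) (norm_nonneg _))

theorem eq_zero_of_hasDerivAt_slitPlane (h𝒜 : ContinuousOn 𝒜 Complex.slitPlane)
    (hf : ∀ x ∈ Complex.slitPlane, HasDerivAt f (𝒜 x (f x)) x) {y : ℝ} (hy : 0 < y)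
    (h0 : f y = 0) {x : ℂ} (hx : x ∈ Complex.slitPlane) : f x = 0 := by
  have h := eq_zero_of_hasDerivAt_of_path h𝒜 hf (γ := fun t : ℝ => (y : ℂ) + t * (x - y))
    (γ' := fun _ => 1 * (x - y))
    (fun t _ => (Complex.ofRealCLM.hasDerivAt.mul_const (x - (y : ℂ))).const_add _)
    continuousOn_const (fun t ht => ?_) (by simpa using h0)
  · simpa using h
  · have := (Complex.starConvex_ofReal_slitPlane hy).add_smul_sub_mem hx ht.1 ht.2
    simpa using this

/-- The path joins the logarithms of the two points by a segment: the logarithm of a truncated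
sector is convex. -/
theorem eq_zero_of_hasDerivAt_truncSector {M N : ℝ} (hM : 0 < M) (hN : 0 ≤ N)
    (h𝒜 : ContinuousOn 𝒜 (truncSector M N))
    (hf : ∀ x ∈ truncSector M N, HasDerivAt f (𝒜 x (f x)) x) {x y : ℂ}
    (hy : y ∈ truncSector M N) (h0 : f y = 0) (hx : x ∈ truncSector M N) : f x = 0 := by
  have hx0 := truncSector.ne_zero hN hx
  have hy0 := truncSector.ne_zero hN hy
  have hd : ∀ t : ℝ, HasDerivAt (fun t : ℝ => Complex.exp (Complex.log y +
      t * (Complex.log x - Complex.log y))) (Complex.exp (Complex.log y +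
      t * (Complex.log x - Complex.log y)) * (1 * (Complex.log x - Complex.log y))) t := fun t =>
    ((Complex.ofRealCLM.hasDerivAt.mul_const (Complex.log x - Complex.log y)).const_add _).cexp
  have h := eq_zero_of_hasDerivAt_of_path h𝒜 hf (fun t _ => hd t) (by fun_prop)
    (fun t ht => ?_) (by simpa [Complex.exp_log hy0] using h0)
  · simpa [Complex.exp_log hx0] using h
  · have hπ := halfAngle_lt hM
    have hpi := Real.pi_pos
    set w := Complex.log y + t * (Complex.log x - Complex.log y)
    have hre : w.re = Real.log ‖y‖ + t * (Real.log ‖x‖ - Real.log ‖y‖) := by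
      simp [w, Complex.log_re]
    have him : w.im = y.arg + t * (x.arg - y.arg) := by simp [w, Complex.log_im]
    have hx2 := abs_lt.1 hx.2
    have hy2 := abs_lt.1 hy.2
    have hst : (0 : ℝ) ≤ 1 - t := by linarith [ht.2]
    have him' : |w.im| < halfAngle M := by
      rw [him, abs_lt]
      rcases ht.1.eq_or_lt with h | h
      · rw [← h]; constructor <;> linarith
      · constructor <;> nlinarith
    constructor
    · rw [Complex.norm_exp, hre]
      have h1 : min ‖x‖ ‖y‖ ≤ Real.exp (Real.log ‖y‖ + t * (Real.log ‖x‖ - Real.log ‖y‖)) := by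
        have hm : 0 < min ‖x‖ ‖y‖ := lt_min (norm_pos_iff.2 hx0) (norm_pos_iff.2 hy0)
        rw [← Real.log_le_iff_le_exp hm]
        have h2 := Real.log_le_log hm (min_le_left _ _)
        have h3 := Real.log_le_log hm (min_le_right _ _)
        nlinarith [ht.1]
      exact (lt_min hx.1 hy.1).trans_le h1
    · have h1 : (Complex.exp w).arg = w.im := by
        rw [← Complex.log_im, Complex.log_exp] <;> linarith [abs_lt.1 him']
      change |(Complex.exp w).arg| < _
      rwa [h1]

end LinearUniqueness

section Filters

theorem sectorInfty_mono {φ φ' : ℝ} (h : φ ≤ φ') : sectorInfty φ ≤ sectorInfty φ' :=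
  inf_le_inf_left _ (principal_mono.2 fun _ hx => lt_of_lt_of_le hx h)

theorem realInfty_le_sectorInfty {φ : ℝ} (hφ : 0 < φ) : realInfty ≤ sectorInfty φ := by
  refine le_inf ?_ ?_
  · rw [← comap_norm_atTop, ← map_le_iff_le_comap, realInfty, map_map]
    exact tendsto_abs_atTop_atTop.congr fun x => (Complex.norm_real x).symm
  · rw [le_principal_iff, realInfty, mem_map]
    filter_upwards [eventually_ge_atTop 0] with x hx
    simpa [Complex.arg_ofReal_of_nonneg hx] using hφ

theorem ofReal_mem_truncSector {M N y : ℝ} (hM : 0 < M) (hN : 0 ≤ N) (hy : N < y) :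
    (y : ℂ) ∈ truncSector M N := by
  have hy0 := hN.trans hy.le
  refine ⟨by simpa [abs_of_nonneg hy0] using hy, ?_⟩
  simpa [Complex.arg_ofReal_of_nonneg hy0] using halfAngle_pos hM

theorem powFlow_ofReal {M s y : ℝ} (hs : 0 ≤ s) (hy : 0 ≤ y) :
    powFlow M s y = ((y ^ (M + 1) + s) ^ (M + 1)⁻¹ : ℝ) := by
  rw [powFlow, ← Complex.ofReal_cpow hy, ← Complex.ofReal_add,
    ← Complex.ofReal_cpow (by positivity)]

theorem tendsto_powFlow_realInfty {M y : ℝ} (hM : 0 < M) (hy : 0 ≤ y) :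
    Tendsto (fun s : ℝ => powFlow M s y) atTop realInfty := by
  have h : Tendsto (fun s : ℝ => (y ^ (M + 1) + s) ^ (M + 1)⁻¹) atTop atTop :=
    (tendsto_rpow_atTop (by positivity)).comp (tendsto_atTop_add_const_left _ _ tendsto_id)
  refine (tendsto_map.comp h).congr' ?_
  filter_upwards [eventually_ge_atTop 0] with s hs
  exact (powFlow_ofReal hs hy).symm

theorem eventually_mem_truncSector {M N : ℝ} :
    ∀ᶠ x in sectorInfty (halfAngle M), x ∈ truncSector M N := by
  have h1 : ∀ᶠ x in sectorInfty (halfAngle M), N < ‖x‖ :=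
    (tendsto_norm_cobounded_atTop.mono_left inf_le_left).eventually_gt_atTop N
  exact h1.and (mem_inf_of_right (mem_principal_self _))

theorem tendsto_prodMk_unifInfty (φ : ℝ) (E : ℂ) :
    Tendsto (fun x : ℂ => (x, E)) (sectorInfty φ) (unifInfty φ (‖E‖ + 1)) := by
  refine tendsto_id.prodMk (tendsto_principal.2 (Eventually.of_forall fun _ => ?_))
  simp

theorem tendsto_G_sectorInfty {𝔸 : Type*} [NormedRing 𝔸] [NormedAlgebra ℂ 𝔸] {k : ℕ}
    (d : GaugeData 𝔸 k) {M : ℝ} (hM : 0 < M) (hk : k ≠ 0) (φ : ℝ) (E : ℂ) :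
    Tendsto (fun x => d.G M x E) (sectorInfty φ) (𝓝 1) := by
  have h := tendsto_G (φ := φ) (ρ := ‖E‖ + 1) d hM hk
  have h2 := h.comp (tendsto_prodMk_unifInfty φ E)
  exact h2

end Filters

section Solutions

variable {W : Type*} [NormedAddCommGroup W] [NormedSpace ℂ W] {k : ℕ}

/-- The leading asymptotics `Φ = exp (-lam S) q ^ (-h) (ψ + o(1))` along the filter `F`. -/
def GaugeData.HasLeading (d : GaugeData (W →L[ℂ] W) k) (M : ℝ) (lam : ℂ) (E : ℂ) (ψ : W)
    (F : Filter ℂ) (Φ : ℂ → W) : Prop :=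
  ∃ r : ℂ → W, Tendsto r F (𝓝 0) ∧ ∀ᶠ x in F,
    Φ x = Complex.exp (-lam * action M k x E) • d.P M x E (ψ + r x)

/-- `Φ` solves the linear equation on the slit plane. -/
def GaugeData.Solves (d : GaugeData (W →L[ℂ] W) k) (M : ℝ) (E : ℂ) (Φ : ℂ → W) : Prop :=
  ∀ x ∈ Complex.slitPlane, HasDerivAt Φ (-(d.conn M x E (Φ x))) x

variable [CompleteSpace W] {d : GaugeData (W →L[ℂ] W) k} {M : ℝ} {lam : ℂ} {ρ ε Cc C N : ℝ}

omit [CompleteSpace W] in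
theorem continuousOn_neg_conn (d : GaugeData (W →L[ℂ] W) k) (E : ℂ) :
    ContinuousOn (fun x => -d.conn M x E) Complex.slitPlane := fun x hx =>
  ((differentiableAt_conn d (M := M) (p := (x, E)) hx).comp x (f := fun x => (x, E))
    (by fun_prop)).neg.continuousAt.continuousWithinAt

namespace RegionBound

variable (h : RegionBound d M lam ρ ε Cc C N) {E : ℂ} (hE : ‖E‖ < ρ)
include h hE

/-- If `δ` solves the linear equation then `T⁻¹ δ` solves the transformed equation. -/
theorem hasDerivAt_inverse_T {δ : ℂ → W} (hδ : d.Solves M E δ) {x : ℂ} (hx : x ∈ truncSector M N) :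
    HasDerivAt (fun x => Ring.inverse (d.T M lam x E) (δ x))
      (-((q M k x E • d.B lam + d.R M x E) (Ring.inverse (d.T M lam x E) (δ x)))) x := by
  have hM := h.hM
  have hs := truncSector.mem_slitPlane hM h.N_nonneg hx
  have hT := d.hasDerivAt_T lam hM h.hk hs (h.q_mem_slitPlane hE hx) (h.unit x hx E hE)
  have hU := isUnit_T d (M := M) (lam := lam) (h.unit x hx E hE)
  have hdi := ((differentiableAt_inverse (𝕜 := ℂ) hU).comp x hT.differentiableAt).clm_apply
    (hδ x hs).differentiableAt
  set D := fun x => Ring.inverse (d.T M lam x E) (δ x) with hD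
  have hdi' : HasDerivAt D (deriv D x) x := hdi.hasDerivAt
  have hev : (fun x => d.T M lam x E (D x)) =ᶠ[𝓝 x] δ := by
    filter_upwards [(isOpen_truncSector hM h.N_nonneg).mem_nhds hx] with y hy
    exact DFunLike.congr_fun (Ring.mul_inverse_cancel _
      (isUnit_T d (M := M) (lam := lam) (h.unit y hy E hE))) (δ y)
  have h1 := (hT.clm_apply hdi').congr_of_eventuallyEq hev.symm
  have h2 := h1.unique (hδ x hs)
  rw [← hev.self_of_nhds] at h2
  have h3 : d.T M lam x E (deriv D x) =
      d.T M lam x E (-((q M k x E • d.B lam + d.R M x E) (D x))) := by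
    rw [map_neg, ← sub_eq_zero, sub_neg_eq_add]
    rw [← sub_eq_zero] at h2
    rw [← h2]
    simp only [GaugeData.B, _root_.add_apply, _root_.neg_apply, mul_apply_eq_comp, map_add]
    abel
  have h4 : deriv D x = -((q M k x E • d.B lam + d.R M x E) (D x)) := by
    have h5 := congrArg (fun v => (Ring.inverse (d.T M lam x E) : W →L[ℂ] W) v) h3
    have h6 : ∀ v, Ring.inverse (d.T M lam x E) (d.T M lam x E v) = v := fun v =>
      DFunLike.congr_fun (Ring.inverse_mul_cancel _ hU) v
    simpa only [h6] using h5
  rwa [h4] at hdi'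

/-- A solution which is `o(1)` relative to the leading asymptotics on the positive real axis
vanishes. -/
theorem eq_zero_of_hasLeading_zero {δ : ℂ → W} (hδ : d.Solves M E δ)
    (hlead : d.HasLeading M lam E 0 realInfty δ) {x : ℂ} (hx : x ∈ Complex.slitPlane) :
    δ x = 0 := by
  have hM := h.hM
  have hN := h.N_nonneg
  obtain ⟨r, hr, hδr⟩ := hlead
  set y : ℝ := N + 1 with hy
  have hy0 : 0 < y := by linarith
  have hyN : (y : ℂ) ∈ truncSector M N := ofReal_mem_truncSector hM hN (by linarith)
  have hflow := tendsto_powFlow_realInfty hM hy0.le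
  have hle := realInfty_le_sectorInfty (halfAngle_pos hM)
  set D := fun x => Ring.inverse (d.T M lam x E) (δ x) with hD
  -- `D = G⁻¹ r` tends to zero along the real axis
  have hDlim : Tendsto D realInfty (𝓝 0) := by
    have hG := (tendsto_G_sectorInfty d hM h.hk (halfAngle M) E).mono_left hle
    have hGi : Tendsto (fun x => Ring.inverse (d.G M x E)) realInfty (𝓝 1) := by
      have h1 : ContinuousAt Ring.inverse (1 : W →L[ℂ] W) := by
        simpa using NormedRing.inverse_continuousAt (1 : (W →L[ℂ] W)ˣ)
      have := h1.tendsto.comp hG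
      simpa [Function.comp_def] using this
    have h2 := ((isBoundedBilinearMap_apply (𝕜 := ℂ) (E := W) (F := W)).continuous.tendsto
      (1, 0)).comp (hGi.prodMk_nhds hr)
    simp only [map_zero] at h2
    refine h2.congr' ?_
    filter_upwards [hδr, hle (eventually_mem_truncSector (N := N))] with z hz hzN
    have hGu := h.unit z hzN E hE
    have h3 : ∀ v, d.G M z E (Ring.inverse (d.G M z E) v) = v := fun v =>
      DFunLike.congr_fun (Ring.mul_inverse_cancel _ hGu) v
    have h4 : d.T M lam z E (Ring.inverse (d.G M z E) (r z)) = δ z := by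
      rw [hz, zero_add]
      simp only [GaugeData.T, _root_.smul_apply, mul_apply_eq_comp, h3]
    rw [hD]
    simp only
    rw [← h4]
    exact (DFunLike.congr_fun (Ring.inverse_mul_cancel _ (isUnit_T d hGu)) _).symm
  have hUD : ∀ z ∈ truncSector M N, HasDerivAt
      (fun z => NormedSpace.exp (action M k z E • d.B lam) (D z))
      (-(NormedSpace.exp (action M k z E • d.B lam) (d.R M z E (D z)))) z := by
    intro z hz
    have h1 : HasDerivAt (fun z => NormedSpace.exp (action M k z E • d.B lam)) _ z :=
      (hasDerivAt_exp_smul_const (d.B lam) _).scomp z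
        (hasDerivAt_action hM h.hk (truncSector.mem_slitPlane hM hN hz) E)
    have h2 := h1.clm_apply (h.hasDerivAt_inverse_T hE hδ hz)
    convert! h2 using 1
    simp only [_root_.add_apply, _root_.smul_apply, mul_apply_eq_comp, map_neg, map_add, map_smul]
    abel
  have hf : ∀ s : ℝ, 0 ≤ s → HasDerivAt (fun t : ℝ =>
      NormedSpace.exp (action M k (powFlow M t y) E • d.B lam) (D (powFlow M t y)))
      (-(d.flowL M lam E (powFlow M s y) (D (powFlow M s y)))) s := by
    intro s hs
    have h1 := (hUD _ (powFlow_mem hM hN hyN hs)).scomp s (hasDerivAt_powFlow hM hN hyN hs)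
    convert! h1 using 1
    simp only [GaugeData.flowL, mul_apply_eq_comp, _root_.smul_apply, map_smul, smul_neg]
  have hz := (h.volterraBound hyN hE one_pos (Real.one_le_rpow (h.one_le.trans hyN.1.le)
    (by linarith))).eventually_eq_zero
    (U := fun t => NormedSpace.exp (action M k (powFlow M t y) E • d.B lam))
    (f := fun t => D (powFlow M t y)) hf
    (fun s _ v => DFunLike.congr_fun (exp_neg_smul_mul_exp_smul (d.B lam) _) v)
    (fun s t hs hst => h.norm_exp_action_sub_le hyN hE hs hst) (hDlim.comp hflow)
  obtain ⟨s, hs0, hs⟩ := (hz.and (eventually_ge_atTop 0)).exists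
  have hmem := powFlow_mem hM hN hyN hs
  have h1 : δ (powFlow M s y) = 0 := by
    have h2 : d.T M lam (powFlow M s y) E (D (powFlow M s y)) = δ (powFlow M s y) :=
      DFunLike.congr_fun (Ring.mul_inverse_cancel _ (isUnit_T d (h.unit _ hmem E hE))) _
    rw [← h2, hs0, map_zero]
  rw [powFlow_ofReal hs hy0.le] at h1
  refine eq_zero_of_hasDerivAt_slitPlane (𝒜 := fun x => -d.conn M x E)
    (continuousOn_neg_conn d E) hδ (by positivity) h1 hx

theorem eqOn_of_hasLeading {ψ : W} {Φ₁ Φ₂ : ℂ → W} (h₁ : d.Solves M E Φ₁) (h₂ : d.Solves M E Φ₂)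
    (hl₁ : d.HasLeading M lam E ψ realInfty Φ₁) (hl₂ : d.HasLeading M lam E ψ realInfty Φ₂) :
    EqOn Φ₁ Φ₂ Complex.slitPlane := by
  intro x hx
  rw [← sub_eq_zero]
  refine h.eq_zero_of_hasLeading_zero hE (δ := fun x => Φ₁ x - Φ₂ x) (fun x hx => ?_) ?_ hx
  · convert! (h₁ x hx).sub (h₂ x hx) using 1
    rw [map_sub]; abel
  · obtain ⟨r₁, hr₁, he₁⟩ := hl₁
    obtain ⟨r₂, hr₂, he₂⟩ := hl₂
    refine ⟨fun x => r₁ x - r₂ x, by simpa using hr₁.sub hr₂, ?_⟩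
    filter_upwards [he₁, he₂] with x h1 h2
    rw [h1, h2, ← smul_sub, ← map_sub]
    congr 2
    abel

omit hE in
/-- The solution with the prescribed asymptotics, for all `E` in a disc: `T Z` on a truncated
sector, continued to the slit plane by solving an initial value problem. -/
theorem exists_solution {ψ : W} (hψ : d.B lam ψ = 0) :
    ∃ Y : ℂ → ℂ → W, (∀ E : ℂ, ‖E‖ < ρ → d.Solves M E (fun x => Y x E) ∧
      d.HasLeading M lam E ψ (sectorInfty (halfAngle M)) (fun x => Y x E)) ∧
      ∀ x ∈ Complex.slitPlane, DifferentiableOn ℂ (Y x) (Metric.ball 0 ρ) := by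
  have hM := h.hM
  have hN := h.N_nonneg
  set y : ℝ := N + 1 with hy
  have hy0 : 0 < y := by linarith
  have hyN : (y : ℂ) ∈ truncSector M N := ofReal_mem_truncSector hM hN (by linarith)
  have hys := truncSector.mem_slitPlane hM hN hyN
  have hb : ∀ E ∈ Metric.ball (0 : ℂ) ρ, ‖E‖ < ρ := fun E hE => by simpa using hE
  have h𝒜 : DifferentiableOn ℂ (fun p : ℂ × ℂ => -d.conn M p.1 p.2)
      (Complex.slitPlane ×ˢ Metric.ball 0 ρ) := fun p hp =>
    (differentiableAt_conn d hp.1).neg.differentiableWithinAt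
  have hv : DifferentiableOn ℂ (fun E => d.T M lam y E (gaugedSol d M lam ψ y E))
      (Metric.ball 0 ρ) := by
    intro E hE
    refine DifferentiableWithinAt.clm_apply ?_ (h.differentiableOn_gaugedSol hyN ψ E hE)
    exact ((differentiableAt_T d (p := ((y : ℂ), E)) hM h.hk hys
      (h.q_mem_slitPlane (hb E hE) hyN)).comp E (f := fun E => ((y : ℂ), E))
        (by fun_prop)).differentiableWithinAt
  obtain ⟨Y, hY, hYE⟩ := exists_hasDerivAt_starConvex Complex.isOpen_slitPlane
    Metric.isOpen_ball hys (Complex.starConvex_ofReal_slitPlane hy0)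
    (𝒜 := fun x E => -d.conn M x E) h𝒜 hv
  refine ⟨Y, fun E hE => ?_, hYE⟩
  obtain ⟨hY0, hYd⟩ := hY E (by simpa using hE)
  have hsol : d.Solves M E (fun x => Y x E) := hYd
  have heq : ∀ x ∈ truncSector M N, Y x E = d.T M lam x E (gaugedSol d M lam ψ x E) := by
    intro x hx
    rw [← sub_eq_zero]
    refine eq_zero_of_hasDerivAt_truncSector
      (f := fun x => Y x E - d.T M lam x E (gaugedSol d M lam ψ x E))
      (𝒜 := fun x => -d.conn M x E) hM hN
      ((continuousOn_neg_conn d E).mono fun z hz => truncSector.mem_slitPlane hM hN hz)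
      (fun z hz => ?_) hyN ?_ hx
    · have hzs := truncSector.mem_slitPlane hM hN hz
      have hT := d.hasDerivAt_T lam hM h.hk hzs (h.q_mem_slitPlane hE hz) (h.unit z hz E hE)
      convert! (hsol z hzs).sub (hT.clm_apply (h.hasDerivAt_gaugedSol hz hE hψ)) using 1
      simp only [GaugeData.B, _root_.add_apply, _root_.neg_apply, mul_apply_eq_comp, map_add,
        map_sub, map_neg]
      abel
    · simp only [hY0, sub_self]
  have hpos : 0 < decayRate M k / (M + 1) := div_pos (decayRate_pos hM h.hk) (by linarith)
  refine ⟨hsol, fun x => d.G M x E (gaugedSol d M lam ψ x E) - ψ, ?_, ?_⟩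
  · have hnorm : Tendsto (fun x : ℂ => ‖x‖) (sectorInfty (halfAngle M)) atTop :=
      tendsto_norm_cobounded_atTop.mono_left inf_le_left
    have h1 : Tendsto (fun x : ℂ => (‖x‖ ^ (M + 1)) ^ (-(decayRate M k / (M + 1))))
        (sectorInfty (halfAngle M)) (𝓝 0) :=
      (tendsto_rpow_neg_atTop hpos).comp
        ((tendsto_rpow_atTop (by linarith : 0 < M + 1)).comp hnorm)
    have h2 := (((Real.continuous_exp.tendsto _).comp ((h1.const_mul (boundConst M k Cc C /
      (decayRate M k / (M + 1)))).const_mul 2)).sub_const 1).const_mul ‖ψ‖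
    simp only [mul_zero, Real.exp_zero, sub_self] at h2
    have hZ : Tendsto (fun x => gaugedSol d M lam ψ x E) (sectorInfty (halfAngle M)) (𝓝 ψ) := by
      rw [tendsto_iff_norm_sub_tendsto_zero]
      refine squeeze_zero' (Eventually.of_forall fun _ => norm_nonneg _) ?_ h2
      filter_upwards [eventually_mem_truncSector (N := N)] with x hx
      exact h.norm_gaugedSol_sub_le hx hE ψ
    have h3 := (((isBoundedBilinearMap_apply (𝕜 := ℂ) (E := W) (F := W)).continuous.tendsto
      (1, ψ)).comp ((tendsto_G_sectorInfty d hM h.hk (halfAngle M) E).prodMk_nhds hZ)).sub_const ψ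
    simpa using h3
  · filter_upwards [eventually_mem_truncSector (N := N)] with x hx
    rw [heq x hx, add_sub_cancel]
    simp only [GaugeData.T, _root_.smul_apply, mul_apply_eq_comp]

end RegionBound

theorem exists_regionBound (d : GaugeData (W →L[ℂ] W) k) (hM : 0 < M) (hk : k ≠ 0) (hε : 0 < ε)
    (hcone : ∀ τ : ℝ, 0 ≤ τ → ∀ z : ℂ, ‖z - τ‖ ≤ ε * τ → ‖NormedSpace.exp (z • d.B lam)‖ ≤ Cc)
    (ρ : ℝ) : ∃ C N, RegionBound d M lam ρ ε Cc C N := by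
  obtain ⟨N, hN, C, hC, H⟩ := exists_region d hM hk ρ hε
  exact ⟨C, N, hM, hk, hN, hC, hcone, fun x hx E hE => (H x E hx.1 hx.2 hE).1,
    fun x hx E hE => (H x E hx.1 hx.2 hE).2.1, fun x hx E hE => (H x E hx.1 hx.2 hE).2.2.1,
    fun x hx E hE => (H x E hx.1 hx.2 hE).2.2.2⟩

omit [CompleteSpace W] in
theorem GaugeData.HasLeading.mono {E : ℂ} {ψ : W} {F F' : Filter ℂ} {Φ : ℂ → W}
    (h : d.HasLeading M lam E ψ F Φ) (hF : F' ≤ F) : d.HasLeading M lam E ψ F' Φ := by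
  obtain ⟨r, hr, he⟩ := h
  exact ⟨r, hr.mono_left hF, he.filter_mono hF⟩

/-- The solutions constructed on discs in the `E`-plane of increasing radii agree by uniqueness, and
define an entire function of `E`. -/
theorem exists_entire_solution (d : GaugeData (W →L[ℂ] W) k) (hM : 0 < M) (hk : k ≠ 0)
    (hε : 0 < ε)
    (hcone : ∀ τ : ℝ, 0 ≤ τ → ∀ z : ℂ, ‖z - τ‖ ≤ ε * τ → ‖NormedSpace.exp (z • d.B lam)‖ ≤ Cc)
    {ψ : W} (hψ : d.B lam ψ = 0) :
    ∃ Ψ : ℂ → ℂ → W,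
      (∀ E, d.Solves M E (fun x => Ψ x E) ∧
        d.HasLeading M lam E ψ (sectorInfty (halfAngle M)) (fun x => Ψ x E) ∧
        ∀ Φ : ℂ → W, d.Solves M E Φ → d.HasLeading M lam E ψ realInfty Φ →
          EqOn Φ (fun x => Ψ x E) Complex.slitPlane) ∧
      ∀ x ∈ Complex.slitPlane, Differentiable ℂ (Ψ x) := by
  choose C N h using exists_regionBound d hM hk hε hcone
  choose Y hY hYE using fun ρ => (h ρ).exists_solution hψ
  have hlt : ∀ E : ℂ, ‖E‖ < ‖E‖ + 1 := fun E => lt_add_one _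
  have hle := realInfty_le_sectorInfty (halfAngle_pos hM)
  refine ⟨fun x E => Y (‖E‖ + 1) x E, fun E => ?_, fun x hx E => ?_⟩
  · obtain ⟨h1, h2⟩ := hY _ E (hlt E)
    exact ⟨h1, h2, fun Φ hΦ hl => (h _).eqOn_of_hasLeading (hlt E) hΦ h1 hl (h2.mono hle)⟩
  · refine ((hYE (‖E‖ + 1) x hx).differentiableAt
      (Metric.isOpen_ball.mem_nhds (by simp))).congr_of_eventuallyEq ?_
    filter_upwards [Metric.isOpen_ball.mem_nhds (by simp : E ∈ Metric.ball 0 (‖E‖ + 1))]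
      with E' hE'
    have hE'' : ‖E'‖ < ‖E‖ + 1 := by simpa using hE'
    obtain ⟨h1, h2⟩ := hY _ E' (hlt E')
    obtain ⟨h3, h4⟩ := hY _ E' hE''
    exact (h _).eqOn_of_hasLeading (hlt E') h1 h3 (h2.mono hle) (h4.mono hle) hx

end Solutions

end ODEIM

end

/-! ### The evaluation representation as gauge data -/

namespace ODEIM

section EvaluationGauge

variable (X : ADEType) {𝔤 : Type*} [LieRing 𝔤] [LieAlgebra ℂ 𝔤] {H : LieSubalgebra ℂ 𝔤}
  [H.IsCartanSubalgebra] (b : LieAlgebra.Basis (Fin X.rank) H)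
  (V : Type*) [NormedAddCommGroup V] [NormedSpace ℂ V] [FiniteDimensional ℂ V]
  [LieRingModule 𝔤 V] [LieModule ℂ 𝔤 V]

/-- The evaluation representation provides the operators of the abstract equation. -/
theorem exists_gaugeData (k : ℕ) {e e₀ : Affine 𝔤 k}
    (he : e = ∑ i, Affine.mon k 0 (b.e i)) {a : 𝔤} (ha : IsLowestRootVector b a)
    (he₀ : e₀ = Affine.mon k 1 a) (h ell : H)
    (hhe : ⁅Affine.mon k 0 (h : 𝔤), e⁆ = e)
    (hhe₀ : ⁅Affine.mon k 0 (h : 𝔤), e₀⁆ = (-((k : ℂ) - 1)) • e₀) (ζ : ℂˣ) :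
    ∃ d : GaugeData (V →L[ℂ] V) k,
      d.e = LinearMap.toContinuousLinearMap (evalRep V k ζ e) ∧
      d.e₀ = LinearMap.toContinuousLinearMap (evalRep V k ζ e₀) ∧
      d.h = LinearMap.toContinuousLinearMap (evalRep V k ζ (Affine.mon k 0 (h : 𝔤))) ∧
      d.ell = LinearMap.toContinuousLinearMap (evalRep V k ζ (Affine.mon k 0 (ell : 𝔤))) := by
  obtain ⟨Fh, hFh⟩ := exists_commutator_eq_evalRep (V := V) b k ζ he ha he₀ h
  obtain ⟨Fl, hFl⟩ := exists_commutator_eq_evalRep (V := V) b k ζ he ha he₀ ell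
  rw [map_add] at hFh hFl
  have h1 := evalRep_mul_of_lie_eq_smul (V := V) k ζ (r := 1) (hhe.trans (one_smul _ _).symm)
  have h2 := evalRep_mul_of_lie_eq_smul (V := V) k ζ hhe₀
  have h3 := evalRep_cartan_commute (V := V) b k ζ h ell
  set τ := (LinearMap.toContinuousLinearMap : Module.End ℂ V ≃ₗ[ℂ] (V →L[ℂ] V))
  exact ⟨⟨τ (evalRep V k ζ e), τ (evalRep V k ζ e₀), τ (evalRep V k ζ (Affine.mon k 0 (h : 𝔤))),
    τ (evalRep V k ζ (Affine.mon k 0 (ell : 𝔤))), τ Fh, τ Fl, congrArg τ h1, congrArg τ h2,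
    congrArg τ h3, congrArg τ hFh, congrArg τ hFl⟩, rfl, rfl, rfl, rfl⟩

end EvaluationGauge

end ODEIM

open ODEIM in
/-- Asymptotics of the subdominant solution in an evaluation representation in which
`Λ = e₀ + e` has a maximal eigenvalue. -/
theorem theorem3p2
    -- a simple Lie algebra of type ADE with Cartan subalgebra `H` and Chevalley generators `b`
    (X : ADEType) {𝔤 : Type*} [LieRing 𝔤] [LieAlgebra ℂ 𝔤] [FiniteDimensional ℂ 𝔤]
    [LieAlgebra.IsSimple ℂ 𝔤] (H : LieSubalgebra ℂ 𝔤) [H.IsCartanSubalgebra]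
    (b : LieAlgebra.Basis (Fin X.rank) H) (hb : b.A = X.cartanMatrix)
    -- the generators `e = ∑ e i` and `e₀ = a ⊗ t`, `a` a lowest root vector
    (e e₀ : Affine 𝔤 X.dualCoxeter)
    (he : e = ∑ i, Affine.mon X.dualCoxeter 0 (b.e i))
    (a : 𝔤) (ha : IsLowestRootVector b a) (he₀ : e₀ = Affine.mon X.dualCoxeter 1 a)
    -- the grading element `h` and the element `ℓ` of the Cartan subalgebra
    (h ell : H)
    (hhe : ⁅Affine.mon X.dualCoxeter 0 (h : 𝔤), e⁆ = e)
    (hhe₀ : ⁅Affine.mon X.dualCoxeter 0 (h : 𝔤), e₀⁆ = (-((X.dualCoxeter : ℂ) - 1)) • e₀)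
    (M : ℝ) (hM : 0 < M)
    -- the evaluation representation `V(ζ)`
    (V : Type*) [NormedAddCommGroup V] [NormedSpace ℂ V] [FiniteDimensional ℂ V]
    [LieRingModule 𝔤 V] [LieModule ℂ 𝔤 V] (ζ : ℂˣ)
    -- the maximal eigenvalue of `Λ` and its eigenvector
    (lam : ℝ) (hlam : IsMaximalEigenvalue (evalRep V X.dualCoxeter ζ (e₀ + e)) lam)
    (ψ : V) (hψ : (evalRep V X.dualCoxeter ζ (e₀ + e)).HasEigenvector (lam : ℂ) ψ) :
    ∃ Ψ : ℂ → ℂ → V,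
      -- `Ψ(·, E)` is a solution with the prescribed asymptotics, and the only one
      (∀ E : ℂ,
        IsSolution M X.dualCoxeter ζ (Affine.mon X.dualCoxeter 0 (ell : 𝔤)) e e₀ E
          (fun x => Ψ x E) ∧
        HasAsymptotics M X.dualCoxeter lam
          (evalRep V X.dualCoxeter ζ (Affine.mon X.dualCoxeter 0 (h : 𝔤))) ψ E realInfty
          (fun x => Ψ x E) ∧
        ∀ Φ : ℂ → V,
          IsSolution M X.dualCoxeter ζ (Affine.mon X.dualCoxeter 0 (ell : 𝔤)) e e₀ E Φ →
          HasAsymptotics M X.dualCoxeter lam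
            (evalRep V X.dualCoxeter ζ (Affine.mon X.dualCoxeter 0 (h : 𝔤))) ψ E realInfty Φ →
          Set.EqOn Φ (fun x => Ψ x E) Complex.slitPlane) ∧
      -- the same asymptotics hold in the sector
      (∀ E : ℂ, ∀ δ : ℝ, 0 < δ →
        HasAsymptotics M X.dualCoxeter lam
          (evalRep V X.dualCoxeter ζ (Affine.mon X.dualCoxeter 0 (h : 𝔤))) ψ E
          (sectorInfty (Real.pi / (2 * (M + 1)) - δ)) (fun x => Ψ x E)) ∧
      -- `Ψ(x, ·)` is entire
      (∀ x ∈ Complex.slitPlane, Differentiable ℂ (fun E => Ψ x E)) := by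
  have hV : CompleteSpace V := FiniteDimensional.complete ℂ V
  have hk : X.dualCoxeter ≠ 0 := (lt_of_lt_of_le two_pos X.two_le_dualCoxeter).ne'
  obtain ⟨d, hde, hde₀, hdh, hdl⟩ :=
    exists_gaugeData X b V X.dualCoxeter he ha he₀ h ell hhe hhe₀ ζ
  obtain ⟨ε, hε, Cc, hcone⟩ := exists_cone_bound hlam
  have hB : d.B lam = LinearMap.toContinuousLinearMap (evalRep V X.dualCoxeter ζ (e₀ + e)) -
      (lam : ℂ) • (1 : V →L[ℂ] V) := by
    rw [GaugeData.B, hde, hde₀, map_add (evalRep V X.dualCoxeter ζ), map_add]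
  rw [← hB] at hcone
  have hBψ : d.B lam ψ = 0 := by
    have h1 := hψ.apply_eq_smul
    rw [hB]
    simp only [_root_.sub_apply, _root_.smul_apply, LinearMap.coe_toContinuousLinearMap', h1,
      one_apply_eq_self, sub_self]
  have hconn : ∀ x E v, d.conn M x E v = evalRep V X.dualCoxeter ζ
      (x⁻¹ • Affine.mon X.dualCoxeter 0 (ell : 𝔤) + e + pot M X.dualCoxeter x E • e₀) v := by
    intro x E v
    rw [GaugeData.conn, hde, hde₀, hdl]
    simp only [map_add, map_smul, _root_.add_apply, _root_.smul_apply, LinearMap.add_apply,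
      LinearMap.smul_apply, LinearMap.coe_toContinuousLinearMap']
  have hpow : ∀ x E, opPow (q M X.dualCoxeter x E)
      (-evalRep V X.dualCoxeter ζ (Affine.mon X.dualCoxeter 0 (h : 𝔤))) = d.P M x E := by
    intro x E
    rw [opPow, GaugeData.P, hdh, map_neg, smul_neg, neg_smul]
  have hsol : ∀ E Φ, IsSolution M X.dualCoxeter ζ (Affine.mon X.dualCoxeter 0 (ell : 𝔤)) e e₀ E Φ ↔
      d.Solves M E Φ := by
    intro E Φ
    simp only [IsSolution, GaugeData.Solves, hconn]
  have hasy : ∀ E F Φ, HasAsymptotics M X.dualCoxeter lam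
      (evalRep V X.dualCoxeter ζ (Affine.mon X.dualCoxeter 0 (h : 𝔤))) ψ E F Φ ↔
      d.HasLeading M lam E ψ F Φ := by
    intro E F Φ
    simp only [HasAsymptotics, GaugeData.HasLeading, hpow]
  simp only [hsol, hasy]
  obtain ⟨Ψ, hΨ, hΨE⟩ := exists_entire_solution d hM hk hε hcone hBψ
  refine ⟨Ψ, fun E => ⟨(hΨ E).1, (hΨ E).2.1.mono (realInfty_le_sectorInfty (halfAngle_pos hM)),
    (hΨ E).2.2⟩, fun E δ hδ => (hΨ E).2.1.mono (sectorInfty_mono ?_), hΨE⟩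
  rw [halfAngle]
  linarith
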